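/- **Setting.** Let $d\ge 2$ and let $\Omega^{A},\Omega^{B}\subset\mathbb R^d$ be disjoint bounded Lipschitz domains with boundaries $\Gamma^\eta=\partial\Omega^\eta$ ($\eta=A,B$). Let $\Gamma_C=\Gamma^A\cap\Gamma^B$, and let $\Gamma_D^\eta\neq\emptyset$ and $\Gamma_N^\eta$ be relatively open disjoint parts of $\Gamma^\eta$, with $\Gamma_N^\eta\cap\Gamma_C=\emptyset$, $\overline{\Gamma_D^\eta}\cap\Gamma_C=\emptyset$ and $\Gamma^\eta=\overline{\Gamma_D^\eta}\cup\overline{\Gamma_N^\eta}\cup\Gamma_C$. Let $n^B$ be the unit outward normal of $\Omega^B$. For $u=(u^A,u^B)$ with $u^\eta\in H^1(\Omega^\eta;\mathbb R^d)$, put $e(u)=\tfrac12(\nabla u+(\nabla u)^\top)$ and, on $\Gamma_C$, in the sense of traces, $[u]=u^A-u^B$, $[u]_n=[u]\cdot n^B$, $[u]_t=[u]-[u]_n n^B$. Let $\mathbb C^\eta,\mathbb D^\eta$ be symmetric positive-definite fourth-order tensors of elastic and viscous moduli (constant on each body), let $\mu>0$, and let $\gamma:\mathbb R\to[0,\infty)$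 be convex, nonincreasing and $C^1$. For $g=(g^A,g^B)$ with $g^\eta\in L^2(\Gamma_D^\eta;\mathbb R^d)$ define $$E(g;u)=\sum_{\eta}\int_{\Omega^\eta}\tfrac12\,e(u^\eta):\mathbb C^\eta:e(u^\eta)\,d\Omega+\int_{\Gamma_C}\gamma([u]_n)\,d\Gamma\ \text{ if } u^\eta|_{\Gamma_D^\eta}=g^\eta\ (\eta=A,B),\qquad E(g;u)=+\infty\ \text{ otherwise},$$ $$R_1(u;v)=\int_{\Gamma_C}-\mu\,\gamma'([u]_n)\,\bigl|[v]_t\bigr|\,d\Gamma,\qquad R_2(v)=\sum_{\eta}\int_{\Omega^\eta}\tfrac12\,e(v^\eta):\mathbb D^\eta:e(v^\eta)\,d\Omega,\qquad R(u;v)=R_1(u;v)+R_2(v).$$ Let $T=N\tau$ with $\tau>0$, $N\in\mathbb N$. For $t\in[0,T]$ let $g_D(t)$ be Dirichlet data and let $f_N^\eta(t)\in L^2(\Gamma_N^\eta;\mathbb R^d)$ be surface loads, with $\langle F(t),v\rangle=\sum_\eta\int_{\Gamma_N^\eta}f_N^\eta(t)\cdot v^\eta\,d\Gamma$. Let $u_D(t)=(u_D^A(t),u_D^B(t))$,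 $u_D^\eta(t)\in H^1(\Omega^\eta;\mathbb R^d)$, be a prolongation of $g_D(t)$: $u_D^\eta(t)=g_D^\eta(t)$ on $\Gamma_D^\eta$ and $[u_D(t)]=0$ on $\Gamma_C$. Write $u_D^k=u_D(k\tau)$. **Statement.** Let $1\le k\le N$ and let $u^{k-1}$ be a displacement with $E(g_D((k-1)\tau);u^{k-1})<\infty$. Then the incremental functional $$H^k(u)=\tau R\Bigl(u^{k-1};\frac{u-u^{k-1}}{\tau}\Bigr)+E(g_D(k\tau);u)-\langle F(k\tau),u\rangle$$ is strictly convex on its effective domain $\{H^k<\infty\}$ (which is convex). It has a unique minimizer $u^k$ in $H^1(\Omega^A;\mathbb R^d)\times H^1(\Omega^B;\mathbb R^d)$. Moreover $E(g_D(k\tau);u^k)<\infty$, and $$\begin{aligned} &R_1(u^{k-1};u^k-u^{k-1})+\frac2\tau R_2(u^k-u^{k-1})+E(g_D(k\tau);u^k)\ \le\ E(g_D((k-1)\tau);u^{k-1})\\ &\quad+\sum_{\eta}\int_{\Omega^\eta}\Bigl(\mathbb C^\eta e(u^{\eta,k-1})+\mathbb D^\eta e\Bigl(\frac{u^{\eta,k}-u^{\eta,k-1}}{\tau}\Bigr)\Bigr):e(u_D^{\eta,k}-u_D^{\eta,k-1})\,d\Omega\\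 &\quad+\sum_{\eta}\frac12\int_{\Omega^\eta}e(u_D^{\eta,k}-u_D^{\eta,k-1}):\mathbb C^\eta:e(u_D^{\eta,k}-u_D^{\eta,k-1})\,d\Omega\\ &\quad+\bigl\langle F(k\tau),\,u^k-u^{k-1}-(u_D^k-u_D^{k-1})\bigr\rangle . \end{aligned}$$ -/

import Mathlib

open MeasureTheory Set Filter Topology
open scoped ENNReal ContDiff

noncomputable section

namespace ContactProblem

/-- Euclidean space `ℝ^d`. -/
abbrev E (d : ℕ) : Type := EuclideanSpace ℝ (Fin d)

/-- Real `d × d` arrays with the Euclidean (Frobenius) norm; values of gradients of fields. -/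
abbrev Mat (d : ℕ) : Type := EuclideanSpace ℝ (Fin d × Fin d)

/-- The `j`-th vector of the standard basis of `ℝ^d`. -/
def basisVec {d : ℕ} (j : Fin d) : E d := EuclideanSpace.single j 1

/-- The two bodies. -/
inductive Body : Type
  | A
  | B
  deriving DecidableEq

instance : Fintype Body := ⟨{Body.A, Body.B}, fun η => by cases η <;> simp⟩

/-! ### Lipschitz domains, surface measure, unit normal -/

/-- `Ω` has a Lipschitz boundary: near each boundary point and after a rotation, `Ω` is the strict
epigraph of a Lipschitz function. Here `e` is the vertical direction, `inner ℝ y e` the vertical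
coordinate of `y`, and `y - inner ℝ y e • e` its horizontal part. -/
def HasLipschitzBoundary {d : ℕ} (Ω : Set (E d)) : Prop :=
  ∀ x ∈ frontier Ω, ∃ r > 0, ∃ e : E d, ‖e‖ = 1 ∧ ∃ (K : NNReal) (a : E d → ℝ),
    LipschitzWith K a ∧
      ∀ y ∈ Metric.ball x r, (y ∈ Ω ↔ a (y - inner ℝ y e • e) < inner ℝ y e)

/-- The `(d-1)`-dimensional surface measure on the boundary of `Ω`. -/
def surface {d : ℕ} (Ω : Set (E d)) : Measure (E d) :=
  (Measure.euclideanHausdorffMeasure (d - 1)).restrict (frontier Ω)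

/-- `ν` is the unit outward normal of `Ω` at `x`: up to an error `o(|y - x|)`, the set `Ω`
coincides near `x` with the half-space `{y | ⟪y - x, ν⟫ < 0}`. -/
def IsOuterUnitNormal {d : ℕ} (Ω : Set (E d)) (x ν : E d) : Prop :=
  ‖ν‖ = 1 ∧ ∀ ε > 0, ∀ᶠ y in 𝓝 x,
    (y ∈ Ω → inner ℝ (y - x) ν ≤ ε * ‖y - x‖) ∧
    (inner ℝ (y - x) ν < -(ε * ‖y - x‖) → y ∈ Ω)

/-! ### The space `H¹(Ω; ℝ^d)` -/

/-- `G` is the weak gradient of the vector field `u` on `Ω`, with `∂ⱼ uᵢ (x) = G x (i, j)`. -/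
def IsWeakGradient {d : ℕ} (Ω : Set (E d)) (u : E d → E d) (G : E d → Mat d) : Prop :=
  ∀ φ : E d → ℝ, ContDiff ℝ ∞ φ → HasCompactSupport φ → tsupport φ ⊆ Ω → ∀ i j : Fin d,
    ∫ x in Ω, (u x) i * fderiv ℝ φ x (basisVec j) = - ∫ x in Ω, G x (i, j) * φ x

/-- The classical gradient of a differentiable vector field, with entries `∂ⱼ φᵢ (x)`. -/
def gradField {d : ℕ} (φ : E d → E d) (x : E d) : Mat d :=
  WithLp.toLp 2 fun p => (fderiv ℝ φ x (basisVec p.2)) p.1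

/-- `w` is the boundary trace of the `H¹` field `u` with gradient `G`: there are fields `φ n`,
smooth up to the boundary, that converge to `u` in `H¹(Ω)` and whose boundary values converge to
`w` in `L²(∂Ω)`. -/
def IsTrace {d : ℕ} (Ω : Set (E d)) (u : E d → E d) (G : E d → Mat d)
    (w : E d → E d) : Prop :=
  ∃ φ : ℕ → E d → E d, (∀ n, ContDiff ℝ ∞ (φ n)) ∧
    Tendsto (fun n => eLpNorm (φ n - u) 2 (volume.restrict Ω)) atTop (𝓝 0) ∧
    Tendsto (fun n => eLpNorm (gradField (φ n) - G) 2 (volume.restrict Ω)) atTop (𝓝 0) ∧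
    Tendsto (fun n => eLpNorm (φ n - w) 2 (surface Ω)) atTop (𝓝 0)

/-- The ambient space `L²(Ω) × L²(Ω) × L²(∂Ω)` of (field, gradient, trace). -/
abbrev PreH1 {d : ℕ} (Ω : Set (E d)) : Type :=
  Lp (E d) 2 (volume.restrict Ω) × Lp (Mat d) 2 (volume.restrict Ω) ×
    Lp (E d) 2 (surface Ω)

theorem eLpNorm_tendsto_add {α F : Type*} [MeasurableSpace α] {m : Measure α}
    [NormedAddCommGroup F] {f g : ℕ → α → F} {u v s : α → F}
    (hf : Tendsto (fun n => eLpNorm (f n - u) 2 m) atTop (𝓝 0))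
    (hg : Tendsto (fun n => eLpNorm (g n - v) 2 m) atTop (𝓝 0))
    (hfm : ∀ n, AEStronglyMeasurable (f n) m) (hgm : ∀ n, AEStronglyMeasurable (g n) m)
    (hu : AEStronglyMeasurable u m) (hv : AEStronglyMeasurable v m) (hs : s =ᵐ[m] u + v) :
    Tendsto (fun n => eLpNorm (f n + g n - s) 2 m) atTop (𝓝 0) := by
  have h0 := hf.add hg
  rw [add_zero] at h0
  refine tendsto_of_tendsto_of_tendsto_of_le_of_le tendsto_const_nhds h0 (fun _ => zero_le) ?_
  intro n
  have : eLpNorm (f n + g n - s) 2 m = eLpNorm ((f n - u) + (g n - v)) 2 m := by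
    apply eLpNorm_congr_ae
    filter_upwards [hs] with x hx
    simp only [Pi.sub_apply, Pi.add_apply, hx]
    abel
  simp only [this]
  exact eLpNorm_add_le ((hfm n).sub hu) ((hgm n).sub hv) (by norm_num)

theorem eLpNorm_tendsto_smul {α F : Type*} [MeasurableSpace α] {m : Measure α}
    [NormedAddCommGroup F] [NormedSpace ℝ F] {f : ℕ → α → F} {u s : α → F} (c : ℝ)
    (hf : Tendsto (fun n => eLpNorm (f n - u) 2 m) atTop (𝓝 0)) (hs : s =ᵐ[m] c • u) :
    Tendsto (fun n => eLpNorm (c • f n - s) 2 m) atTop (𝓝 0) := by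
  have h0 : Tendsto (fun n => ‖c‖ₑ * eLpNorm (f n - u) 2 m) atTop (𝓝 (‖c‖ₑ * 0)) :=
    ENNReal.Tendsto.const_mul hf (Or.inr (by simp))
  rw [mul_zero] at h0
  refine h0.congr (fun n => ?_)
  rw [← eLpNorm_const_smul]
  apply eLpNorm_congr_ae
  filter_upwards [hs] with x hx
  simp only [Pi.sub_apply, Pi.smul_apply, hx, smul_sub]

theorem memLp_two_mul_integrable {d : ℕ} {m : Measure (E d)} {f : E d → ℝ} {φ : E d → ℝ}
    (hf : MemLp f 2 m) (hφ : MemLp φ 2 m) : Integrable (fun x => f x * φ x) m :=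
  hf.integrable_mul hφ

theorem memLp_two_of_continuous {d : ℕ} {Ω : Set (E d)} {φ : E d → ℝ} (h : Continuous φ)
    (hc : HasCompactSupport φ) : MemLp φ 2 (volume.restrict Ω) :=
  (h.memLp_of_hasCompactSupport hc).restrict Ω

theorem memLp_coord {d : ℕ} {m : Measure (E d)} {u : E d → E d} (hu : MemLp u 2 m) (i : Fin d) :
    MemLp (fun x => (u x) i) 2 m :=
  (EuclideanSpace.proj (𝕜 := ℝ) (ι := Fin d) i).comp_memLp' hu

theorem memLp_grad_coord {d : ℕ} {m : Measure (E d)} {G : E d → Mat d}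
    (hG : MemLp G 2 m) (i j : Fin d) : MemLp (fun x => G x (i, j)) 2 m :=
  (EuclideanSpace.proj (𝕜 := ℝ) (ι := Fin d × Fin d) (i, j)).comp_memLp' hG

theorem continuous_gradField {d : ℕ} {φ : E d → E d} (h : ContDiff ℝ ∞ φ) :
    Continuous (gradField φ) := by
  refine (PiLp.continuous_toLp 2 _).comp (continuous_pi fun p => ?_)
  exact (EuclideanSpace.proj (𝕜 := ℝ) (ι := Fin d) p.1).continuous.comp
    ((h.continuous_fderiv (by simp)).clm_apply continuous_const)

theorem gradField_add {d : ℕ} {φ ψ : E d → E d} (h : ContDiff ℝ ∞ φ) (h' : ContDiff ℝ ∞ ψ) :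
    gradField (φ + ψ) = gradField φ + gradField ψ := by
  ext x p
  simp [gradField, fderiv_add (h.differentiable (by simp) x) (h'.differentiable (by simp) x)]

theorem gradField_smul {d : ℕ} {φ : E d → E d} (h : ContDiff ℝ ∞ φ) (c : ℝ) :
    gradField (c • φ) = c • gradField φ := by
  ext x p
  simp [gradField, fderiv_const_smul (h.differentiable (by simp) x) c]

theorem memLp_testGrad {d : ℕ} {Ω : Set (E d)} {φ : E d → ℝ} (h : ContDiff ℝ ∞ φ)
    (hc : HasCompactSupport φ) (j : Fin d) :
    MemLp (fun x => fderiv ℝ φ x (basisVec j)) 2 (volume.restrict Ω) :=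
  memLp_two_of_continuous ((h.continuous_fderiv (by simp)).clm_apply continuous_const)
    (hc.fderiv_apply (𝕜 := ℝ) (basisVec j))

theorem IsWeakGradient.add {d : ℕ} {Ω : Set (E d)} {u v s : E d → E d}
    {G H S : E d → Mat d} (hu : IsWeakGradient Ω u G) (hv : IsWeakGradient Ω v H)
    (mu : MemLp u 2 (volume.restrict Ω)) (mv : MemLp v 2 (volume.restrict Ω))
    (mG : MemLp G 2 (volume.restrict Ω)) (mH : MemLp H 2 (volume.restrict Ω))
    (hs : s =ᵐ[volume.restrict Ω] u + v) (hS : S =ᵐ[volume.restrict Ω] G + H) :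
    IsWeakGradient Ω s S := by
  intro φ h1 h2 h3 i j
  have e1 : ∫ x in Ω, (s x) i * fderiv ℝ φ x (basisVec j)
      = ∫ x in Ω, ((u x) i * fderiv ℝ φ x (basisVec j) + (v x) i * fderiv ℝ φ x (basisVec j)) := by
    apply integral_congr_ae
    filter_upwards [hs] with x hx
    simp [hx, add_mul]
  have e2 : ∫ x in Ω, S x (i, j) * φ x
      = ∫ x in Ω, (G x (i, j) * φ x + H x (i, j) * φ x) := by
    apply integral_congr_ae
    filter_upwards [hS] with x hx
    simp [hx, add_mul]
  have mφ := memLp_two_of_continuous (Ω := Ω) h1.continuous h2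
  have mD := memLp_testGrad (Ω := Ω) h1 h2 j
  rw [e1, e2, integral_add (memLp_two_mul_integrable (memLp_coord mu i) mD)
      (memLp_two_mul_integrable (memLp_coord mv i) mD),
    integral_add (memLp_two_mul_integrable (memLp_grad_coord mG i j) mφ)
      (memLp_two_mul_integrable (memLp_grad_coord mH i j) mφ),
    hu φ h1 h2 h3 i j, hv φ h1 h2 h3 i j]
  ring

theorem IsWeakGradient.smul {d : ℕ} {Ω : Set (E d)} {u s : E d → E d}
    {G S : E d → Mat d} (c : ℝ) (hu : IsWeakGradient Ω u G)
    (hs : s =ᵐ[volume.restrict Ω] c • u) (hS : S =ᵐ[volume.restrict Ω] c • G) :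
    IsWeakGradient Ω s S := by
  intro φ h1 h2 h3 i j
  have e1 : ∫ x in Ω, (s x) i * fderiv ℝ φ x (basisVec j)
      = ∫ x in Ω, c * ((u x) i * fderiv ℝ φ x (basisVec j)) := by
    apply integral_congr_ae
    filter_upwards [hs] with x hx
    simp [hx, mul_assoc]
  have e2 : ∫ x in Ω, S x (i, j) * φ x
      = ∫ x in Ω, c * (G x (i, j) * φ x) := by
    apply integral_congr_ae
    filter_upwards [hS] with x hx
    simp [hx, mul_assoc]
  rw [e1, e2, integral_const_mul, integral_const_mul, hu φ h1 h2 h3 i j]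
  ring

theorem IsTrace.add {d : ℕ} {Ω : Set (E d)} {u v s : E d → E d}
    {G H S : E d → Mat d} {w z r : E d → E d} (hu : IsTrace Ω u G w)
    (hv : IsTrace Ω v H z)
    (mu : AEStronglyMeasurable u (volume.restrict Ω))
    (mv : AEStronglyMeasurable v (volume.restrict Ω))
    (mG : AEStronglyMeasurable G (volume.restrict Ω))
    (mH : AEStronglyMeasurable H (volume.restrict Ω))
    (mw : AEStronglyMeasurable w (surface Ω)) (mz : AEStronglyMeasurable z (surface Ω))
    (hs : s =ᵐ[volume.restrict Ω] u + v) (hS : S =ᵐ[volume.restrict Ω] G + H)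
    (hr : r =ᵐ[surface Ω] w + z) : IsTrace Ω s S r := by
  obtain ⟨φ, hφ, p1, p2, p3⟩ := hu
  obtain ⟨ψ, hψ, q1, q2, q3⟩ := hv
  refine ⟨fun n => φ n + ψ n, fun n => (hφ n).add (hψ n), ?_, ?_, ?_⟩
  · exact eLpNorm_tendsto_add p1 q1 (fun n => (hφ n).continuous.aestronglyMeasurable)
      (fun n => (hψ n).continuous.aestronglyMeasurable) mu mv hs
  · simp only [fun n => gradField_add (hφ n) (hψ n)]
    exact eLpNorm_tendsto_add p2 q2 (fun n => (continuous_gradField (hφ n)).aestronglyMeasurable)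
      (fun n => (continuous_gradField (hψ n)).aestronglyMeasurable) mG mH hS
  · exact eLpNorm_tendsto_add p3 q3 (fun n => (hφ n).continuous.aestronglyMeasurable)
      (fun n => (hψ n).continuous.aestronglyMeasurable) mw mz hr

theorem IsTrace.smul {d : ℕ} {Ω : Set (E d)} {u s : E d → E d}
    {G S : E d → Mat d} {w r : E d → E d} (c : ℝ) (hu : IsTrace Ω u G w)
    (hs : s =ᵐ[volume.restrict Ω] c • u) (hS : S =ᵐ[volume.restrict Ω] c • G)
    (hr : r =ᵐ[surface Ω] c • w) : IsTrace Ω s S r := by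
  obtain ⟨φ, hφ, p1, p2, p3⟩ := hu
  refine ⟨fun n => c • φ n, fun n => (hφ n).const_smul c, ?_, ?_, ?_⟩
  · exact eLpNorm_tendsto_smul c p1 hs
  · simp only [fun n => gradField_smul (hφ n) c]
    exact eLpNorm_tendsto_smul c p2 hS
  · exact eLpNorm_tendsto_smul c p3 hr

theorem isWeakGradient_zero {d : ℕ} {Ω : Set (E d)} :
    IsWeakGradient Ω (0 : E d → E d) (0 : E d → Mat d) := by
  intro φ _ _ _ i j
  simp

theorem isTrace_zero {d : ℕ} {Ω : Set (E d)} :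
    IsTrace Ω (0 : E d → E d) (0 : E d → Mat d) (0 : E d → E d) := by
  have h : gradField (0 : E d → E d) = 0 := by ext x p; simp [gradField]
  refine ⟨fun _ => 0, fun _ => contDiff_const, ?_, ?_, ?_⟩ <;> simp [h]

/-- The space `H¹(Ω; ℝ^d)`, as a subspace: an element is a field in `L²(Ω)` stored together with its weak gradient
in `L²(Ω)` and its boundary trace in `L²(∂Ω)`. On a bounded Lipschitz domain every field in `L²(Ω)`
with a weak gradient in `L²(Ω)` has exactly one gradient and exactly one trace in this sense, so
that the last two components are determined by the first and always exist. -/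
def h1Submodule {d : ℕ} (Ω : Set (E d)) : Submodule ℝ (PreH1 Ω) where
  carrier := {p | IsWeakGradient Ω p.1 p.2.1 ∧ IsTrace Ω p.1 p.2.1 p.2.2}
  zero_mem' := by
    have z1 := Lp.coeFn_zero (E d) 2 (volume.restrict Ω)
    have z2 := Lp.coeFn_zero (Mat d) 2 (volume.restrict Ω)
    have z3 := Lp.coeFn_zero (E d) 2 (surface Ω)
    exact ⟨isWeakGradient_zero.smul 0 (z1.trans (ae_of_all _ fun x => by simp)) (z2.trans (ae_of_all _ fun x => by simp)),
      isTrace_zero.smul 0 (z1.trans (ae_of_all _ fun x => by simp)) (z2.trans (ae_of_all _ fun x => by simp))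
        (z3.trans (ae_of_all _ fun x => by simp))⟩
  add_mem' := by
    intro p q hp hq
    have s1 := Lp.coeFn_add p.1 q.1
    have s2 := Lp.coeFn_add p.2.1 q.2.1
    have s3 := Lp.coeFn_add p.2.2 q.2.2
    exact ⟨hp.1.add hq.1 (Lp.memLp _) (Lp.memLp _) (Lp.memLp _) (Lp.memLp _) s1 s2,
      hp.2.add hq.2 (Lp.aestronglyMeasurable _) (Lp.aestronglyMeasurable _)
        (Lp.aestronglyMeasurable _) (Lp.aestronglyMeasurable _) (Lp.aestronglyMeasurable _)
        (Lp.aestronglyMeasurable _) s1 s2 s3⟩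
  smul_mem' := by
    intro c p hp
    have s1 := Lp.coeFn_smul c p.1
    have s2 := Lp.coeFn_smul c p.2.1
    have s3 := Lp.coeFn_smul c p.2.2
    exact ⟨hp.1.smul c s1 s2, hp.2.smul c s1 s2 s3⟩

/-- The space `H¹(Ω; ℝ^d)`. -/
def H1 {d : ℕ} (Ω : Set (E d)) : Type := h1Submodule Ω

instance {d : ℕ} (Ω : Set (E d)) : AddCommGroup (H1 Ω) :=
  inferInstanceAs (AddCommGroup (h1Submodule Ω))

instance {d : ℕ} (Ω : Set (E d)) : Module ℝ (H1 Ω) :=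
  inferInstanceAs (Module ℝ (h1Submodule Ω))

/-- The weak gradient of an `H¹` field. -/
def H1.grad {d : ℕ} {Ω : Set (E d)} (u : H1 Ω) : E d → Mat d := u.1.2.1

/-- The boundary trace of an `H¹` field. -/
def H1.trace {d : ℕ} {Ω : Set (E d)} (u : H1 Ω) : E d → E d := u.1.2.2

/-- The small-strain tensor `e(u) = ½ (∇u + (∇u)ᵀ)`. -/
def H1.strain {d : ℕ} {Ω : Set (E d)} (u : H1 Ω) (x : E d) : Matrix (Fin d) (Fin d) ℝ :=
  fun i j => (u.grad x (i, j) + u.grad x (j, i)) / 2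

/-! ### Moduli tensors -/

/-- The double contraction `A : B` of two matrices. -/
def ddot {d : ℕ} (A B : Matrix (Fin d) (Fin d) ℝ) : ℝ := ∑ i, ∑ j, A i j * B i j

/-- A symmetric positive-definite fourth-order tensor of (elastic or viscous) moduli. -/
structure ModuliTensor (d : ℕ) where
  /-- the components of the tensor -/
  coeff : Fin d → Fin d → Fin d → Fin d → ℝ
  minor_symm : ∀ i j k l, coeff i j k l = coeff j i k l
  major_symm : ∀ i j k l, coeff i j k l = coeff k l i j
  posDef : ∀ A : Matrix (Fin d) (Fin d) ℝ, A.IsSymm → A ≠ 0 →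
    0 < ∑ i, ∑ j, ∑ k, ∑ l, coeff i j k l * A i j * A k l

/-- The matrix `C A` with entries `∑ C_{ijkl} A_{kl}`. -/
def ModuliTensor.app {d : ℕ} (C : ModuliTensor d) (A : Matrix (Fin d) (Fin d) ℝ) :
    Matrix (Fin d) (Fin d) ℝ :=
  fun i j => ∑ k, ∑ l, C.coeff i j k l * A k l

/-! ### Geometry of the contact problem -/

/-- Two bodies `Ω A`, `Ω B` in `ℝ^d` in contact, with their Dirichlet and Neumann boundary parts.
The contact boundary is the common part of the two boundaries. -/
structure Geometry (d : ℕ) where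
  /-- the domains occupied by the bodies -/
  Ω : Body → Set (E d)
  /-- the Dirichlet parts -/
  ΓD : Body → Set (E d)
  /-- the Neumann parts -/
  ΓN : Body → Set (E d)
  /-- the unit outward normal field of body `B`, defined almost everywhere on its boundary -/
  nB : E d → E d
  isOpen : ∀ η, IsOpen (Ω η)
  isConnected : ∀ η, IsConnected (Ω η)
  isBounded : ∀ η, Bornology.IsBounded (Ω η)
  lipschitz : ∀ η, HasLipschitzBoundary (Ω η)
  disjoint : Disjoint (Ω Body.A) (Ω Body.B)
  measurable_nB : Measurable nB
  normal_nB : ∀ᵐ x ∂(surface (Ω Body.B)), IsOuterUnitNormal (Ω Body.B) x (nB x)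
  ΓD_open : ∀ η, ∃ U, IsOpen U ∧ ΓD η = U ∩ frontier (Ω η)
  ΓN_open : ∀ η, ∃ U, IsOpen U ∧ ΓN η = U ∩ frontier (Ω η)
  ΓD_nonempty : ∀ η, (ΓD η).Nonempty
  disjoint_DN : ∀ η, Disjoint (ΓD η) (ΓN η)
  disjoint_NC : ∀ η, Disjoint (ΓN η) (frontier (Ω Body.A) ∩ frontier (Ω Body.B))
  disjoint_DC : ∀ η, Disjoint (closure (ΓD η)) (frontier (Ω Body.A) ∩ frontier (Ω Body.B))
  cover : ∀ η, frontier (Ω η) =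
    closure (ΓD η) ∪ closure (ΓN η) ∪ (frontier (Ω Body.A) ∩ frontier (Ω Body.B))

variable {d : ℕ}

/-- The contact boundary `Γ_C = Γ^A ∩ Γ^B`. -/
def Geometry.ΓC (P : Geometry d) : Set (E d) := frontier (P.Ω Body.A) ∩ frontier (P.Ω Body.B)

/-- The surface measure on the Dirichlet part of body `η`. -/
def Geometry.σD (P : Geometry d) (η : Body) : Measure (E d) :=
  (Measure.euclideanHausdorffMeasure (d - 1)).restrict (P.ΓD η)

/-- The surface measure on the Neumann part of body `η`. -/
def Geometry.σN (P : Geometry d) (η : Body) : Measure (E d) :=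
  (Measure.euclideanHausdorffMeasure (d - 1)).restrict (P.ΓN η)

/-- The surface measure on the contact boundary. -/
def Geometry.σC (P : Geometry d) : Measure (E d) :=
  (Measure.euclideanHausdorffMeasure (d - 1)).restrict P.ΓC

/-- Displacements `u = (u^A, u^B)` in `H¹(Ω^A; ℝ^d) × H¹(Ω^B; ℝ^d)`. -/
abbrev Geometry.Disp (P : Geometry d) : Type := (η : Body) → H1 (P.Ω η)

/-- The gap `[u] = u^A - u^B` of displacements on the contact boundary. -/
def gap {P : Geometry d} (u : P.Disp) (x : E d) : E d :=
  (u Body.A).trace x - (u Body.B).trace x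

/-- The normal gap `[u]_n = [u] · n^B`. -/
def gapN {P : Geometry d} (u : P.Disp) (x : E d) : ℝ := inner ℝ (gap u x) (P.nB x)

/-- The tangential gap `[u]_t = [u] - [u]_n n^B`. -/
def gapT {P : Geometry d} (u : P.Disp) (x : E d) : E d := gap u x - gapN u x • P.nB x

/-! ### The functionals -/

/-- The quadratic form `∑ η, ∫_{Ω^η} ½ e(u^η) : C^η : e(u^η)`. -/
def quad {P : Geometry d} (C : Body → ModuliTensor d) (u : P.Disp) : ℝ :=
  ∑ η, ∫ x in P.Ω η, (1 / 2) * ddot ((C η).app ((u η).strain x)) ((u η).strain x)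

/-- Dirichlet data on the boundary parts `Γ_D^η`. -/
abbrev Geometry.DirichletData (P : Geometry d) : Type := (η : Body) → Lp (E d) 2 (P.σD η)

/-- Surface loads on the boundary parts `Γ_N^η`. -/
abbrev Geometry.NeumannData (P : Geometry d) : Type := (η : Body) → Lp (E d) 2 (P.σN η)

/-- `u^η = g^η` on `Γ_D^η` for both bodies, in the sense of traces. -/
def HasDirichletData {P : Geometry d} (g : P.DirichletData) (u : P.Disp) : Prop :=
  ∀ η, (u η).trace =ᵐ[P.σD η] (g η : E d → E d)

open Classical in
/-- The bulk stored energy `E_B(g; u)`, which is `+∞` if `u` violates the Dirichlet condition. -/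
def energyB {P : Geometry d} (C : Body → ModuliTensor d) (g : P.DirichletData) (u : P.Disp) :
    EReal :=
  if HasDirichletData g u then ((quad C u : ℝ) : EReal) else ⊤

/-- The contact energy `E_C(u) = ∫_{Γ_C} γ([u]_n)` (the integrand is nonnegative). -/
def energyC {P : Geometry d} (γ : ℝ → ℝ) (u : P.Disp) : EReal :=
  ((∫⁻ x, ENNReal.ofReal (γ (gapN u x)) ∂P.σC : ℝ≥0∞) : EReal)

/-- The stored energy `E(g; u) = E_B(g; u) + E_C(u)`. -/
def energy {P : Geometry d} (C : Body → ModuliTensor d) (γ : ℝ → ℝ) (g : P.DirichletData)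
    (u : P.Disp) : EReal :=
  energyB C g u + energyC γ u

/-- The frictional potential `R₁(u; v) = ∫_{Γ_C} -μ γ'([u]_n) |[v]_t|` (the integrand is
nonnegative since `γ` is decreasing). -/
def R1 {P : Geometry d} (γ : ℝ → ℝ) (μ : ℝ) (u v : P.Disp) : EReal :=
  ((∫⁻ x, ENNReal.ofReal (-μ * deriv γ (gapN u x) * ‖gapT v x‖) ∂P.σC : ℝ≥0∞) : EReal)

/-- The viscous potential `R₂(v)`. -/
def R2 {P : Geometry d} (D : Body → ModuliTensor d) (v : P.Disp) : ℝ := quad D v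

/-- The potential of dissipative forces `R(u; v) = R₁(u; v) + R₂(v)`. -/
def R {P : Geometry d} (D : Body → ModuliTensor d) (γ : ℝ → ℝ) (μ : ℝ) (u v : P.Disp) : EReal :=
  R1 γ μ u v + ((R2 D v : ℝ) : EReal)

/-- The load `⟨F, v⟩ = ∑ η, ∫_{Γ_N^η} f^η · v^η`. -/
def load {P : Geometry d} (f : P.NeumannData) (v : P.Disp) : ℝ :=
  ∑ η, ∫ x, inner ℝ ((f η : E d → E d) x) ((v η).trace x) ∂(P.σN η)

/-- The incremental functional `τ R(w; (u - w)/τ) + E(g; u) - ⟨F, u⟩` with previous state `w`,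
Dirichlet datum `g` and surface load `f`. -/
def incremental {P : Geometry d} (C D : Body → ModuliTensor d) (γ : ℝ → ℝ) (μ τ : ℝ)
    (g : P.DirichletData) (f : P.NeumannData) (w u : P.Disp) : EReal :=
  ((τ : ℝ) : EReal) * R D γ μ w (τ⁻¹ • (u - w)) + energy C γ g u - ((load f u : ℝ) : EReal)

/-- The work of the Dirichlet loading over one time step from `w` to `u`, when the prolongation of
the Dirichlet datum changes by `δ`:
`∑ η, ∫_{Ω^η} (C e(w) + D e((u - w)/τ)) : e(δ) + ∑ η, ½ ∫_{Ω^η} e(δ) : C : e(δ)`. -/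
def dirichletWork {P : Geometry d} (C D : Body → ModuliTensor d) (τ : ℝ) (w u δ : P.Disp) : ℝ :=
  (∑ η, ∫ x in P.Ω η,
    ddot ((C η).app ((w η).strain x) + (D η).app ((τ⁻¹ • (u η - w η)).strain x))
      ((δ η).strain x)) +
  ∑ η, (1 / 2) * ∫ x in P.Ω η, ddot ((C η).app ((δ η).strain x)) ((δ η).strain x)

end ContactProblem

end

/-!
The incremental functional is a continuous quadratic functional plus a convex `[0, ∞]`-valued
functional, the contact energy and the frictional potential of the increment with the previous
state frozen in the friction coefficient.

*Uniform convexity.* The quadratic part is uniformly convex on the affine space of fields with the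
prescribed Dirichlet data by Korn's first inequality, `korn_first`, and this is where the work lies.
Near a boundary point a Lipschitz domain coincides with a set `U` that is stable under translations
by a cone. On `U` a function is recovered from averages of its derivatives over the cone; for an
entry of the gradient of a field these derivatives are derivatives of the strain, by Saint-Venant's
identity. Integrating by parts onto the kernel leaves averages of the strain with a kernel of
vanishing mean and the singular weight `dt / t` in the scale `t`, and such averages are bounded on
`L²` by Plancherel's theorem (`lintegral_dilPairing_le`). This gives Korn's second inequality
(`korn_second`) after localization. Averages over the cone also give an Ehrling inequality
(`ehrling`), which serves as the compactness statement, and integration along the vertical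
direction gives the trace inequality (`trace_inequality`). By these three estimates the `H¹` norm
is controlled by the strain and finitely many functionals. A field without strain is an
infinitesimal rigid motion, which vanishes if it vanishes on a relatively open part of the
boundary, so that Peetre's lemma removes the finite remainder.

*Existence and uniqueness.* The nonsmooth part is lower semicontinuous by Fatou's lemma, since
traces converge in `L²`. Minimizing sequences of a uniformly convex functional are Cauchy
(`exists_minimizer`). The previous state `w`, shifted by the change `δ` of the prolongation of the
Dirichlet data, is a competitor: `δ` has no gap on the contact boundary, so the contact energy is
that of `w` and the friction vanishes (`nonsmooth_add_of_gap_eq_zero`).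

*Energy inequality.* Write `J` for the functional and `q` for its quadratic part. At the minimizer
`u`, comparison with points of the segment towards `v` gives `J u + q (u - v) ≤ J v`
(`stepValue_add_stepForm_le`), which also yields uniqueness. For `v = w + δ`, expanding the
quadratic forms turns this into the energy inequality, where the nonnegative remainder
`½ C (u - v, u - v)` is dropped.
-/

namespace ContactProblem

/-! ### A bound for averaged dilations -/

section Dilation

open FourierTransform
open scoped LineDeriv SchwartzMap

variable {V : Type*} [NormedAddCommGroup V] [InnerProductSpace ℝ V] [FiniteDimensional ℝ V]
  [MeasurableSpace V] [BorelSpace V]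

/-- The pairing `∫∫ g(x) β(y) f(x + t y) dy dx` of `g` with the average of `f` over translations
weighted by the kernel `β` dilated by `t`. -/
noncomputable def dilPairing (β f g : V → ℂ) (t : ℝ) : ℂ :=
  ∫ x, ∫ y, g x * (β y * f (x + t • y))

theorem lintegral_enorm_mul_le {α F G : Type*} [MeasurableSpace α] {m : Measure α}
    [NormedAddCommGroup F] [NormedAddCommGroup G] {f : α → F} {g : α → G}
    (hf : AEStronglyMeasurable f m) (hg : AEStronglyMeasurable g m) :
    ∫⁻ x, ‖f x‖ₑ * ‖g x‖ₑ ∂m ≤ eLpNorm f 2 m * eLpNorm g 2 m := by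
  have := ENNReal.lintegral_mul_le_Lp_mul_Lq m (p := 2) (q := 2)
    (by constructor <;> norm_num) hf.enorm hg.enorm
  rw [eLpNorm_eq_lintegral_rpow_enorm_toReal (by norm_num) (by norm_num),
    eLpNorm_eq_lintegral_rpow_enorm_toReal (by norm_num) (by norm_num)]
  simpa using this

theorem integral_exp_mul_eq_fourier (h : V → ℂ) (ξ : V) :
    ∫ x, h x * Complex.exp (↑(2 * Real.pi * inner ℝ ξ x) * Complex.I) = 𝓕 h (-ξ) := by
  rw [Real.fourier_eq']
  refine integral_congr_ae (ae_of_all _ fun x => ?_)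
  simp only [smul_eq_mul, inner_neg_right, real_inner_comm x ξ]
  rw [mul_comm]
  congr 3
  push_cast
  ring

theorem norm_exp_inner (a : ℝ) : ‖Complex.exp ((a : ℂ) * Complex.I)‖ = 1 :=
  Complex.norm_exp_ofReal_mul_I a

/-- In Fourier variables, averaging with the kernel dilated by `t` multiplies `𝓕 f` by the dilated
Fourier transform of the kernel. -/
theorem dilPairing_schwartz (β f g : 𝓢(V, ℂ)) (t : ℝ) :
    dilPairing β f g t = ∫ ξ, 𝓕 f ξ * (𝓕 g (-ξ) * 𝓕 β (-(t • ξ))) := by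
  have hinv : ∀ z, f z = ∫ ξ, Complex.exp (↑(2 * Real.pi * inner ℝ ξ z) * Complex.I) * 𝓕 f ξ := by
    intro z
    have : 𝓕⁻ (𝓕 f) = f := by simp
    conv_lhs => rw [← this]
    rw [SchwartzMap.fourierInv_coe, Real.fourierInv_eq']
    rfl
  have e1 : ∀ x, ∫ y, g x * (β y * f (x + t • y))
      = ∫ ξ, g x * Complex.exp (↑(2 * Real.pi * inner ℝ ξ x) * Complex.I) *
          (𝓕 f ξ * 𝓕 β (-(t • ξ))) := by
    intro x
    have : ∀ y, g x * (β y * f (x + t • y)) =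
        ∫ ξ, g x * Complex.exp (↑(2 * Real.pi * inner ℝ ξ x) * Complex.I) * (𝓕 f ξ *
          (β y * Complex.exp (↑(2 * Real.pi * inner ℝ (t • ξ) y) * Complex.I))) := by
      intro y
      rw [hinv, ← integral_const_mul, ← integral_const_mul]
      refine integral_congr_ae (ae_of_all _ fun ξ => ?_)
      have : Complex.exp (↑(2 * Real.pi * inner ℝ ξ (x + t • y)) * Complex.I)
        = Complex.exp (↑(2 * Real.pi * inner ℝ ξ x) * Complex.I) *
          Complex.exp (↑(2 * Real.pi * inner ℝ (t • ξ) y) * Complex.I) := by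
        rw [← Complex.exp_add]
        congr 1
        simp only [inner_add_right, inner_smul_right, inner_smul_left]
        simp
        ring
      simp only [this]
      ring
    simp_rw [this]
    rw [integral_integral_swap]
    · refine integral_congr_ae (ae_of_all _ fun ξ => ?_)
      simp only
      rw [integral_const_mul, integral_const_mul, integral_exp_mul_eq_fourier]
      rfl
    · have i1 : Integrable (fun p : V × V => β p.1 * 𝓕 f p.2) (volume.prod volume) :=
        β.integrable.mul_prod (𝓕 f).integrable
      refine (i1.norm.const_mul ‖g x‖).mono' ?_ (ae_of_all _ fun p => ?_)
      · refine Continuous.aestronglyMeasurable ?_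
        have := β.continuous
        have := (𝓕 f).continuous
        simp only [Function.uncurry_def]
        fun_prop
      · simp only [Function.uncurry_def, norm_mul, norm_exp_inner]
        apply le_of_eq; ring
  unfold dilPairing
  simp_rw [e1]
  rw [integral_integral_swap]
  · refine integral_congr_ae (ae_of_all _ fun ξ => ?_)
    simp only
    rw [integral_mul_const, integral_exp_mul_eq_fourier]
    simp only [SchwartzMap.fourier_coe]
    ring
  · have i1 : Integrable (fun p : V × V => g p.1 * 𝓕 f p.2) (volume.prod volume) :=
      g.integrable.mul_prod (𝓕 f).integrable
    obtain ⟨C, hC, hβ⟩ := (𝓕 β).decay 0 0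
    simp only [pow_zero, one_mul, norm_iteratedFDeriv_zero] at hβ
    refine (i1.norm.mul_const C).mono' ?_ (ae_of_all _ fun p => ?_)
    · refine Continuous.aestronglyMeasurable ?_
      have := g.continuous
      have := (𝓕 f).continuous
      have := (𝓕 β).continuous
      simp only [Function.uncurry_def]
      fun_prop
    · simp only [Function.uncurry_def, norm_mul, norm_exp_inner]
      rw [mul_one, ← mul_assoc]
      gcongr
      exact hβ _

/-- A kernel that is a derivative has a Fourier transform vanishing at `0` and at infinity. -/
theorem norm_fourier_lineDeriv_le (κ : 𝓢(V, ℂ)) (v : V) :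
    ∃ C : ℝ, 0 ≤ C ∧ ∀ ξ, ‖𝓕 (∂_{v} κ) ξ‖ ≤ C * (‖ξ‖ / (1 + ‖ξ‖ ^ 2)) := by
  obtain ⟨C0, h0, hC0⟩ := (𝓕 κ).decay 0 0
  obtain ⟨C2, h2, hC2⟩ := (𝓕 κ).decay 2 0
  simp only [pow_zero, one_mul, norm_iteratedFDeriv_zero] at hC0 hC2
  refine ⟨2 * Real.pi * ‖v‖ * (C0 + C2), by positivity, fun ξ => ?_⟩
  rw [SchwartzMap.fourier_lineDerivOp_eq]
  have e : ((2 * (Real.pi : ℂ) * Complex.I) •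
      (SchwartzMap.smulLeftCLM ℂ fun x => inner ℝ x v) (𝓕 κ)) ξ
      = (2 * Real.pi * Complex.I) * ((inner ℝ ξ v : ℝ) • 𝓕 κ ξ) := by
    rw [smul_apply, smul_eq_mul, SchwartzMap.smulLeftCLM_apply_apply (by fun_prop)]
  rw [e]
  have h3 : ‖𝓕 κ ξ‖ ≤ (C0 + C2) / (1 + ‖ξ‖ ^ 2) := by
    rw [le_div_iff₀ (by positivity)]
    nlinarith [hC0 ξ, hC2 ξ]
  have h4 : |inner ℝ ξ v| ≤ ‖ξ‖ * ‖v‖ := abs_real_inner_le_norm ξ v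
  simp only [norm_mul, norm_smul, Complex.norm_I, Complex.norm_real, Real.norm_eq_abs,
    abs_of_pos Real.pi_pos, Complex.norm_ofNat, mul_one]
  calc 2 * Real.pi * (|inner ℝ ξ v| * ‖𝓕 κ ξ‖)
      ≤ 2 * Real.pi * ((‖ξ‖ * ‖v‖) * ((C0 + C2) / (1 + ‖ξ‖ ^ 2))) := by gcongr
    _ = _ := by ring

/-- The `dt / t` integral of the bound on `𝓕 (∂ᵥ κ)` along a ray is the same for all frequencies: in
the variable `t r` it is the integral of `1 / (1 + s²)`. -/
theorem lintegral_dilation_weight_le (r : ℝ) (hr : 0 ≤ r) :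
    ∫⁻ t in Ioi (0 : ℝ), ENNReal.ofReal (r / (1 + (t * r) ^ 2)) ≤ ENNReal.ofReal (Real.pi / 2) := by
  rcases hr.eq_or_lt with rfl | hr
  · simp
  have hi : IntegrableOn (fun t : ℝ => r / (1 + (t * r) ^ 2)) (Ioi 0) := by
    have := ((integrable_inv_one_add_sq.comp_mul_right' hr.ne').const_mul r).integrableOn
      (s := Ioi 0)
    simpa [div_eq_mul_inv] using this
  rw [← ofReal_integral_eq_lintegral_ofReal hi (ae_of_all _ fun t => by positivity)]
  apply le_of_eq
  congr 1
  have := integral_comp_mul_right_Ioi (fun x : ℝ => (1 + x ^ 2)⁻¹) 0 hr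
  simp only [div_eq_mul_inv]
  rw [integral_const_mul, this]
  simp
  field_simp

/-- Tonelli's theorem reduces the scale integral of the pairings to the one of the multiplier at a fixed
frequency; Cauchy-Schwarz and Plancherel do the rest. -/
theorem lintegral_dilPairing_schwartz_le (κ : 𝓢(V, ℂ)) (v : V) :
    ∃ C : NNReal, ∀ f g : 𝓢(V, ℂ),
      ∫⁻ t in Ioi (0 : ℝ), ‖dilPairing (∂_{v} κ : 𝓢(V, ℂ)) f g t‖ₑ * ENNReal.ofReal t⁻¹
        ≤ C * (eLpNorm f 2 * eLpNorm g 2) := by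
  obtain ⟨C, hC0, hC⟩ := norm_fourier_lineDeriv_le κ v
  refine ⟨(C * (Real.pi / 2)).toNNReal, fun f g => ?_⟩
  have hpl : ∀ h : 𝓢(V, ℂ), eLpNorm (𝓕 h : 𝓢(V, ℂ)) 2 = eLpNorm h 2 := by
    intro h
    have e1 := SchwartzMap.norm_fourier_toL2_eq h
    have m1 := h.memLp 2 volume
    have m2 := (𝓕 h : 𝓢(V, ℂ)).memLp 2 volume
    rw [SchwartzMap.norm_toLp, SchwartzMap.norm_toLp] at e1
    exact (ENNReal.toReal_eq_toReal_iff' m2.2.ne m1.2.ne).1 e1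
  have hneg : eLpNorm (fun ξ => 𝓕 g (-ξ)) 2 = eLpNorm g 2 := by
    rw [← hpl g]
    exact eLpNorm_comp_measurePreserving (𝓕 g).continuous.aestronglyMeasurable
      (Measure.measurePreserving_neg volume)
  have hcf := (𝓕 f).continuous
  have hcg := (𝓕 g).continuous
  have key : ∀ t ∈ Ioi (0 : ℝ),
      ‖dilPairing (∂_{v} κ : 𝓢(V, ℂ)) f g t‖ₑ * ENNReal.ofReal t⁻¹ ≤
      ∫⁻ ξ, (‖𝓕 f ξ‖ₑ * ‖𝓕 g (-ξ)‖ₑ) * (ENNReal.ofReal C *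
        ENNReal.ofReal (‖ξ‖ / (1 + (t * ‖ξ‖) ^ 2))) := by
    intro t ht
    have ht : 0 < t := ht
    rw [dilPairing_schwartz]
    refine (mul_le_mul_left (enorm_integral_le_lintegral_enorm _) _).trans ?_
    rw [← lintegral_mul_const' _ _ (by simp)]
    refine lintegral_mono fun ξ => ?_
    rw [enorm_mul, enorm_mul, ← mul_assoc, mul_assoc (_ * _)]
    refine mul_le_mul' le_rfl ?_
    rw [← ENNReal.ofReal_mul hC0, ← ofReal_norm, ← ENNReal.ofReal_mul (norm_nonneg _)]
    apply ENNReal.ofReal_le_ofReal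
    have := hC (-(t • ξ))
    rw [norm_neg, norm_smul, Real.norm_eq_abs, abs_of_pos ht] at this
    calc _ ≤ C * (t * ‖ξ‖ / (1 + (t * ‖ξ‖) ^ 2)) * t⁻¹ := by gcongr
      _ = _ := by field_simp
  calc _ ≤ ∫⁻ t in Ioi (0 : ℝ), ∫⁻ ξ, (‖𝓕 f ξ‖ₑ * ‖𝓕 g (-ξ)‖ₑ) * (ENNReal.ofReal C *
        ENNReal.ofReal (‖ξ‖ / (1 + (t * ‖ξ‖) ^ 2))) := setLIntegral_mono' measurableSet_Ioi key
    _ = ∫⁻ ξ, (‖𝓕 f ξ‖ₑ * ‖𝓕 g (-ξ)‖ₑ) * (ENNReal.ofReal C *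
        ∫⁻ t in Ioi (0 : ℝ), ENNReal.ofReal (‖ξ‖ / (1 + (t * ‖ξ‖) ^ 2))) := by
      rw [lintegral_lintegral_swap]
      · refine lintegral_congr fun ξ => ?_
        rw [lintegral_const_mul _ (by fun_prop), lintegral_const_mul _ (by fun_prop)]
      · refine Measurable.aemeasurable ?_
        simp only [Function.uncurry_def]
        have : Measurable (𝓕 f : 𝓢(V, ℂ)) := hcf.measurable
        have : Measurable (𝓕 g : 𝓢(V, ℂ)) := hcg.measurable
        fun_prop
    _ ≤ ∫⁻ ξ, (‖𝓕 f ξ‖ₑ * ‖𝓕 g (-ξ)‖ₑ) * (ENNReal.ofReal C * ENNReal.ofReal (Real.pi / 2)) := by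
      refine lintegral_mono fun ξ => ?_
      dsimp only
      gcongr
      exact lintegral_dilation_weight_le _ (norm_nonneg ξ)
    _ ≤ (eLpNorm (𝓕 f : 𝓢(V, ℂ)) 2 * eLpNorm (fun ξ => 𝓕 g (-ξ)) 2) *
        (ENNReal.ofReal C * ENNReal.ofReal (Real.pi / 2)) := by
      rw [lintegral_mul_const' _ _ (by finiteness)]
      gcongr
      exact lintegral_enorm_mul_le hcf.aestronglyMeasurable
        (hcg.comp continuous_neg).aestronglyMeasurable
    _ = _ := by
      rw [hpl, hneg, ← ENNReal.ofReal_mul hC0, mul_comm]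
      rfl

theorem quasiMeasurePreserving_add_smul (t : ℝ) :
    Measure.QuasiMeasurePreserving (fun p : V × V => p.1 + t • p.2)
      (volume.prod volume) volume := by
  refine ⟨by fun_prop, ?_⟩
  refine Measure.AbsolutelyContinuous.mk fun s hs h0 => ?_
  rw [Measure.map_apply (by fun_prop) hs, Measure.prod_apply_symm (by measurability)]
  rw [lintegral_eq_zero_iff' (by
    refine (measurable_measure_prodMk_right ?_).aemeasurable
    exact (by fun_prop : Measurable fun p : V × V => p.1 + t • p.2) hs)]
  refine ae_of_all _ fun y => ?_
  exact ((measurePreserving_add_right volume (t • y)).measure_preimage hs.nullMeasurableSet).trans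
    h0

theorem aestronglyMeasurable_dilPairing {β f g : V → ℂ} (hβ : Continuous β)
    (hf : MemLp f 2) (hg : MemLp g 2) (t : ℝ) :
    AEStronglyMeasurable (fun p : V × V => g p.1 * (β p.2 * f (p.1 + t • p.2)))
      (volume.prod volume) :=
  hg.1.comp_fst.mul ((hβ.comp continuous_snd).aestronglyMeasurable.mul
    (hf.1.comp_quasiMeasurePreserving (quasiMeasurePreserving_add_smul t)))

/-- Young's inequality for the integrand of the pairing, at a fixed `t`. -/
theorem lintegral_pairing_le {β f g : V → ℂ} (hβ : Continuous β)
    (hf : MemLp f 2) (hg : MemLp g 2) (t : ℝ) :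
    ∫⁻ p : V × V, ‖g p.1 * (β p.2 * f (p.1 + t • p.2))‖ₑ ∂(volume.prod volume)
      ≤ eLpNorm β 1 * (eLpNorm f 2 * eLpNorm g 2) := by
  have hq : ∀ y, MeasurePreserving (fun x : V => x + t • y) volume volume :=
    fun y => measurePreserving_add_right volume _
  rw [lintegral_prod_symm _ (aestronglyMeasurable_dilPairing hβ hf hg t).enorm]
  have : ∀ y, ∫⁻ x, ‖g x * (β y * f (x + t • y))‖ₑ ≤ ‖β y‖ₑ * (eLpNorm f 2 * eLpNorm g 2) := by
    intro y
    have e : ∀ x, ‖g x * (β y * f (x + t • y))‖ₑ = ‖β y‖ₑ * (‖f (x + t • y)‖ₑ * ‖g x‖ₑ) := by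
      intro x; simp only [enorm_mul]; ring
    simp_rw [e]
    rw [lintegral_const_mul' _ _ (by simp)]
    gcongr
    refine (lintegral_enorm_mul_le (hf.1.comp_quasiMeasurePreserving
      (hq y).quasiMeasurePreserving) hg.1).trans (le_of_eq ?_)
    congr 1
    exact eLpNorm_comp_measurePreserving hf.1 (hq y)
  refine (lintegral_mono this).trans (le_of_eq ?_)
  rw [lintegral_mul_const _ (by have := hβ.measurable; fun_prop), eLpNorm_one_eq_lintegral_enorm]

theorem integrable_dilPairing {β f g : V → ℂ} (hβ : Continuous β) (hβ1 : Integrable β)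
    (hf : MemLp f 2) (hg : MemLp g 2) (t : ℝ) :
    Integrable (fun p : V × V => g p.1 * (β p.2 * f (p.1 + t • p.2))) (volume.prod volume) :=
  ⟨aestronglyMeasurable_dilPairing hβ hf hg t,
    (lintegral_pairing_le hβ hf hg t).trans_lt (ENNReal.mul_lt_top
      (memLp_one_iff_integrable.2 hβ1).2 (ENNReal.mul_lt_top hf.2 hg.2))⟩

theorem dilPairing_eq_prod {β f g : V → ℂ} (hβ : Continuous β) (hβ1 : Integrable β)
    (hf : MemLp f 2) (hg : MemLp g 2) (t : ℝ) :
    dilPairing β f g t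
      = ∫ p : V × V, g p.1 * (β p.2 * f (p.1 + t • p.2)) ∂(volume.prod volume) :=
  (integral_prod _ (integrable_dilPairing hβ hβ1 hf hg t)).symm

theorem enorm_dilPairing_le {β f g : V → ℂ} (hβ : Continuous β) (hβ1 : Integrable β)
    (hf : MemLp f 2) (hg : MemLp g 2) (t : ℝ) :
    ‖dilPairing β f g t‖ₑ ≤ eLpNorm β 1 * (eLpNorm f 2 * eLpNorm g 2) := by
  rw [dilPairing_eq_prod hβ hβ1 hf hg]
  exact (enorm_integral_le_lintegral_enorm _).trans (lintegral_pairing_le hβ hf hg t)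

theorem exists_schwartz_seq {f : V → ℂ} (hf : MemLp f 2) :
    ∃ F : ℕ → 𝓢(V, ℂ), Tendsto (fun n => eLpNorm ((F n : V → ℂ) - f) 2) atTop (𝓝 0) := by
  have hd := SchwartzMap.denseRange_toLpCLM (E := V) (F := ℂ) (p := 2) (by simp)
    (μ := (volume : Measure V))
  have := hd.closure_range ▸ mem_univ (hf.toLp f)
  obtain ⟨u, hu, hlim⟩ := mem_closure_iff_seq_limit.1 this
  choose F hF using hu
  refine ⟨F, ?_⟩
  have h2 := (Lp.tendsto_Lp_iff_tendsto_eLpNorm' u (hf.toLp f)).1 hlim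
  refine h2.congr fun n => ?_
  rw [← hF n]
  refine eLpNorm_congr_ae ?_
  exact ((F n).coeFn_toLp 2 volume).sub hf.coeFn_toLp

theorem dilPairing_sub {β f g f' g' : V → ℂ} (hβ : Continuous β) (hβ1 : Integrable β)
    (hf : MemLp f 2) (hg : MemLp g 2) (hf' : MemLp f' 2) (hg' : MemLp g' 2) (t : ℝ) :
    dilPairing β f' g' t - dilPairing β f g t
      = dilPairing β (f' - f) g' t + dilPairing β f (g' - g) t := by
  rw [dilPairing_eq_prod hβ hβ1 hf' hg', dilPairing_eq_prod hβ hβ1 hf hg,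
    dilPairing_eq_prod hβ hβ1 (hf'.sub hf) hg', dilPairing_eq_prod hβ hβ1 hf (hg'.sub hg),
    ← integral_sub (integrable_dilPairing hβ hβ1 hf' hg' t) (integrable_dilPairing hβ hβ1 hf hg t),
    ← integral_add (integrable_dilPairing hβ hβ1 (hf'.sub hf) hg' t)
      (integrable_dilPairing hβ hβ1 hf (hg'.sub hg) t)]
  congr 1
  ext p
  simp only [Pi.sub_apply]
  ring

theorem tendsto_eLpNorm_of_sub {α F : Type*} [MeasurableSpace α] {m : Measure α}
    [NormedAddCommGroup F] {f : ℕ → α → F} {u : α → F} (hf : ∀ n, MemLp (f n) 2 m)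
    (hu : MemLp u 2 m) (h : Tendsto (fun n => eLpNorm (f n - u) 2 m) atTop (𝓝 0)) :
    Tendsto (fun n => eLpNorm (f n) 2 m) atTop (𝓝 (eLpNorm u 2 m)) := by
  have h2 := (Lp.tendsto_Lp_iff_tendsto_eLpNorm'' f hf u hu).2 h
  have h3 := (continuous_enorm.tendsto _).comp h2
  simpa [Function.comp_def, Lp.enorm_toLp] using h3

theorem ennreal_tendsto_mul_mul {c a b : ℝ≥0∞} {u w : ℕ → ℝ≥0∞} (hc : c ≠ ⊤)
    (hu : Tendsto u atTop (𝓝 a)) (hw : Tendsto w atTop (𝓝 b)) (ha : a ≠ ⊤) (hb : b ≠ ⊤) :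
    Tendsto (fun n => c * (u n * w n)) atTop (𝓝 (c * (a * b))) :=
  ENNReal.Tendsto.const_mul (ENNReal.Tendsto.mul hu (Or.inr hb) hw (Or.inr ha)) (Or.inr hc)

theorem tendsto_dilPairing {β f g : V → ℂ} (hβ : Continuous β) (hβ1 : Integrable β)
    (hf : MemLp f 2) (hg : MemLp g 2) {F G : ℕ → V → ℂ} (mF : ∀ n, MemLp (F n) 2)
    (mG : ∀ n, MemLp (G n) 2) (hF : Tendsto (fun n => eLpNorm (F n - f) 2) atTop (𝓝 0))
    (hG : Tendsto (fun n => eLpNorm (G n - g) 2) atTop (𝓝 0)) (t : ℝ) :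
    Tendsto (fun n => dilPairing β (F n) (G n) t) atTop (𝓝 (dilPairing β f g t)) := by
  have nG := tendsto_eLpNorm_of_sub mG hg hG
  rw [tendsto_iff_edist_tendsto_0]
  have h0 : Tendsto (fun n => eLpNorm β 1 * (eLpNorm (F n - f) 2 * eLpNorm (G n) 2)
      + eLpNorm β 1 * (eLpNorm f 2 * eLpNorm (G n - g) 2)) atTop (𝓝 0) := by
    have b1 : eLpNorm β 1 volume ≠ ⊤ := (memLp_one_iff_integrable.2 hβ1).eLpNorm_ne_top
    have t1 := ennreal_tendsto_mul_mul b1 hF nG ENNReal.zero_ne_top hg.eLpNorm_ne_top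
    have t2 := ennreal_tendsto_mul_mul b1 (tendsto_const_nhds (x := eLpNorm f 2 volume)) hG
      hf.eLpNorm_ne_top ENNReal.zero_ne_top
    rw [zero_mul, mul_zero] at t1
    rw [mul_zero, mul_zero] at t2
    simpa only [add_zero] using t1.add t2
  refine tendsto_of_tendsto_of_tendsto_of_le_of_le tendsto_const_nhds h0 (fun _ => zero_le) ?_
  intro n
  dsimp only
  rw [edist_eq_enorm_sub, dilPairing_sub hβ hβ1 hf hg (mF n) (mG n)]
  exact (enorm_add_le _ _).trans (add_le_add (enorm_dilPairing_le hβ hβ1 ((mF n).sub hf) (mG n) t)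
    (enorm_dilPairing_le hβ hβ1 hf ((mG n).sub hg) t))

/-- A scale-integrated bound passes from Schwartz functions to `L²`: each single pairing is continuous
in `L²`, and Fatou's lemma handles the integral over the scales. -/
theorem lintegral_dilPairing_le_of_schwartz (β : 𝓢(V, ℂ)) (C : NNReal)
    (hC : ∀ f g : 𝓢(V, ℂ), ∫⁻ t in Ioi (0 : ℝ), ‖dilPairing β f g t‖ₑ * ENNReal.ofReal t⁻¹
        ≤ C * (eLpNorm f 2 * eLpNorm g 2)) {f g : V → ℂ} (hf : MemLp f 2) (hg : MemLp g 2) :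
    ∫⁻ t in Ioi (0 : ℝ), ‖dilPairing β f g t‖ₑ * ENNReal.ofReal t⁻¹
        ≤ C * (eLpNorm f 2 * eLpNorm g 2) := by
  have hβ := β.continuous
  have hβ1 : Integrable β := β.integrable
  obtain ⟨F, hF⟩ := exists_schwartz_seq hf
  obtain ⟨G, hG⟩ := exists_schwartz_seq hg
  have mF : ∀ n, MemLp (F n) 2 (volume : Measure V) := fun n => (F n).memLp 2 volume
  have mG : ∀ n, MemLp (G n) 2 (volume : Measure V) := fun n => (G n).memLp 2 volume
  have nF := tendsto_eLpNorm_of_sub mF hf hF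
  have nG := tendsto_eLpNorm_of_sub mG hg hG
  have hlim := fun t => tendsto_dilPairing hβ hβ1 hf hg mF mG hF hG t
  have hmeas : ∀ n, Measurable fun t : ℝ =>
      ‖dilPairing β (F n) (G n) t‖ₑ * ENNReal.ofReal t⁻¹ := by
    intro n
    have : Measurable fun t : ℝ => dilPairing β (F n) (G n) t := by
      simp_rw [dilPairing_schwartz]
      refine (StronglyMeasurable.integral_prod_right' (ν := volume) (f := fun p : ℝ × V =>
        (𝓕 (F n)) p.2 * ((𝓕 (G n)) (-p.2) * (𝓕 β) (-(p.1 • p.2)))) ?_).measurable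
      refine Continuous.stronglyMeasurable ?_
      have := (𝓕 (F n)).continuous
      have := (𝓕 (G n)).continuous
      have := (𝓕 β).continuous
      fun_prop
    fun_prop
  have h1 : ∀ t : ℝ, liminf (fun n => ‖dilPairing β (F n) (G n) t‖ₑ * ENNReal.ofReal t⁻¹) atTop
      = ‖dilPairing β f g t‖ₑ * ENNReal.ofReal t⁻¹ := by
    intro t
    have h2 : Tendsto (fun n => ‖dilPairing β (F n) (G n) t‖ₑ) atTop
      (𝓝 ‖dilPairing β f g t‖ₑ) := (hlim t).enorm
    exact (ENNReal.Tendsto.mul_const h2 (Or.inr ENNReal.ofReal_ne_top)).liminf_eq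
  have h3 : liminf (fun n => (C : ℝ≥0∞) * (eLpNorm (F n) 2 volume * eLpNorm (G n) 2 volume)) atTop
      = C * (eLpNorm f 2 volume * eLpNorm g 2 volume) :=
    (ennreal_tendsto_mul_mul ENNReal.coe_ne_top nF nG hf.eLpNorm_ne_top
      hg.eLpNorm_ne_top).liminf_eq
  rw [← h3]
  simp_rw [← h1]
  refine (lintegral_liminf_le hmeas).trans ?_
  exact liminf_le_liminf (Eventually.of_forall fun n => hC (F n) (G n))

/-- **Boundedness of averaged dilations.** For a kernel with vanishing mean, here a derivative of
a Schwartz function, the pairings are integrable over all scales with respect to `dt / t`. -/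
theorem lintegral_dilPairing_le (κ : 𝓢(V, ℂ)) (v : V) :
    ∃ C : NNReal, ∀ f g : V → ℂ, MemLp f 2 → MemLp g 2 →
      ∫⁻ t in Ioi (0 : ℝ), ‖dilPairing (∂_{v} κ : 𝓢(V, ℂ)) f g t‖ₑ * ENNReal.ofReal t⁻¹
        ≤ C * (eLpNorm f 2 * eLpNorm g 2) := by
  obtain ⟨C, hC⟩ := lintegral_dilPairing_schwartz_le κ v
  exact ⟨C, fun f g hf hg => lintegral_dilPairing_le_of_schwartz _ C hC hf hg⟩

end Dilation

/-! ### Korn's inequality on sets that are stable under translations by a cone -/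

section Cone

open scoped LineDeriv SchwartzMap

variable {d : ℕ}

/-- `U` is stable under translations by the open cone spanned by the ball `ball e ρ`. -/
def IsConeStable (U : Set (E d)) (e : E d) (ρ : ℝ) : Prop :=
  ∀ x ∈ U, ∀ y ∈ Metric.ball e ρ, ∀ t : ℝ, 0 < t → x + t • y ∈ U

/-- For kernels supported in the cone, integration by parts moves the derivative to the kernel, and
only values in `U` are used. -/
theorem integral_kernel_fderiv {U : Set (E d)} {e : E d} {ρ : ℝ} (hU : IsConeStable U e ρ)
    {m F : E d → ℝ} (hm : ContDiff ℝ ∞ m) (hmc : HasCompactSupport m)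
    (hms : tsupport m ⊆ Metric.ball e ρ) (hF : ContDiff ℝ ∞ F) (v : E d) {x : E d} (hx : x ∈ U)
    {t : ℝ} (ht : 0 < t) :
    ∫ y, m y * fderiv ℝ F (x + t • y) v
      = -(t⁻¹ * ∫ y, fderiv ℝ m y v * U.indicator F (x + t • y)) := by
  have hF' : ∀ y, HasFDerivAt (fun y => F (x + t • y)) (t • fderiv ℝ F (x + t • y)) y := by
    intro y
    have h1 : HasFDerivAt (fun y : E d => x + t • y) (t • ContinuousLinearMap.id ℝ (E d)) y :=
      ((hasFDerivAt_id y).const_smul t).const_add x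
    have h2 := ((hF.differentiable (by simp)) (x + t • y)).hasFDerivAt.comp y h1
    refine h2.congr_fderiv ?_
    ext z
    simp
  have hsm : ContDiff ℝ ∞ (fun y => F (x + t • y)) := hF.comp (by fun_prop)
  have hdm : Continuous (fun y => fderiv ℝ m y v) :=
    (hm.continuous_fderiv (by simp)).clm_apply continuous_const
  have ibp := integral_mul_fderiv_eq_neg_fderiv_mul_of_integrable (μ := (volume : Measure (E d)))
    (f := m) (g := fun y => F (x + t • y)) (v := v) ?_ ?_ ?_
    (fun y _ => hm.differentiable (by simp) y) (fun y _ => hsm.differentiable (by simp) y)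
  · have e1 : ∀ y, fderiv ℝ (fun y => F (x + t • y)) y v = t * fderiv ℝ F (x + t • y) v := by
      intro y; rw [(hF' y).fderiv]; rfl
    have e2 : ∀ y, fderiv ℝ m y v * U.indicator F (x + t • y)
        = fderiv ℝ m y v * F (x + t • y) := by
      intro y
      by_cases hy : y ∈ tsupport m
      · rw [indicator_of_mem (hU x hx y (hms hy) t ht)]
      · have : fderiv ℝ m y = 0 := by
          by_contra h
          exact hy (support_fderiv_subset ℝ h)
        simp [this]
    simp_rw [e2]
    simp_rw [e1, mul_left_comm _ t, integral_const_mul] at ibp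
    field_simp
    linarith
  · exact (hdm.mul hsm.continuous).integrable_of_hasCompactSupport
      ((hmc.fderiv_apply (𝕜 := ℝ) v).mul_right)
  · exact (hm.continuous.mul ((hsm.continuous_fderiv (by simp)).clm_apply
      continuous_const)).integrable_of_hasCompactSupport hmc.mul_right
  · exact (hm.continuous.mul hsm.continuous).integrable_of_hasCompactSupport hmc.mul_right

theorem hasCompactSupport_ofReal {m : E d → ℝ} (hmc : HasCompactSupport m) :
    HasCompactSupport fun x => (m x : ℂ) :=
  hmc.comp_left (g := fun a : ℝ => (a : ℂ)) (by simp)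

/-- The averages over the cone of a derivative of `F` are controlled by `F` alone: at scale `t` the
integration by parts costs a factor `1 / t`, which is the weight in the bound for averaged
dilations. -/
theorem lintegral_kernel_fderiv_le {U : Set (E d)} (hUm : MeasurableSet U) {e : E d} {ρ : ℝ}
    (hU : IsConeStable U e ρ) {m : E d → ℝ} (hm : ContDiff ℝ ∞ m) (hmc : HasCompactSupport m)
    (hms : tsupport m ⊆ Metric.ball e ρ) (v : E d) :
    ∃ C : NNReal, ∀ F G : E d → ℝ, ContDiff ℝ ∞ F → HasCompactSupport F → Continuous G →
      HasCompactSupport G →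
      ∫⁻ t in Ioi (0 : ℝ), ‖∫ x in U, G x * ∫ y, m y * fderiv ℝ F (x + t • y) v‖ₑ
        ≤ C * (eLpNorm F 2 (volume.restrict U) * eLpNorm G 2 (volume.restrict U)) := by
  let κ : 𝓢(E d, ℂ) := (hasCompactSupport_ofReal hmc).toSchwartzMap
    (Complex.ofRealCLM.contDiff.comp hm)
  obtain ⟨C, hC⟩ := lintegral_dilPairing_le κ v
  refine ⟨C, fun F G hF hFc hG hGc => ?_⟩
  have hκ : ∀ y, (∂_{v} κ : 𝓢(E d, ℂ)) y = ((fderiv ℝ m y v : ℝ) : ℂ) := by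
    intro y
    rw [SchwartzMap.lineDerivOp_apply]
    have h1 : HasFDerivAt (κ : E d → ℂ) (Complex.ofRealCLM.comp (fderiv ℝ m y)) y :=
      Complex.ofRealCLM.hasFDerivAt.comp y (hm.differentiable (by simp) y).hasFDerivAt
    rw [h1.hasLineDerivAt v |>.lineDeriv]
    rfl
  set f : E d → ℂ := fun x => ((U.indicator F x : ℝ) : ℂ) with hf
  set g : E d → ℂ := fun x => ((U.indicator G x : ℝ) : ℂ) with hg
  have hind : ∀ H : E d → ℝ, Continuous H → HasCompactSupport H →
      MemLp (fun x => ((U.indicator H x : ℝ) : ℂ)) 2 ∧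
      eLpNorm (fun x => ((U.indicator H x : ℝ) : ℂ)) 2 = eLpNorm H 2 (volume.restrict U) := by
    intro H hH hHc
    have h2 : eLpNorm (fun x => ((U.indicator H x : ℝ) : ℂ)) 2 = eLpNorm (U.indicator H) 2 :=
      eLpNorm_congr_norm_ae (ae_of_all _ fun x => by simp)
    have h3 : MemLp (U.indicator H) 2 := (hH.memLp_of_hasCompactSupport hHc).indicator hUm
    refine ⟨⟨Complex.continuous_ofReal.comp_aestronglyMeasurable h3.1, by rw [h2]; exact h3.2⟩, ?_⟩
    rw [h2, eLpNorm_indicator_eq_eLpNorm_restrict hUm]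
  have key := hC f g (hind F hF.continuous hFc).1 (hind G hG hGc).1
  rw [(hind F hF.continuous hFc).2, (hind G hG hGc).2] at key
  refine le_trans (le_of_eq ?_) key
  refine setLIntegral_congr_fun measurableSet_Ioi fun t ht => ?_
  have ht : 0 < t := ht
  have e1 : dilPairing (∂_{v} κ : 𝓢(E d, ℂ)) f g t
      = ((∫ x, U.indicator G x * ∫ y, fderiv ℝ m y v * U.indicator F (x + t • y) : ℝ) : ℂ) := by
    rw [dilPairing, ← integral_complex_ofReal]
    congr 1
    ext x
    rw [integral_const_mul]
    push_cast
    rw [← integral_complex_ofReal]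
    congr 2
    ext y
    rw [hκ, hf]
    push_cast
    rfl
  have e2 : ∫ x in U, G x * ∫ y, m y * fderiv ℝ F (x + t • y) v
      = -(t⁻¹ * ∫ x, U.indicator G x * ∫ y, fderiv ℝ m y v * U.indicator F (x + t • y)) := by
    rw [← integral_const_mul, ← integral_neg, ← integral_indicator hUm]
    congr 1
    ext x
    by_cases hx : x ∈ U
    · rw [indicator_of_mem hx, indicator_of_mem hx,
        integral_kernel_fderiv hU hm hmc hms hF v hx ht]
      ring
    · simp [hx]
  simp only
  rw [e1, e2, enorm_neg, enorm_mul, mul_comm, ← ofReal_norm (t⁻¹), Real.norm_eq_abs,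
    abs_of_pos (inv_pos.2 ht)]
  congr 1
  rw [← ofReal_norm, ← ofReal_norm, Complex.norm_real]

/-- Reproducing formula: a compactly supported function is recovered from the averages of its
derivative over the cone. -/
theorem integral_sq_eq_neg {U : Set (E d)} {e : E d} {ρ : ℝ}
    (hρe : ρ < ‖e‖) {η P : E d → ℝ} (hη : ContDiff ℝ ∞ η) (hηc : HasCompactSupport η)
    (hηs : tsupport η ⊆ Metric.ball e ρ) (hη1 : ∫ y, η y = 1) (hP : ContDiff ℝ ∞ P)
    (hPc : HasCompactSupport P) :
    ∃ T : ℝ, 0 < T ∧ ∫ x in U, P x * P x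
      = -∫ t in Ioc 0 T, ∫ x in U, P x * ∫ y, η y * fderiv ℝ P (x + t • y) y := by
  have hdP := hP.continuous_fderiv (by simp)
  obtain ⟨M, hM⟩ := hPc.isCompact.isBounded.exists_norm_le
  obtain ⟨B, hB⟩ := (hPc.fderiv (𝕜 := ℝ)).exists_bound_of_continuous hdP
  -- every `y` in the ball has norm at least `‖e‖ - ρ`, so at scale `T` the translates of the support
  -- of `P` have left the support
  set T : ℝ := 2 * (|M| + 1) / (‖e‖ - ρ) with hT
  have hTpos : 0 < T := by
    have : 0 < ‖e‖ - ρ := by linarith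
    positivity
  set ψ : E d × ℝ → ℝ := fun p => ∫ y, η y * fderiv ℝ P (p.1 + p.2 • y) y with hψ
  have hbd : ∀ (x : E d) (t : ℝ) (y : E d),
      ‖η y * fderiv ℝ P (x + t • y) y‖ ≤ |η y| * (B * ‖y‖) := by
    intro x t y
    rw [norm_mul, Real.norm_eq_abs]
    gcongr
    exact ((fderiv ℝ P (x + t • y)).le_opNorm y).trans (by gcongr; exact hB _)
  have hηcont := hη.continuous
  have hbi : Integrable fun y => |η y| * (B * ‖y‖) :=
    (by fun_prop : Continuous fun y => |η y| * (B * ‖y‖)).integrable_of_hasCompactSupport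
      (hηc.norm.mul_right)
  have hψc : Continuous ψ := by
    refine continuous_of_dominated (bound := fun y => |η y| * (B * ‖y‖)) ?_ ?_ hbi ?_
    · intro p
      exact (by fun_prop : Continuous fun y => η y * fderiv ℝ P (p.1 + p.2 • y) y).aestronglyMeasurable
    · exact fun p => ae_of_all _ fun y => hbd _ _ _
    · refine ae_of_all _ fun y => ?_
      fun_prop
  have hderiv : ∀ (x : E d) (t : ℝ),
      HasDerivAt (fun t : ℝ => ∫ y, η y * P (x + t • y)) (ψ (x, t)) t := by
    intro x t
    have hPcont := hP.continuous
    refine (hasDerivAt_integral_of_dominated_loc_of_deriv_le (s := univ)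
      (bound := fun y => |η y| * (B * ‖y‖))
      (F' := fun t y => η y * fderiv ℝ P (x + t • y) y) univ_mem ?_ ?_ ?_ ?_ hbi ?_).2
    · exact Eventually.of_forall fun t =>
        (by fun_prop : Continuous fun y => η y * P (x + t • y)).aestronglyMeasurable
    · exact (by fun_prop : Continuous fun y => η y * P (x + t • y)).integrable_of_hasCompactSupport
        hηc.mul_right
    · exact (by fun_prop : Continuous fun y => η y * fderiv ℝ P (x + t • y) y).aestronglyMeasurable
    · exact ae_of_all _ fun y t _ => hbd x t y
    · refine ae_of_all _ fun y t _ => ?_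
      have h1 : HasDerivAt (fun t : ℝ => x + t • y) y t := by
        simpa using ((hasDerivAt_id t).smul_const y).const_add x
      exact (((hP.differentiable (by simp)) (x + t • y)).hasFDerivAt.comp_hasDerivAt t
        h1).const_mul (η y)
  -- the averages `∫ η(y) P(x + t y) dy` run from `P x` at `t = 0` to `0` at `t = T`
  have hrep : ∀ x, P x * P x = -∫ t in Ioc 0 T, P x * ψ (x, t) := by
    intro x
    by_cases hx : P x = 0
    · simp [hx]
    have hx' : ‖x‖ ≤ |M| := (hM x (subset_tsupport _ hx)).trans (le_abs_self M)
    have hi : IntervalIntegrable (fun t => ψ (x, t)) volume 0 T :=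
      (hψc.comp (by fun_prop : Continuous fun t : ℝ => (x, t))).intervalIntegrable 0 T
    have ftc := intervalIntegral.integral_eq_sub_of_hasDerivAt (fun t _ => hderiv x t) hi
    have h0 : ∫ y, η y * P (x + (0 : ℝ) • y) = P x := by
      simp [integral_mul_const, hη1]
    have h1 : ∫ y, η y * P (x + T • y) = 0 := by
      rw [← integral_zero (E d) ℝ (μ := volume)]
      congr 1
      ext y
      by_cases hy : y ∈ tsupport η
      · have hy2 : ‖e‖ - ρ < ‖y‖ := by
          have := hηs hy
          rw [Metric.mem_ball, dist_eq_norm, norm_sub_rev] at this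
          have := norm_sub_norm_le e y
          linarith
        have hbig : |M| < ‖x + T • y‖ := by
          have h3 : ‖T • y‖ = T * ‖y‖ := by rw [norm_smul, Real.norm_eq_abs, abs_of_pos hTpos]
          have h4 : ‖T • y‖ - ‖x‖ ≤ ‖x + T • y‖ := by
            have := norm_sub_norm_le (T • y) (-x)
            rw [norm_neg, sub_neg_eq_add, add_comm] at this
            exact this
          have h5 : 2 * (|M| + 1) ≤ T * ‖y‖ := by
            have hpos : 0 < ‖e‖ - ρ := by linarith
            calc 2 * (|M| + 1) = T * (‖e‖ - ρ) := by rw [hT]; field_simp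
              _ ≤ T * ‖y‖ := by gcongr
          have := abs_nonneg M
          linarith
        have : P (x + T • y) = 0 := by
          by_contra h
          exact absurd (hM _ (subset_tsupport _ h)) (not_le.2 ((le_abs_self M).trans_lt hbig))
        simp [this]
      · simp [image_eq_zero_of_notMem_tsupport hy]
    rw [h0, h1, zero_sub, intervalIntegral.integral_of_le hTpos.le] at ftc
    rw [integral_const_mul, ftc]
    ring
  refine ⟨T, hTpos, ?_⟩
  simp_rw [← integral_const_mul]
  have e1 : ∀ x t, ∫ y, P x * (η y * fderiv ℝ P (x + t • y) y) = P x * ψ (x, t) := by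
    intro x t
    rw [integral_const_mul]
  simp_rw [hrep, e1]
  rw [integral_neg, integral_integral_swap]
  have hPc2 : Integrable (Function.uncurry fun (x : E d) (t : ℝ) => P x * ψ (x, t))
      ((volume : Measure (E d)).prod (volume.restrict (Ioc 0 T))) := by
    have i1 : Integrable P := hP.continuous.integrable_of_hasCompactSupport hPc
    have i2 : Integrable (fun _ : ℝ => (1 : ℝ)) (volume.restrict (Ioc 0 T)) := integrable_const _
    refine ((i1.mul_prod i2).norm.mul_const (∫ y, |η y| * (B * ‖y‖))).mono' ?_
      (ae_of_all _ fun p => ?_)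
    · exact ((hP.continuous.comp continuous_fst).mul hψc).aestronglyMeasurable
    · simp only [Function.uncurry_def, mul_one, norm_mul]
      gcongr
      exact norm_integral_le_of_norm_le hbi (ae_of_all _ fun y => hbd _ _ _)
  exact hPc2.mono_measure (Measure.prod_mono Measure.restrict_le_self le_rfl)

end Cone

section KornCone

variable {d : ℕ}

theorem sq_eLpNorm_two {α F : Type*} [MeasurableSpace α] [NormedAddCommGroup F] (f : α → F)
    (m : Measure α) : eLpNorm f 2 m ^ 2 = ∫⁻ x, ‖f x‖ₑ ^ 2 ∂m := by
  have := eLpNorm_nnreal_pow_eq_lintegral (f := f) (μ := m) (p := 2) (by norm_num)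
  simpa using this

/-- The symmetric part of a matrix. -/
noncomputable def symPart : Mat d →L[ℝ] Mat d :=
  LinearMap.toContinuousLinearMap
    { toFun := fun G => WithLp.toLp 2 fun p => (G p + G p.swap) / 2
      map_add' := fun G H => by ext p; simp; ring
      map_smul' := fun c G => by ext p; simp; ring }

@[simp] theorem symPart_apply (G : Mat d) (i j : Fin d) :
    symPart G (i, j) = (G (i, j) + G (j, i)) / 2 := rfl

theorem gradField_apply (u : E d → E d) (x : E d) (i j : Fin d) :
    gradField u x (i, j) = (fderiv ℝ u x (basisVec j)) i := rfl

theorem contDiff_gradField {u : E d → E d} (hu : ContDiff ℝ ∞ u) :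
    ContDiff ℝ ∞ (gradField u) := by
  refine (PiLp.contDiff_toLp (p := 2)).comp (contDiff_pi.2 fun p => ?_)
  exact (EuclideanSpace.proj (𝕜 := ℝ) (ι := Fin d) p.1).contDiff.comp
    ((hu.fderiv_right (m := ∞) (by simp)).clm_apply contDiff_const)

theorem hasCompactSupport_gradField {u : E d → E d} (hu : HasCompactSupport u) :
    HasCompactSupport (gradField u) := by
  refine (hu.fderiv (𝕜 := ℝ)).comp_left
    (g := fun L : E d →L[ℝ] E d => WithLp.toLp 2 fun p : Fin d × Fin d => (L (basisVec p.2)) p.1) ?_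
  ext p
  simp

theorem contDiff_entry {G : E d → Mat d} (hG : ContDiff ℝ ∞ G) (p : Fin d × Fin d) :
    ContDiff ℝ ∞ fun x => G x p :=
  (EuclideanSpace.proj (𝕜 := ℝ) (ι := Fin d × Fin d) p).contDiff.comp hG

theorem hasCompactSupport_entry {G : E d → Mat d} (hG : HasCompactSupport G)
    (p : Fin d × Fin d) : HasCompactSupport fun x => G x p :=
  hG.comp_left (g := fun M : Mat d => M p) (by simp)

theorem fderiv_entry {G : E d → Mat d} (hG : ContDiff ℝ ∞ G) (p : Fin d × Fin d) (x v : E d) :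
    fderiv ℝ (fun x => G x p) x v = fderiv ℝ G x v p := by
  have := ((EuclideanSpace.proj (𝕜 := ℝ) (ι := Fin d × Fin d) p).hasFDerivAt (x := G x)).comp x
    (hG.differentiable (by simp) x).hasFDerivAt
  exact congrArg (fun L => L v) this.fderiv

theorem fderiv_gradField_apply {u : E d → E d} (hu : ContDiff ℝ ∞ u) (x v : E d) (i j : Fin d) :
    fderiv ℝ (gradField u) x v (i, j) = (fderiv ℝ (fderiv ℝ u) x v (basisVec j)) i := by
  rw [← fderiv_entry (contDiff_gradField hu)]
  have h2 : HasFDerivAt (fderiv ℝ u) (fderiv ℝ (fderiv ℝ u) x) x :=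
    ((hu.fderiv_right (m := ∞) (by simp)).differentiable (by simp) x).hasFDerivAt
  have h3 := (EuclideanSpace.proj (𝕜 := ℝ) (ι := Fin d) i).hasFDerivAt.comp x
    (h2.clm_apply (hasFDerivAt_const (basisVec j) x))
  have h4 := congrArg (fun L => L v) h3.fderiv
  simpa [Function.comp_def, gradField_apply] using h4

/-- Saint-Venant's identity: second derivatives of a field are combinations of first derivatives of
its strain. -/
theorem fderiv_gradField_eq_strain {u : E d → E d} (hu : ContDiff ℝ ∞ u) (x : E d)
    (i j k : Fin d) :
    fderiv ℝ (gradField u) x (basisVec k) (i, j)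
      = symPart (fderiv ℝ (gradField u) x (basisVec k)) (i, j)
        + symPart (fderiv ℝ (gradField u) x (basisVec j)) (i, k)
        - symPart (fderiv ℝ (gradField u) x (basisVec i)) (j, k) := by
  have hs : ∀ v w, fderiv ℝ (fderiv ℝ u) x v w = fderiv ℝ (fderiv ℝ u) x w v := by
    have : IsSymmSndFDerivAt ℝ u x :=
      hu.contDiffAt.isSymmSndFDerivAt (by simpa using ENat.LEInfty.out)
    exact fun v w => this v w
  simp only [symPart_apply, fderiv_gradField_apply hu]
  rw [hs (basisVec k) (basisVec j), hs (basisVec k) (basisVec i), hs (basisVec j) (basisVec i)]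
  ring

/-- The average of the directional derivative `∂ᵥF` with kernel `m` dilated by `t`. -/
noncomputable def kernelAvg (m F : E d → ℝ) (v : E d) (p : E d × ℝ) : ℝ :=
  ∫ y, m y * fderiv ℝ F (p.1 + p.2 • y) v

theorem integrable_kernelAvg {m F : E d → ℝ} (hm : Continuous m) (hmc : HasCompactSupport m)
    (hF : ContDiff ℝ ∞ F) (v : E d) (p : E d × ℝ) :
    Integrable fun y => m y * fderiv ℝ F (p.1 + p.2 • y) v := by
  have hd := hF.continuous_fderiv (by simp)
  exact (by fun_prop : Continuous fun y => m y * fderiv ℝ F (p.1 + p.2 • y) v)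
    |>.integrable_of_hasCompactSupport hmc.mul_right

theorem continuous_kernelAvg {m F : E d → ℝ} (hm : Continuous m) (hmc : HasCompactSupport m)
    (hF : ContDiff ℝ ∞ F) (hFc : HasCompactSupport F) (v : E d) :
    Continuous (kernelAvg m F v) := by
  have hd := hF.continuous_fderiv (by simp)
  obtain ⟨B, hB⟩ := (hFc.fderiv_apply (𝕜 := ℝ) v).exists_bound_of_continuous
    (hd.clm_apply continuous_const)
  refine continuous_of_dominated (bound := fun y => |m y| * B) (fun p => ?_) (fun p => ?_) ?_ ?_
  · exact (integrable_kernelAvg hm hmc hF v p).aestronglyMeasurable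
  · refine ae_of_all _ fun y => ?_
    rw [norm_mul, Real.norm_eq_abs]
    gcongr
    exact hB _
  · exact (hm.abs.integrable_of_hasCompactSupport hmc.norm).mul_const B
  · refine ae_of_all _ fun y => ?_
    fun_prop

theorem integrable_mul_kernelAvg {U : Set (E d)} {m F G : E d → ℝ} (hm : Continuous m)
    (hmc : HasCompactSupport m) (hF : ContDiff ℝ ∞ F) (hFc : HasCompactSupport F) (v : E d)
    (hG : Continuous G) (hGc : HasCompactSupport G) (t : ℝ) :
    Integrable (fun x => G x * kernelAvg m F v (x, t)) (volume.restrict U) := by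
  have := continuous_kernelAvg hm hmc hF hFc v
  exact (by fun_prop : Continuous fun x => G x * kernelAvg m F v (x, t))
    |>.integrable_of_hasCompactSupport hGc.mul_right |>.restrict

theorem measurable_integral_kernelAvg {U : Set (E d)} {m F G : E d → ℝ} (hm : Continuous m)
    (hmc : HasCompactSupport m) (hF : ContDiff ℝ ∞ F) (hFc : HasCompactSupport F) (v : E d)
    (hG : Continuous G) :
    Measurable fun t : ℝ => ∫ x in U, G x * kernelAvg m F v (x, t) := by
  have h := continuous_kernelAvg hm hmc hF hFc v
  refine (StronglyMeasurable.integral_prod_right' (ν := volume.restrict U)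
    (f := fun q : ℝ × E d => G q.2 * kernelAvg m F v (q.2, q.1)) ?_).measurable
  exact (by fun_prop : Continuous fun q : ℝ × E d =>
    G q.2 * kernelAvg m F v (q.2, q.1)).stronglyMeasurable

theorem sum_smul_basisVec (y : E d) : y = ∑ k, y k • basisVec k := by
  have := (EuclideanSpace.basisFun (Fin d) ℝ).sum_repr y
  simpa [basisVec] using this.symm

theorem eLpNorm_entry_le {α : Type*} [MeasurableSpace α] (m : Measure α) (G : α → Mat d)
    (p : Fin d × Fin d) : eLpNorm (fun x => G x p) 2 m ≤ eLpNorm G 2 m :=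
  eLpNorm_mono fun x => PiLp.norm_apply_le (G x) p

theorem norm_le_sum_entries (G : Mat d) : ‖G‖ ≤ ∑ p, ‖G p‖ := by
  have : G = ∑ p, EuclideanSpace.single p (G p) := by
    have := (EuclideanSpace.basisFun (Fin d × Fin d) ℝ).sum_repr G
    conv_lhs => rw [← this]
    refine Finset.sum_congr rfl fun p _ => ?_
    ext q
    simp
  conv_lhs => rw [this]
  refine (norm_sum_le _ _).trans (Finset.sum_le_sum fun p _ => ?_)
  simp

theorem eLpNorm_le_sum_entries {α : Type*} [MeasurableSpace α] (m : Measure α) (G : α → Mat d)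
    (hG : AEStronglyMeasurable G m) : eLpNorm G 2 m ≤ ∑ p, eLpNorm (fun x => G x p) 2 m := by
  have h1 : eLpNorm G 2 m ≤ eLpNorm (∑ p : Fin d × Fin d, fun x => ‖G x p‖) 2 m := by
    refine eLpNorm_mono fun x => ?_
    rw [Finset.sum_apply, Real.norm_of_nonneg (Finset.sum_nonneg fun _ _ => norm_nonneg _)]
    exact norm_le_sum_entries (G x)
  refine h1.trans ((eLpNorm_sum_le (fun p _ => ?_) (by norm_num)).trans (le_of_eq ?_))
  · exact ((EuclideanSpace.proj (𝕜 := ℝ) (ι := Fin d × Fin d) p).continuous.comp_aestronglyMeasurable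
      hG).norm
  · simp_rw [eLpNorm_norm]

theorem integral_sum_add_sub {α : Type*} [MeasurableSpace α] {ν : Measure α}
    {a b c : Fin d → α → ℝ} (ha : ∀ k, Integrable (a k) ν) (hb : ∀ k, Integrable (b k) ν)
    (hc : ∀ k, Integrable (c k) ν) :
    ∫ x, ∑ k, (a k x + b k x - c k x) ∂ν
      = ∑ k, (∫ x, a k x ∂ν + ∫ x, b k x ∂ν - ∫ x, c k x ∂ν) := by
  have hi : ∀ k, Integrable (fun x => a k x + b k x - c k x) ν :=
    fun k => ((ha k).add (hb k)).sub (hc k)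
  rw [integral_finsetSum _ fun k _ => hi k]
  refine Finset.sum_congr rfl fun k _ => ?_
  rw [integral_sub (f := fun x => a k x + b k x) ((ha k).add (hb k)) (hc k),
    integral_add (ha k) (hb k)]

/-- **Korn's inequality on a cone-stable set.** The reproducing formula represents an entry `P` of the
gradient by averages of its derivatives; by Saint-Venant's identity these are derivatives of the
strain, and `lintegral_kernel_fderiv_le` bounds `‖P‖²` by `‖strain‖ ‖P‖`. -/
theorem korn_coneStable {U : Set (E d)} (hUm : MeasurableSet U) {e : E d} {ρ : ℝ} (hρ : 0 < ρ)
    (hρe : ρ < ‖e‖) (hU : IsConeStable U e ρ) :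
    ∃ C : NNReal, ∀ u : E d → E d, ContDiff ℝ ∞ u → HasCompactSupport u →
      eLpNorm (gradField u) 2 (volume.restrict U)
        ≤ C * eLpNorm (fun x => symPart (gradField u x)) 2 (volume.restrict U) := by
  let φ : ContDiffBump e := ⟨ρ / 3, ρ / 2, by linarith, by linarith⟩
  set η : E d → ℝ := φ.normed volume with hηdef
  have hη : ContDiff ℝ ∞ η := φ.contDiff_normed
  have hηc : HasCompactSupport η := φ.hasCompactSupport_normed
  have hηs : tsupport η ⊆ Metric.ball e ρ := by
    rw [hηdef, φ.tsupport_normed_eq]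
    exact Metric.closedBall_subset_ball (by change ρ / 2 < ρ; linarith)
  have hη1 : ∫ y, η y = 1 := φ.integral_normed
  -- the kernels for the partial derivatives in `∂_y P = ∑ k, y k ∂_k P`
  set m : Fin d → E d → ℝ := fun k y => y k * η y with hmdef
  have hm : ∀ k, ContDiff ℝ ∞ (m k) := fun k =>
    ((EuclideanSpace.proj (𝕜 := ℝ) (ι := Fin d) k).contDiff).mul hη
  have hmc : ∀ k, HasCompactSupport (m k) := fun k => hηc.mul_left
  have hms : ∀ k, tsupport (m k) ⊆ Metric.ball e ρ := fun k =>
    (tsupport_mul_subset_right (f := fun y : E d => y k) (g := η)).trans hηs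
  choose C hC using fun k l : Fin d => lintegral_kernel_fderiv_le hUm hU (hm k) (hmc k) (hms k)
    (basisVec l)
  -- the constant for a single entry of the gradient
  set K : Fin d × Fin d → NNReal := fun p => ∑ k, (C k k + C k p.2 + C k p.1) with hK
  refine ⟨∑ p, K p, fun u hu huc => ?_⟩
  set S : E d → Mat d := fun x => symPart (gradField u x) with hS
  have hSs : ContDiff ℝ ∞ S := symPart.contDiff.comp (contDiff_gradField hu)
  have hSc : HasCompactSupport S :=
    (hasCompactSupport_gradField huc).comp_left (g := symPart) (map_zero _)
  have hSd : ∀ x v, fderiv ℝ S x v = symPart (fderiv ℝ (gradField u) x v) := by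
    intro x v
    have := (symPart (d := d)).hasFDerivAt.comp x
      ((contDiff_gradField hu).differentiable (by simp) x).hasFDerivAt
    exact congrArg (fun L => L v) this.fderiv
  have entry : ∀ p : Fin d × Fin d, eLpNorm (fun x => gradField u x p) 2 (volume.restrict U)
      ≤ K p * eLpNorm S 2 (volume.restrict U) := by
    rintro ⟨i, j⟩
    set P : E d → ℝ := fun x => gradField u x (i, j) with hPdef
    have hP : ContDiff ℝ ∞ P := contDiff_entry (contDiff_gradField hu) _
    have hPc : HasCompactSupport P := hasCompactSupport_entry (hasCompactSupport_gradField huc) _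
    have hSe : ∀ p, ContDiff ℝ ∞ fun x => S x p := fun p => contDiff_entry hSs p
    have hSec : ∀ p, HasCompactSupport fun x => S x p := fun p => hasCompactSupport_entry hSc p
    obtain ⟨T, hT, hrep⟩ := integral_sq_eq_neg (U := U) hρe hη hηc hηs hη1 hP hPc
    set J : Fin d → Fin d → Fin d × Fin d → ℝ → ℝ := fun k l p t =>
      ∫ x in U, P x * kernelAvg (m k) (fun x => S x p) (basisVec l) (x, t) with hJ
    have hJm : ∀ k l p, Measurable (J k l p) := fun k l p =>
      measurable_integral_kernelAvg (hm k).continuous (hmc k) (hSe p) (hSec p) _ hP.continuous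
    have hJle : ∀ k l p, ∫⁻ t in Ioc 0 T, ‖J k l p t‖ₑ ≤ C k l *
        (eLpNorm S 2 (volume.restrict U) * eLpNorm P 2 (volume.restrict U)) := by
      intro k l p
      refine (lintegral_mono_set Ioc_subset_Ioi_self).trans
        ((hC k l (fun x => S x p) P (hSe p) (hSec p) hP.continuous hPc).trans ?_)
      gcongr
      exact eLpNorm_entry_le _ S p
    have hsplit : ∀ t, ∫ x in U, P x * ∫ y, η y * fderiv ℝ P (x + t • y) y
        = ∑ k, (J k k (i, j) t + J k j (i, k) t - J k i (j, k) t) := by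
      intro t
      have ig : ∀ k l p, Integrable (fun x =>
          P x * kernelAvg (m k) (fun x => S x p) (basisVec l) (x, t)) (volume.restrict U) :=
        fun k l p => integrable_mul_kernelAvg (hm k).continuous (hmc k) (hSe p) (hSec p) _
          hP.continuous hPc t
      have : ∀ x, P x * ∫ y, η y * fderiv ℝ P (x + t • y) y = ∑ k,
          (P x * kernelAvg (m k) (fun x => S x (i, j)) (basisVec k) (x, t)
          + P x * kernelAvg (m k) (fun x => S x (i, k)) (basisVec j) (x, t)
          - P x * kernelAvg (m k) (fun x => S x (j, k)) (basisVec i) (x, t)) := by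
        intro x
        have iy : ∀ k l p, Integrable fun y =>
            m k y * fderiv ℝ (fun x => S x p) (x + t • y) (basisVec l) :=
          fun k l p => integrable_kernelAvg (hm k).continuous (hmc k) (hSe p) (basisVec l) (x, t)
        have e0 : ∀ y, η y * fderiv ℝ P (x + t • y) y = ∑ k,
            (m k y * fderiv ℝ (fun x => S x (i, j)) (x + t • y) (basisVec k)
            + m k y * fderiv ℝ (fun x => S x (i, k)) (x + t • y) (basisVec j)
            - m k y * fderiv ℝ (fun x => S x (j, k)) (x + t • y) (basisVec i)) := by
          intro y
          conv_lhs => rw [show fderiv ℝ P (x + t • y) y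
            = ∑ k, y k * fderiv ℝ P (x + t • y) (basisVec k) by
              conv_lhs => rw [sum_smul_basisVec y, map_sum, ← sum_smul_basisVec y]
              simp, Finset.mul_sum]
          refine Finset.sum_congr rfl fun k _ => ?_
          rw [hPdef, fderiv_entry (contDiff_gradField hu), fderiv_gradField_eq_strain hu]
          simp only [fderiv_entry hSs, hSd, hmdef]
          ring
        simp_rw [e0]
        rw [integral_sum_add_sub (fun k => iy _ _ _) (fun k => iy _ _ _) (fun k => iy _ _ _),
          Finset.mul_sum]
        refine Finset.sum_congr rfl fun k _ => ?_
        simp only [kernelAvg]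
        ring
      simp_rw [this]
      exact integral_sum_add_sub (fun k => ig _ _ _) (fun k => ig _ _ _) (fun k => ig _ _ _)
    have hPL : MemLp P 2 (volume.restrict U) :=
      (hP.continuous.memLp_of_hasCompactSupport hPc).restrict U
    have hsq : eLpNorm P 2 (volume.restrict U) ^ 2 = ‖∫ x in U, P x * P x‖ₑ := by
      rw [sq_eLpNorm_two, Real.enorm_of_nonneg (integral_nonneg fun x => mul_self_nonneg _),
        ofReal_integral_eq_lintegral_ofReal (memLp_two_mul_integrable hPL hPL)
          (ae_of_all _ fun x => mul_self_nonneg _)]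
      refine lintegral_congr fun x => ?_
      rw [← ofReal_norm, ← ENNReal.ofReal_pow (norm_nonneg _), Real.norm_eq_abs, sq_abs, sq]
    have hfin : eLpNorm P 2 (volume.restrict U) * eLpNorm P 2 (volume.restrict U)
        ≤ (K (i, j) * eLpNorm S 2 (volume.restrict U)) * eLpNorm P 2 (volume.restrict U) := by
      rw [← sq, hsq, hrep, enorm_neg]
      simp_rw [hsplit]
      refine (enorm_integral_le_lintegral_enorm _).trans ?_
      calc ∫⁻ t in Ioc 0 T, ‖∑ k, (J k k (i, j) t + J k j (i, k) t - J k i (j, k) t)‖ₑ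
          ≤ ∫⁻ t in Ioc 0 T, ∑ k, (‖J k k (i, j) t‖ₑ + ‖J k j (i, k) t‖ₑ + ‖J k i (j, k) t‖ₑ) := by
            refine lintegral_mono fun t => ?_
            refine (enorm_sum_le _ _).trans (Finset.sum_le_sum fun k _ => ?_)
            refine enorm_sub_le.trans ?_
            gcongr
            exact enorm_add_le _ _
        _ = ∑ k, ((∫⁻ t in Ioc 0 T, ‖J k k (i, j) t‖ₑ) + (∫⁻ t in Ioc 0 T, ‖J k j (i, k) t‖ₑ)
            + (∫⁻ t in Ioc 0 T, ‖J k i (j, k) t‖ₑ)) := by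
            rw [lintegral_finsetSum _ fun k _ => by
              have h1 := hJm k k (i, j); have h2 := hJm k j (i, k); have h3 := hJm k i (j, k)
              fun_prop]
            refine Finset.sum_congr rfl fun k _ => ?_
            rw [lintegral_add_right _ (hJm _ _ _).enorm, lintegral_add_right _ (hJm _ _ _).enorm]
        _ ≤ ∑ k, (C k k + C k j + C k i) * (eLpNorm S 2 (volume.restrict U)
            * eLpNorm P 2 (volume.restrict U)) := by
            refine Finset.sum_le_sum fun k _ => ?_
            rw [add_mul, add_mul]
            exact add_le_add (add_le_add (hJle _ _ _) (hJle _ _ _)) (hJle _ _ _)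
        _ = _ := by
            rw [← Finset.sum_mul, hK]
            push_cast
            ring
    rcases eq_or_ne (eLpNorm P 2 (volume.restrict U)) 0 with h0 | h0
    · rw [h0]; exact zero_le
    · exact (ENNReal.mul_le_mul_iff_left h0 hPL.eLpNorm_ne_top).1 hfin
  refine (eLpNorm_le_sum_entries _ _
    (contDiff_gradField hu).continuous.aestronglyMeasurable).trans ?_
  rw [ENNReal.ofNNReal_finsetSum, Finset.sum_mul]
  exact Finset.sum_le_sum fun p _ => entry p

end KornCone

/-! ### Localization to charts and Korn's second inequality -/

section Charts

variable {d : ℕ}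

/-- Near `x`, in the ball of radius `r`, the set `Ω` coincides with the cone-stable set `U`. -/
structure IsConeChart (Ω : Set (E d)) (x : E d) (r : ℝ) (U : Set (E d)) (e : E d) (ρ : ℝ) :
    Prop where
  r_pos : 0 < r
  measurableSet : MeasurableSet U
  ρ_pos : 0 < ρ
  ρ_lt : ρ < ‖e‖
  stable : IsConeStable U e ρ
  mem_iff : ∀ y ∈ Metric.ball x r, (y ∈ Ω ↔ y ∈ U)

theorem norm_sub_inner_smul_le {e : E d} (he : ‖e‖ = 1) (z : E d) :
    ‖z - inner ℝ z e • e‖ ≤ ‖z‖ := by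
  have h : ‖z - inner ℝ z e • e‖ ^ 2 = ‖z‖ ^ 2 - inner ℝ z e ^ 2 := by
    rw [norm_sub_sq_real, inner_smul_right, norm_smul, he, Real.norm_eq_abs, mul_one, sq_abs]
    ring
  have := sq_nonneg (inner ℝ z e : ℝ)
  exact abs_le_of_sq_le_sq' (by nlinarith) (norm_nonneg z) |>.2

/-- The strict epigraph of `a` above the hyperplane orthogonal to `e`. -/
def epigraph (e : E d) (a : E d → ℝ) : Set (E d) :=
  {y | a (y - inner ℝ y e • e) < inner ℝ y e}

theorem isConeStable_epigraph {e : E d} (he : ‖e‖ = 1) {K : NNReal} {a : E d → ℝ}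
    (ha : LipschitzWith K a) : IsConeStable (epigraph e a) e (1 / (K + 2)) := by
  intro x hx y hy t ht
  simp only [epigraph, Set.mem_ofPred_eq] at hx ⊢
  rw [Metric.mem_ball, dist_eq_norm] at hy
  have hee : inner ℝ e e = (1 : ℝ) := by rw [real_inner_self_eq_norm_sq, he]; norm_num
  have e1 : (x + t • y) - inner ℝ (x + t • y) e • e
      = (x - inner ℝ x e • e) + t • ((y - e) - inner ℝ (y - e) e • e) := by
    simp only [inner_add_left, inner_smul_left, inner_sub_left, hee, smul_sub, add_smul, sub_smul,
      smul_smul]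
    simp
    abel
  have h1 : a ((x + t • y) - inner ℝ (x + t • y) e • e) ≤ a (x - inner ℝ x e • e)
      + K * (t * ‖y - e‖) := by
    have := ha.dist_le_mul ((x + t • y) - inner ℝ (x + t • y) e • e) (x - inner ℝ x e • e)
    rw [e1, dist_eq_norm, dist_eq_norm, add_sub_cancel_left, norm_smul, Real.norm_eq_abs,
      Real.norm_eq_abs, abs_of_pos ht] at this
    have h2 := norm_sub_inner_smul_le he (y - e)
    have h3 := (le_abs_self _).trans this
    rw [e1]
    have : (K : ℝ) * (t * ‖y - e - inner ℝ (y - e) e • e‖) ≤ K * (t * ‖y - e‖) := by gcongr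
    linarith
  have h2 : inner ℝ (x + t • y) e ≥ inner ℝ x e + t * (1 - ‖y - e‖) := by
    have : inner ℝ (y - e) e ≥ -‖y - e‖ := by
      have := abs_real_inner_le_norm (y - e) e
      rw [he, mul_one] at this
      exact (abs_le.1 this).1
    rw [inner_sub_left, hee] at this
    rw [inner_add_left, inner_smul_left]
    simp only [conj_trivial]
    nlinarith
  have h3 : (K : ℝ) * ‖y - e‖ + ‖y - e‖ < 1 := by
    have hK : (0 : ℝ) ≤ K := K.2
    have : ((K : ℝ) + 2) * ‖y - e‖ < 1 := by
      rw [lt_div_iff₀ (by positivity)] at hy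
      linarith
    nlinarith [norm_nonneg (y - e)]
  nlinarith

theorem isOpen_epigraph (e : E d) {a : E d → ℝ} (ha : Continuous a) : IsOpen (epigraph e a) :=
  isOpen_lt (by fun_prop) (by fun_prop)

theorem isConeChart_epigraph {Ω : Set (E d)} {x e : E d} {r : ℝ} (hr : 0 < r) (he : ‖e‖ = 1)
    {K : NNReal} {a : E d → ℝ} (ha : LipschitzWith K a)
    (h : ∀ y ∈ Metric.ball x r, (y ∈ Ω ↔ a (y - inner ℝ y e • e) < inner ℝ y e)) :
    IsConeChart Ω x r (epigraph e a) e (1 / (K + 2)) := by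
  refine ⟨hr, (isOpen_epigraph e ha.continuous).measurableSet, by positivity, ?_,
    isConeStable_epigraph he ha, h⟩
  rw [he, div_lt_one (by positivity)]
  have : (0 : ℝ) ≤ K := K.2
  linarith

theorem exists_coneChart (hd : 2 ≤ d) {Ω : Set (E d)} (hΩ : IsOpen Ω)
    (hL : HasLipschitzBoundary Ω) (x : E d) (hx : x ∈ closure Ω) :
    ∃ r U e ρ, IsConeChart Ω x r U e ρ := by
  by_cases hxΩ : x ∈ Ω
  · obtain ⟨r, hr, hb⟩ := Metric.isOpen_iff.1 hΩ x hxΩ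
    -- at an interior point the whole space serves, with any direction
    refine ⟨r, univ, basisVec ⟨0, by lia⟩, 1 / 2, hr, MeasurableSet.univ, by norm_num, ?_,
      fun _ _ _ _ _ _ => trivial, fun y hy => by simp [hb hy]⟩
    simp [basisVec]
    norm_num
  · have hf : x ∈ frontier Ω := by rw [hΩ.frontier_eq]; exact ⟨hx, hxΩ⟩
    obtain ⟨r, hr, e, he, K, a, ha, h⟩ := hL x hf
    exact ⟨r, epigraph e a, e, 1 / (K + 2), isConeChart_epigraph hr he ha h⟩

theorem lintegral_biUnion_finset_le {α ι : Type*} [MeasurableSpace α] {ν : Measure α}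
    (t : Finset ι) (B : ι → Set α) (f : α → ℝ≥0∞) :
    ∫⁻ x in ⋃ i ∈ t, B i, f x ∂ν ≤ ∑ i ∈ t, ∫⁻ x in B i, f x ∂ν := by
  classical
  induction t using Finset.induction_on with
  | empty => simp
  | insert a t ha ih =>
    rw [Finset.set_biUnion_insert, Finset.sum_insert ha]
    exact (lintegral_union_le f _ _).trans (add_le_add le_rfl ih)

theorem eLpNorm_restrict_le_sum {F ι : Type*} [NormedAddCommGroup F] (ν : Measure (E d))
    (f : E d → F) {S : Set (E d)} (t : Finset ι) (B : ι → Set (E d)) (h : S ⊆ ⋃ i ∈ t, B i) :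
    eLpNorm f 2 (ν.restrict S) ≤ ∑ i ∈ t, eLpNorm f 2 (ν.restrict (S ∩ B i)) := by
  have h1 : eLpNorm f 2 (ν.restrict S) ^ 2
      ≤ ∑ i ∈ t, eLpNorm f 2 (ν.restrict (S ∩ B i)) ^ 2 := by
    simp_rw [sq_eLpNorm_two]
    have : S ⊆ ⋃ i ∈ t, S ∩ B i := fun x hx => by
      obtain ⟨i, hi, hb⟩ := mem_iUnion₂.1 (h hx)
      exact mem_iUnion₂.2 ⟨i, hi, hx, hb⟩
    exact (lintegral_mono_set this).trans (lintegral_biUnion_finset_le t (fun i => S ∩ B i) _)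
  have h2 : ∑ i ∈ t, eLpNorm f 2 (ν.restrict (S ∩ B i)) ^ 2
      ≤ (∑ i ∈ t, eLpNorm f 2 (ν.restrict (S ∩ B i))) ^ 2 := by
    rw [sq (∑ i ∈ t, _), Finset.sum_mul]
    refine Finset.sum_le_sum fun i hi => ?_
    rw [sq]
    gcongr
    exact Finset.single_le_sum (f := fun i => eLpNorm f 2 (ν.restrict (S ∩ B i)))
      (fun _ _ => zero_le) hi
  exact (ENNReal.pow_le_pow_left_iff two_ne_zero).1 (h1.trans h2)

/-- Rank-one matrix with entries `aᵢ ℓ(eⱼ)`. -/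
noncomputable def outer (a : E d) (l : E d →L[ℝ] ℝ) : Mat d :=
  WithLp.toLp 2 fun p => a p.1 * l (basisVec p.2)

theorem norm_outer_le (a : E d) (l : E d →L[ℝ] ℝ) :
    ‖outer a l‖ ≤ (d * d : ℕ) * (‖l‖ * ‖a‖) := by
  refine (norm_le_sum_entries _).trans ?_
  have : ∀ p ∈ (Finset.univ : Finset (Fin d × Fin d)), ‖outer a l p‖ ≤ ‖l‖ * ‖a‖ := by
    intro p _
    change ‖a p.1 * l (basisVec p.2)‖ ≤ _
    rw [norm_mul, mul_comm]
    gcongr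
    · simpa [basisVec] using l.le_opNorm (basisVec p.2)
    · exact PiLp.norm_apply_le a p.1
  refine (Finset.sum_le_card_nsmul _ _ _ this).trans (le_of_eq ?_)
  simp

theorem gradField_smul_fun {χ : E d → ℝ} {φ : E d → E d} (hχ : ContDiff ℝ ∞ χ)
    (hφ : ContDiff ℝ ∞ φ) (x : E d) :
    gradField (fun y => χ y • φ y) x = χ x • gradField φ x + outer (φ x) (fderiv ℝ χ x) := by
  have h : HasFDerivAt (fun y => χ y • φ y) (χ x • fderiv ℝ φ x + (fderiv ℝ χ x).smulRight (φ x)) x :=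
    (hχ.differentiable (by simp) x).hasFDerivAt.smul (hφ.differentiable (by simp) x).hasFDerivAt
  ext ⟨i, j⟩
  rw [gradField_apply, h.fderiv]
  simp [outer, gradField]
  ring

/-- A cut-off function for the ball `ball x r`, equal to `1` on the ball of half the radius, with
the effect of the cut-off on fields and their gradients. -/
theorem exists_cutoff (x : E d) {r : ℝ} (hr : 0 < r) :
    ∃ (χ : E d → ℝ) (M : NNReal), ContDiff ℝ ∞ χ ∧ HasCompactSupport χ ∧
      (∀ y, y ∉ Metric.ball x r → χ y = 0) ∧
      ∀ φ : E d → E d, ContDiff ℝ ∞ φ →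
        ContDiff ℝ ∞ (fun y => χ y • φ y) ∧ HasCompactSupport (fun y => χ y • φ y) ∧
        (∀ y ∈ Metric.ball x (r / 2), χ y • φ y = φ y ∧
          gradField (fun y => χ y • φ y) y = gradField φ y) ∧
        (∀ y, y ∉ Metric.ball x r → gradField (fun y => χ y • φ y) y = 0) ∧
        (∀ y, ‖χ y • φ y‖ ≤ ‖φ y‖) ∧
        (∀ y, ‖gradField (fun y => χ y • φ y) y‖ ≤ ‖gradField φ y‖ + M * ‖φ y‖) ∧
        (∀ y, ‖symPart (gradField (fun y => χ y • φ y) y)‖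
          ≤ ‖symPart (gradField φ y)‖ + M * ‖φ y‖) := by
  let χ : ContDiffBump x := ⟨r / 2, 3 * r / 4, by linarith, by linarith⟩
  have hs : tsupport χ ⊆ Metric.ball x r := by
    rw [χ.tsupport_eq]
    exact Metric.closedBall_subset_ball (by change 3 * r / 4 < r; linarith)
  have hχ : ContDiff ℝ ∞ χ := χ.contDiff
  obtain ⟨B, hB⟩ := (χ.hasCompactSupport.fderiv (𝕜 := ℝ)).exists_bound_of_continuous
    (hχ.continuous_fderiv (by simp))
  have hB0 : 0 ≤ B := (norm_nonneg _).trans (hB x)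
  have h01 : ∀ y, |χ y| ≤ 1 := fun y => by
    rw [abs_of_nonneg χ.nonneg]; exact χ.le_one
  set M1 : ℝ := (d * d : ℕ) * B with hM1
  have hM1' : 0 ≤ M1 := by positivity
  have hout : ∀ (φ : E d → E d) y, ‖outer (φ y) (fderiv ℝ χ y)‖ ≤ M1 * ‖φ y‖ := by
    intro φ y
    refine (norm_outer_le _ _).trans ?_
    rw [hM1, mul_assoc]
    gcongr
    exact hB y
  refine ⟨χ, ⟨(1 + ‖symPart (d := d)‖) * M1, by positivity⟩, hχ, χ.hasCompactSupport,
    fun y hy => image_eq_zero_of_notMem_tsupport fun h => hy (hs h), fun φ hφ => ?_⟩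
  refine ⟨hχ.smul hφ, χ.hasCompactSupport.smul_right, fun y hy => ?_, fun y hy => ?_, fun y => ?_,
    fun y => ?_, fun y => ?_⟩
  · have h1 : χ y = 1 := χ.one_of_mem_closedBall (Metric.ball_subset_closedBall hy)
    have h2 : fderiv ℝ χ y = 0 := by
      have : (χ : E d → ℝ) =ᶠ[𝓝 y] fun _ => 1 := by
        filter_upwards [Metric.isOpen_ball.mem_nhds hy] with z hz
        exact χ.one_of_mem_closedBall (Metric.ball_subset_closedBall hz)
      rw [this.fderiv_eq]
      simp
    refine ⟨by simp [h1], ?_⟩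
    rw [gradField_smul_fun hχ hφ, h1, h2, one_smul]
    ext p
    simp [outer]
  · have h1 : χ y = 0 := image_eq_zero_of_notMem_tsupport fun h => hy (hs h)
    have h2 : fderiv ℝ χ y = 0 := by
      by_contra h
      exact hy (hs (support_fderiv_subset ℝ h))
    rw [gradField_smul_fun hχ hφ, h1, h2, zero_smul]
    ext p
    simp [outer]
  · rw [norm_smul]
    exact mul_le_of_le_one_left (norm_nonneg _) (h01 y)
  · rw [gradField_smul_fun hχ hφ]
    refine (norm_add_le _ _).trans (add_le_add ?_ ?_)
    · rw [norm_smul]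
      exact mul_le_of_le_one_left (norm_nonneg _) (h01 y)
    · refine (hout φ y).trans ?_
      change _ ≤ (1 + ‖symPart (d := d)‖) * M1 * ‖φ y‖
      gcongr
      nlinarith [norm_nonneg (symPart (d := d))]
  · rw [gradField_smul_fun hχ hφ, map_add, map_smul]
    refine (norm_add_le _ _).trans (add_le_add ?_ ?_)
    · rw [norm_smul]
      exact mul_le_of_le_one_left (norm_nonneg _) (h01 y)
    · refine ((symPart (d := d)).le_opNorm _).trans ?_
      change _ ≤ (1 + ‖symPart (d := d)‖) * M1 * ‖φ y‖
      calc _ ≤ ‖symPart (d := d)‖ * (M1 * ‖φ y‖) := by gcongr; exact hout φ y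
        _ ≤ _ := by nlinarith [mul_nonneg hM1' (norm_nonneg (φ y))]

/-- A function supported in the ball of a chart has the same norm on `Ω` and on `U`. -/
theorem IsConeChart.eLpNorm_eq {F : Type*} [NormedAddCommGroup F] {Ω U : Set (E d)} {x e : E d}
    {r ρ : ℝ} (h : IsConeChart Ω x r U e ρ) (hΩ : MeasurableSet Ω) {f : E d → F}
    (hf : ∀ y, y ∉ Metric.ball x r → f y = 0) :
    eLpNorm f 2 (volume.restrict U) = eLpNorm f 2 (volume.restrict Ω) := by
  rw [← eLpNorm_indicator_eq_eLpNorm_restrict h.measurableSet,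
    ← eLpNorm_indicator_eq_eLpNorm_restrict hΩ]
  congr 1
  ext y
  by_cases hy : y ∈ Metric.ball x r
  · by_cases hyU : y ∈ U
    · rw [indicator_of_mem hyU, indicator_of_mem ((h.mem_iff y hy).2 hyU)]
    · rw [indicator_of_notMem hyU, indicator_of_notMem fun h' => hyU ((h.mem_iff y hy).1 h')]
  · simp [indicator, hf y hy]

theorem eLpNorm_le_add_of_norm_le {α F G H : Type*} [MeasurableSpace α] {m : Measure α}
    [NormedAddCommGroup F] [NormedAddCommGroup G] [NormedAddCommGroup H] {f : α → F} {g : α → G}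
    {h : α → H} {M : NNReal} (hg : AEStronglyMeasurable g m) (hh : AEStronglyMeasurable h m)
    (hf : ∀ y, ‖f y‖ ≤ ‖g y‖ + M * ‖h y‖) :
    eLpNorm f 2 m ≤ eLpNorm g 2 m + M * eLpNorm h 2 m := by
  have h1 : eLpNorm f 2 m ≤ eLpNorm ((fun y => ‖g y‖) + (M : ℝ) • fun y => ‖h y‖) 2 m :=
    eLpNorm_mono fun y => by
      rw [Pi.add_apply, Pi.smul_apply, smul_eq_mul, Real.norm_of_nonneg (by positivity)]
      exact hf y
  have h2 := eLpNorm_add_le (p := 2) hg.norm (hh.norm.const_smul (M : ℝ)) (by norm_num)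
  rw [eLpNorm_const_smul, eLpNorm_norm, eLpNorm_norm] at h2
  have h3 : ‖(M : ℝ)‖ₑ = (M : ℝ≥0∞) := by
    rw [Real.enorm_of_nonneg (NNReal.coe_nonneg M), ENNReal.ofReal_coe_nnreal]
  rw [h3] at h2
  exact h1.trans h2

open Classical in
/-- The closure of a bounded Lipschitz domain is covered by finitely many half-size chart balls. -/
theorem exists_finite_coneCharts (hd : 2 ≤ d) {Ω : Set (E d)} (hΩ : IsOpen Ω)
    (hb : Bornology.IsBounded Ω) (hL : HasLipschitzBoundary Ω) :
    ∃ (t : Finset (E d)) (r : E d → ℝ), closure Ω ⊆ ⋃ x ∈ t, Metric.ball x (r x / 2) ∧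
      ∀ x ∈ t, ∃ U e ρ, IsConeChart Ω x (r x) U e ρ := by
  have hc : IsCompact (closure Ω) := hb.isCompact_closure
  have := fun x : closure Ω => exists_coneChart hd hΩ hL x.1 x.2
  choose r U e ρ h using this
  let r' : E d → ℝ := fun x => if hx : x ∈ closure Ω then r ⟨x, hx⟩ else 1
  have hr' : ∀ x (hx : x ∈ closure Ω), r' x = r ⟨x, hx⟩ := fun x hx => dif_pos hx
  obtain ⟨t, ht, hcov⟩ := hc.elim_nhds_subcover (fun x => Metric.ball x (r' x / 2)) fun x hx =>
    Metric.ball_mem_nhds x (by rw [hr' x hx]; exact half_pos (h ⟨x, hx⟩).r_pos)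
  refine ⟨t, r', hcov, fun x hx => ?_⟩
  rw [hr' x (ht x hx)]
  exact ⟨_, _, _, h ⟨x, ht x hx⟩⟩

/-- The cut-off to the ball of a chart turns a field into one to which Korn's inequality on the
cone-stable set applies; the derivative of the cut-off produces the term of order zero. -/
theorem korn_second_local {Ω U : Set (E d)} (hΩ : IsOpen Ω) {x e : E d} {r ρ : ℝ}
    (h : IsConeChart Ω x r U e ρ) :
    ∃ C : NNReal, ∀ φ : E d → E d, ContDiff ℝ ∞ φ →
      eLpNorm (gradField φ) 2 (volume.restrict (Ω ∩ Metric.ball x (r / 2)))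
        ≤ C * (eLpNorm (fun y => symPart (gradField φ y)) 2 (volume.restrict Ω)
          + eLpNorm φ 2 (volume.restrict Ω)) := by
  obtain ⟨K, hK⟩ := korn_coneStable h.measurableSet h.ρ_pos h.ρ_lt h.stable
  obtain ⟨χ, M, hχ, -, hχ0, hcut⟩ := exists_cutoff x h.r_pos
  refine ⟨K * (1 + M), fun φ hφ => ?_⟩
  obtain ⟨c1, c2, c3, c4, c5, c6, c7⟩ := hcut φ hφ
  have hb : MeasurableSet (Ω ∩ Metric.ball x (r / 2)) :=
    hΩ.measurableSet.inter Metric.isOpen_ball.measurableSet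
  calc eLpNorm (gradField φ) 2 (volume.restrict (Ω ∩ Metric.ball x (r / 2)))
      = eLpNorm (gradField fun y => χ y • φ y) 2
          (volume.restrict (Ω ∩ Metric.ball x (r / 2))) :=
        eLpNorm_congr_ae ((ae_restrict_iff' hb).2 (ae_of_all _ fun y hy => ((c3 y hy.2).2).symm))
    _ ≤ eLpNorm (gradField fun y => χ y • φ y) 2 (volume.restrict Ω) :=
        eLpNorm_mono_measure _ (Measure.restrict_mono_set _ inter_subset_left)
    _ = eLpNorm (gradField fun y => χ y • φ y) 2 (volume.restrict U) :=
        (h.eLpNorm_eq hΩ.measurableSet c4).symm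
    _ ≤ K * eLpNorm (fun y => symPart (gradField (fun y => χ y • φ y) y)) 2
          (volume.restrict U) := hK _ c1 c2
    _ = K * eLpNorm (fun y => symPart (gradField (fun y => χ y • φ y) y)) 2
          (volume.restrict Ω) := by
        rw [h.eLpNorm_eq hΩ.measurableSet fun y hy => by rw [c4 y hy, map_zero]]
    _ ≤ K * (eLpNorm (fun y => symPart (gradField φ y)) 2 (volume.restrict Ω)
          + M * eLpNorm φ 2 (volume.restrict Ω)) := by
        gcongr
        exact eLpNorm_le_add_of_norm_le (symPart.continuous.comp
          (continuous_gradField hφ)).aestronglyMeasurable hφ.continuous.aestronglyMeasurable c7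
    _ ≤ _ := by
        push_cast
        rw [mul_assoc]
        gcongr
        rw [mul_add]
        gcongr
        · exact le_mul_of_one_le_left zero_le (by simp)
        · simp

/-- **Korn's second inequality** on a bounded Lipschitz domain. -/
theorem korn_second (hd : 2 ≤ d) {Ω : Set (E d)} (hΩ : IsOpen Ω)
    (hb : Bornology.IsBounded Ω) (hL : HasLipschitzBoundary Ω) :
    ∃ C : NNReal, ∀ φ : E d → E d, ContDiff ℝ ∞ φ →
      eLpNorm (gradField φ) 2 (volume.restrict Ω)
        ≤ C * (eLpNorm (fun y => symPart (gradField φ y)) 2 (volume.restrict Ω)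
          + eLpNorm φ 2 (volume.restrict Ω)) := by
  obtain ⟨t, r, hcov, hch⟩ := exists_finite_coneCharts hd hΩ hb hL
  have : ∀ x : t, ∃ C : NNReal, ∀ φ : E d → E d, ContDiff ℝ ∞ φ →
      eLpNorm (gradField φ) 2 (volume.restrict (Ω ∩ Metric.ball x.1 (r x.1 / 2)))
        ≤ C * (eLpNorm (fun y => symPart (gradField φ y)) 2 (volume.restrict Ω)
          + eLpNorm φ 2 (volume.restrict Ω)) := fun x => by
    obtain ⟨U, e, ρ, h⟩ := hch x.1 x.2
    exact korn_second_local hΩ h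
  choose C hC using this
  refine ⟨∑ x, C x, fun φ hφ => ?_⟩
  have hcov' : Ω ⊆ ⋃ x ∈ (Finset.univ : Finset t), Metric.ball x.1 (r x.1 / 2) := fun y hy => by
    obtain ⟨x, hx, hyx⟩ := mem_iUnion₂.1 (hcov (subset_closure hy))
    exact mem_iUnion₂.2 ⟨⟨x, hx⟩, Finset.mem_univ _, hyx⟩
  refine (eLpNorm_restrict_le_sum volume _ _ _ hcov').trans ?_
  rw [ENNReal.ofNNReal_finsetSum, Finset.sum_mul]
  exact Finset.sum_le_sum fun x _ => hC x φ hφ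

end Charts

/-! ### Compactness: an Ehrling-type inequality -/

section Ehrling

variable {d : ℕ}

theorem sq_lintegral_mul_le {α : Type*} [MeasurableSpace α] {m : Measure α} {f g : α → ℝ≥0∞}
    (hf : AEMeasurable f m) (hg : AEMeasurable g m) :
    (∫⁻ x, f x * g x ∂m) ^ 2 ≤ (∫⁻ x, f x ^ 2 ∂m) * ∫⁻ x, g x ^ 2 ∂m := by
  have h := ENNReal.lintegral_mul_le_Lp_mul_Lq m (p := 2) (q := 2)
    (by constructor <;> norm_num) hf hg
  simp only [Pi.mul_apply, ENNReal.rpow_ofNat, one_div] at h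
  have h2 := pow_le_pow_left₀ zero_le h 2
  rw [mul_pow] at h2
  have : ∀ a : ℝ≥0∞, (a ^ (2 : ℝ)⁻¹) ^ 2 = a := by
    intro a
    rw [← ENNReal.rpow_natCast, ← ENNReal.rpow_mul]
    norm_num
  rwa [this, this] at h2

theorem norm_fderiv_apply_le (v : E d → E d) (z y : E d) :
    ‖fderiv ℝ v z y‖ ≤ (d * d : ℕ) * ‖gradField v z‖ * ‖y‖ := by
  have h1 : ∀ k, ‖fderiv ℝ v z (basisVec k)‖ ≤ d * ‖gradField v z‖ := by
    intro k
    have h2 : ‖fderiv ℝ v z (basisVec k)‖ ≤ ∑ i, ‖fderiv ℝ v z (basisVec k) i‖ := by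
      conv_lhs => rw [sum_smul_basisVec (fderiv ℝ v z (basisVec k))]
      refine (norm_sum_le _ _).trans (Finset.sum_le_sum fun i _ => ?_)
      simp [basisVec, norm_smul]
    refine h2.trans ((Finset.sum_le_card_nsmul _ _ ‖gradField v z‖ fun i _ => ?_).trans
      (le_of_eq (by simp)))
    exact PiLp.norm_apply_le (gradField v z) (i, k)
  conv_lhs => rw [sum_smul_basisVec y, map_sum]
  refine (norm_sum_le _ _).trans ?_
  refine (Finset.sum_le_card_nsmul _ _ (‖y‖ * (d * ‖gradField v z‖)) fun k _ => ?_).trans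
    (le_of_eq (by simp; ring))
  rw [map_smul, norm_smul]
  gcongr
  · exact PiLp.norm_apply_le y k
  · exact h1 k

/-- Translations in the directions of the cone are Lipschitz from `H¹(U)` to `L²(U)`. -/
theorem lintegral_translate_sub_le {U : Set (E d)} (hUm : MeasurableSet U) {e : E d} {ρ : ℝ}
    (hU : IsConeStable U e ρ) {v : E d → E d} (hv : ContDiff ℝ ∞ v) {y : E d}
    (hy : y ∈ Metric.ball e ρ) {t : ℝ} (ht : 0 < t) :
    ∫⁻ x in U, ‖v (x + t • y) - v x‖ₑ ^ 2 ≤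
      ENNReal.ofReal (t * ((d * d : ℕ) * ‖y‖)) ^ 2 *
        ∫⁻ x in U, ‖gradField v x‖ₑ ^ 2 := by
  have hdv := hv.continuous_fderiv (by simp)
  have hgv := continuous_gradField hv
  have h1 : ∀ x, ‖v (x + t • y) - v x‖ₑ ^ 2 ≤ ENNReal.ofReal t *
      ∫⁻ s in Ioc 0 t, ENNReal.ofReal ((d * d : ℕ) * ‖y‖) ^ 2 * ‖gradField v (x + s • y)‖ₑ ^ 2 := by
    intro x
    have hder : ∀ s : ℝ, HasDerivAt (fun s : ℝ => v (x + s • y)) (fderiv ℝ v (x + s • y) y) s := by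
      intro s
      have h1 : HasDerivAt (fun s : ℝ => x + s • y) y s := by
        simpa using ((hasDerivAt_id s).smul_const y).const_add x
      exact ((hv.differentiable (by simp)) (x + s • y)).hasFDerivAt.comp_hasDerivAt s h1
    have hc : Continuous fun s : ℝ => fderiv ℝ v (x + s • y) y := by fun_prop
    have ftc := intervalIntegral.integral_eq_sub_of_hasDerivAt (fun s _ => hder s)
      (hc.intervalIntegrable 0 t)
    rw [zero_smul, add_zero, intervalIntegral.integral_of_le ht.le] at ftc
    rw [← ftc]
    have h2 : ‖∫ s in Ioc 0 t, fderiv ℝ v (x + s • y) y‖ₑ ≤ ∫⁻ s in Ioc 0 t,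
        1 * (ENNReal.ofReal ((d * d : ℕ) * ‖y‖) * ‖gradField v (x + s • y)‖ₑ) := by
      refine (enorm_integral_le_lintegral_enorm _).trans (lintegral_mono fun s => ?_)
      rw [one_mul, ← ofReal_norm, ← ofReal_norm, ← ENNReal.ofReal_mul (by positivity)]
      apply ENNReal.ofReal_le_ofReal
      refine (norm_fderiv_apply_le v _ y).trans (le_of_eq (by ring))
    have h3 : Measurable fun s : ℝ =>
        ENNReal.ofReal ((d * d : ℕ) * ‖y‖) * ‖gradField v (x + s • y)‖ₑ :=
      (by fun_prop : Continuous fun s : ℝ => ‖gradField v (x + s • y)‖ₑ).measurable.const_mul _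
    refine (pow_le_pow_left₀ zero_le h2 2).trans ((sq_lintegral_mul_le (by fun_prop)
      h3.aemeasurable).trans (le_of_eq ?_))
    simp [mul_pow]
  calc ∫⁻ x in U, ‖v (x + t • y) - v x‖ₑ ^ 2
      ≤ ∫⁻ x in U, ENNReal.ofReal t *
      ∫⁻ s in Ioc 0 t, ENNReal.ofReal ((d * d : ℕ) * ‖y‖) ^ 2 * ‖gradField v (x + s • y)‖ₑ ^ 2 :=
        lintegral_mono h1
    _ = ENNReal.ofReal t * ∫⁻ s in Ioc 0 t, ENNReal.ofReal ((d * d : ℕ) * ‖y‖) ^ 2 *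
          ∫⁻ x in U, ‖gradField v (x + s • y)‖ₑ ^ 2 := by
        rw [lintegral_const_mul' _ _ (by simp), lintegral_lintegral_swap]
        · congr 1
          refine lintegral_congr fun s => ?_
          rw [lintegral_const_mul' _ _ (by finiteness)]
        · refine Continuous.aemeasurable ?_
          simp only [Function.uncurry_def]
          refine ENNReal.continuous_const_mul (by finiteness) |>.comp ?_
          fun_prop
    _ ≤ ENNReal.ofReal t * ∫⁻ s in Ioc 0 t, ENNReal.ofReal ((d * d : ℕ) * ‖y‖) ^ 2 *
          ∫⁻ x in U, ‖gradField v x‖ₑ ^ 2 := by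
        refine mul_le_mul' le_rfl (setLIntegral_mono' measurableSet_Ioc fun s hs => ?_)
        refine mul_le_mul' le_rfl ?_
        rw [← lintegral_indicator hUm, ← lintegral_indicator hUm]
        calc _ ≤ ∫⁻ x, U.indicator (fun x => ‖gradField v x‖ₑ ^ 2) (x + s • y) := by
              refine lintegral_mono fun x => ?_
              by_cases hx : x ∈ U
              · rw [indicator_of_mem hx, indicator_of_mem (hU x hx y hy s hs.1)]
              · simp [hx]
          _ = _ := lintegral_add_right_eq_self _ _
    _ = _ := by
        rw [setLIntegral_const, Real.volume_Ioc, sub_zero, ENNReal.ofReal_mul ht.le, mul_pow]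
        ring

/-- The kernel of the average over translations by the dilated bump function. -/
noncomputable def dilKernel (η : E d → ℝ) (t : ℝ) (x z : E d) : ℝ :=
  (t ^ d)⁻¹ * η (t⁻¹ • (z - x))

/-- On `U` the average over the cone is an integral operator over `U` with the dilated kernel. -/
theorem integral_average_eq {U : Set (E d)} (hUm : MeasurableSet U) {e : E d} {ρ : ℝ}
    (hU : IsConeStable U e ρ) {η : E d → ℝ} (hηs : tsupport η ⊆ Metric.ball e ρ)
    (v : E d → E d) {x : E d} (hx : x ∈ U) {t : ℝ} (ht : 0 < t) :
    ∫ y, η y • v (x + t • y) = ∫ z in U, dilKernel η t x z • v z := by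
  set h : E d → E d := fun z => η (t⁻¹ • (z - x)) • U.indicator v z with hh
  have h1 : ∀ y, η y • v (x + t • y) = h (x + t • y) := by
    intro y
    simp only [hh, add_sub_cancel_left, smul_smul, inv_mul_cancel₀ ht.ne', one_smul]
    by_cases hy : y ∈ tsupport η
    · rw [indicator_of_mem (hU x hx y (hηs hy) t ht)]
    · simp [image_eq_zero_of_notMem_tsupport hy]
  simp_rw [h1]
  rw [Measure.integral_comp_smul volume (fun w => h (x + w)) t, integral_add_left_eq_self h x,
    finrank_euclideanSpace, Fintype.card_fin, ← integral_smul, ← integral_indicator hUm]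
  congr 1
  ext1 z
  by_cases hz : z ∈ U
  · simp only [hh, indicator_of_mem hz, dilKernel, smul_smul]
    rw [abs_of_pos (by positivity)]
  · simp [hh, hz]

theorem exists_lipschitz_dilKernel {η : E d → ℝ} (hη : ContDiff ℝ ∞ η)
    (hηc : HasCompactSupport η) {t : ℝ} (ht : 0 < t) :
    ∃ L : NNReal, ∀ x x' z, ‖dilKernel η t x z - dilKernel η t x' z‖ ≤ L * ‖x - x'‖ := by
  obtain ⟨L, hL⟩ := (hη.of_le (m := 1) (by simp)).lipschitzWith_of_hasCompactSupport hηc one_ne_zero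
  refine ⟨⟨(t ^ d)⁻¹ * (L * t⁻¹), by positivity⟩, fun x x' z => ?_⟩
  have := hL.dist_le_mul (t⁻¹ • (z - x)) (t⁻¹ • (z - x'))
  rw [dist_eq_norm, dist_eq_norm, ← smul_sub, norm_smul, sub_sub_sub_cancel_left, norm_inv,
    Real.norm_eq_abs t, abs_of_pos ht, norm_sub_rev] at this
  rw [dilKernel, dilKernel, ← mul_sub, norm_mul, Real.norm_eq_abs ((t ^ d)⁻¹),
    abs_of_pos (by positivity)]
  change _ ≤ (t ^ d)⁻¹ * (L * t⁻¹) * ‖x - x'‖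
  rw [mul_assoc, mul_assoc, norm_sub_rev x x', norm_sub_rev]
  gcongr

/-- The error of averaging over translations at scale `t` is of order `t` in `H¹(U)`. -/
theorem exists_eLpNorm_sub_average_le {U : Set (E d)} (hUm : MeasurableSet U) {e : E d} {ρ : ℝ}
    (hU : IsConeStable U e ρ) {η : E d → ℝ} (hη : ContDiff ℝ ∞ η)
    (hηc : HasCompactSupport η) (hηs : tsupport η ⊆ Metric.ball e ρ) (hη1 : ∫ y, η y = 1) :
    ∃ C : NNReal, ∀ t : NNReal, 0 < t → ∀ v : E d → E d, ContDiff ℝ ∞ v →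
      eLpNorm (fun x => v x - ∫ y, η y • v (x + (t : ℝ) • y)) 2 (volume.restrict U)
        ≤ C * t * eLpNorm (gradField v) 2 (volume.restrict U) := by
  have hηi : Integrable η := hη.continuous.integrable_of_hasCompactSupport hηc
  have hη2 : MemLp η 2 := hη.continuous.memLp_of_hasCompactSupport hηc
  set I : ℝ≥0∞ := ∫⁻ y, ‖η y‖ₑ ^ 2 with hI
  have hIfin : I ≠ ⊤ := by
    rw [hI, ← sq_eLpNorm_two]
    exact ENNReal.pow_ne_top hη2.eLpNorm_ne_top
  set V : ℝ≥0∞ := volume (Metric.ball e ρ) with hV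
  have hVfin : V ≠ ⊤ := Metric.isBounded_ball.measure_lt_top.ne
  set R : ℝ := (d * d : ℕ) * (‖e‖ + |ρ|) with hR
  have hR0 : 0 ≤ R := by positivity
  obtain ⟨C, hC⟩ : ∃ C : NNReal, I * V * ENNReal.ofReal R ^ 2 ≤ (C : ℝ≥0∞) ^ 2 := by
    have hfin : I * V * ENNReal.ofReal R ^ 2 ≠ ⊤ := by finiteness
    refine ⟨(I * V * ENNReal.ofReal R ^ 2).toNNReal + 1, ?_⟩
    rw [ENNReal.coe_add, ENNReal.coe_toNNReal hfin, ENNReal.coe_one]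
    calc I * V * ENNReal.ofReal R ^ 2 ≤ I * V * ENNReal.ofReal R ^ 2 + 1 := le_self_add
      _ ≤ _ := le_self_pow₀ (by simp) (by norm_num)
  refine ⟨C, fun t ht v hv => ?_⟩
  have ht' : (0 : ℝ) < t := ht
  have hvc := hv.continuous
  have hηcont := hη.continuous
  rw [← ENNReal.pow_le_pow_left_iff two_ne_zero, mul_pow, mul_pow, sq_eLpNorm_two, sq_eLpNorm_two]
  have h1 : ∀ x, ‖v x - ∫ y, η y • v (x + (t : ℝ) • y)‖ₑ ^ 2
      ≤ I * ∫⁻ y in Metric.ball e ρ, ‖v (x + (t : ℝ) • y) - v x‖ₑ ^ 2 := by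
    intro x
    have e1 : v x - ∫ y, η y • v (x + (t : ℝ) • y)
        = ∫ y in Metric.ball e ρ, η y • (v x - v (x + (t : ℝ) • y)) := by
      have e2 : v x = ∫ y, η y • v x := by rw [integral_smul_const, hη1, one_smul]
      have i1 : Integrable fun y => η y • v (x + (t : ℝ) • y) :=
        (by fun_prop : Continuous fun y => η y • v (x + (t : ℝ) • y)).integrable_of_hasCompactSupport
          hηc.smul_right
      rw [setIntegral_eq_integral_of_forall_compl_eq_zero fun y hy => by
        rw [image_eq_zero_of_notMem_tsupport fun h => hy (hηs h), zero_smul]]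
      conv_lhs => rw [e2]
      rw [← integral_sub (hηi.smul_const _) i1]
      simp_rw [smul_sub]
    rw [e1]
    have h2 : ‖∫ y in Metric.ball e ρ, η y • (v x - v (x + (t : ℝ) • y))‖ₑ
        ≤ ∫⁻ y in Metric.ball e ρ, ‖η y‖ₑ * ‖v (x + (t : ℝ) • y) - v x‖ₑ := by
      refine (enorm_integral_le_lintegral_enorm _).trans (le_of_eq ?_)
      refine lintegral_congr fun y => ?_
      rw [enorm_smul, ← enorm_neg (v x - _), neg_sub]
    refine (pow_le_pow_left₀ zero_le h2 2).trans ((sq_lintegral_mul_le (by fun_prop)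
      (Continuous.aemeasurable (by fun_prop))).trans ?_)
    gcongr
    exact setLIntegral_le_lintegral _ _
  calc ∫⁻ x in U, ‖v x - ∫ y, η y • v (x + (t : ℝ) • y)‖ₑ ^ 2
      ≤ ∫⁻ x in U, I * ∫⁻ y in Metric.ball e ρ, ‖v (x + (t : ℝ) • y) - v x‖ₑ ^ 2 :=
        lintegral_mono h1
    _ = I * ∫⁻ y in Metric.ball e ρ, ∫⁻ x in U, ‖v (x + (t : ℝ) • y) - v x‖ₑ ^ 2 := by
        rw [lintegral_const_mul' _ _ hIfin, lintegral_lintegral_swap]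
        refine Continuous.aemeasurable ?_
        simp only [Function.uncurry_def]
        fun_prop
    _ ≤ I * ∫⁻ y in Metric.ball e ρ, (ENNReal.ofReal (t * R) ^ 2 *
          ∫⁻ x in U, ‖gradField v x‖ₑ ^ 2) := by
        refine mul_le_mul' le_rfl (setLIntegral_mono' Metric.isOpen_ball.measurableSet
          fun y hy => ?_)
        refine (lintegral_translate_sub_le hUm hU hv hy ht').trans ?_
        gcongr
        rw [hR]
        gcongr
        have h3 : ‖y - e‖ < ρ := by rwa [Metric.mem_ball, dist_eq_norm] at hy
        have h4 := norm_add_le (y - e) e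
        rw [sub_add_cancel] at h4
        have := le_abs_self ρ
        linarith
    _ = (I * V * ENNReal.ofReal R ^ 2) * t ^ 2 * ∫⁻ x in U, ‖gradField v x‖ₑ ^ 2 := by
        rw [setLIntegral_const, ENNReal.ofReal_mul ht'.le, ENNReal.ofReal_coe_nnreal]
        ring
    _ ≤ _ := by gcongr

theorem continuous_dilKernel {η : E d → ℝ} (hη : Continuous η) (t : ℝ) (x : E d) :
    Continuous (dilKernel η t x) := by
  unfold dilKernel
  fun_prop

/-- The averages depend on the base point in a Lipschitz way, so that on a bounded set they are
determined by finitely many of them, up to a small error. -/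
theorem eLpNorm_dilKernel_average_le {U B : Set (E d)} (hUm : MeasurableSet U)
    (hBm : MeasurableSet B) {η : E d → ℝ} (hη : Continuous η) {t : ℝ} {L : NNReal}
    (hL : ∀ x x' z, ‖dilKernel η t x z - dilKernel η t x' z‖ ≤ L * ‖x - x'‖) {s : Finset (E d)}
    {δ : NNReal} (hs : B ⊆ ⋃ x ∈ s, Metric.ball x δ) {v : E d → E d} (hv : Continuous v)
    (hvc : HasCompactSupport v) (hvB : ∀ y, y ∉ B → v y = 0) :
    eLpNorm (fun x => ∫ z in U, dilKernel η t x z • v z) 2 (volume.restrict (U ∩ B))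
      ≤ (volume B) ^ (2 : ℝ)⁻¹ * (∑ x ∈ s, ‖∫ z in U, dilKernel η t x z • v z‖ₑ
        + L * δ * ((volume B) ^ (2 : ℝ)⁻¹ * eLpNorm v 2 (volume.restrict U))) := by
  have hi : ∀ x, Integrable (fun z => dilKernel η t x z • v z) (volume.restrict U) := fun x =>
    (((continuous_dilKernel hη t x).smul hv).integrable_of_hasCompactSupport
      hvc.smul_left).restrict
  have hv1 : ∫⁻ z in U, ‖v z‖ₑ ≤ (volume B) ^ (2 : ℝ)⁻¹ * eLpNorm v 2 (volume.restrict U) := by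
    have e1 : ∫⁻ z in U, ‖v z‖ₑ = ∫⁻ z in U, ‖B.indicator (fun _ => (1 : ℝ)) z‖ₑ * ‖v z‖ₑ := by
      refine lintegral_congr fun z => ?_
      by_cases hz : z ∈ B
      · simp [hz]
      · simp [hvB z hz]
    rw [e1]
    refine (lintegral_enorm_mul_le (aestronglyMeasurable_const.indicator hBm)
      hv.aestronglyMeasurable).trans ?_
    gcongr
    refine (eLpNorm_mono_measure _ Measure.restrict_le_self).trans (le_of_eq ?_)
    rw [eLpNorm_indicator_const hBm (by norm_num) (by norm_num)]
    simp
  have hpt : ∀ x ∈ B, ‖∫ z in U, dilKernel η t x z • v z‖ₑ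
      ≤ ∑ x ∈ s, ‖∫ z in U, dilKernel η t x z • v z‖ₑ
        + L * δ * ((volume B) ^ (2 : ℝ)⁻¹ * eLpNorm v 2 (volume.restrict U)) := by
    intro x hx
    obtain ⟨x', hx's, hx'⟩ := mem_iUnion₂.1 (hs hx)
    have e1 : ∫ z in U, dilKernel η t x z • v z = (∫ z in U, dilKernel η t x' z • v z)
        + ∫ z in U, (dilKernel η t x z - dilKernel η t x' z) • v z := by
      simp_rw [sub_smul]
      rw [integral_sub (hi x) (hi x')]
      abel
    rw [e1]
    refine (enorm_add_le _ _).trans (add_le_add ?_ ?_)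
    · exact Finset.single_le_sum (f := fun x => ‖∫ z in U, dilKernel η t x z • v z‖ₑ)
        (fun _ _ => zero_le) hx's
    · calc _ ≤ ∫⁻ z in U, (L * δ : NNReal) * ‖v z‖ₑ := by
            refine (enorm_integral_le_lintegral_enorm _).trans (lintegral_mono fun z => ?_)
            rw [enorm_smul]
            gcongr
            rw [← ofReal_norm, ← ENNReal.ofReal_coe_nnreal]
            apply ENNReal.ofReal_le_ofReal
            refine (hL x x' z).trans ?_
            push_cast
            gcongr
            rw [← dist_eq_norm]
            exact (Metric.mem_ball.1 hx').le
        _ ≤ _ := by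
            rw [lintegral_const_mul' _ _ ENNReal.coe_ne_top]
            push_cast
            gcongr
  refine (eLpNorm_le_of_ae_enorm_bound (C := ∑ x ∈ s, ‖∫ z in U, dilKernel η t x z • v z‖ₑ
        + L * δ * ((volume B) ^ (2 : ℝ)⁻¹ * eLpNorm v 2 (volume.restrict U))) ?_).trans ?_
  · exact (ae_restrict_iff' (hUm.inter hBm)).2 (ae_of_all _ fun x hx => hpt x hx.2)
  · simp only [Measure.restrict_apply_univ, ENNReal.toReal_ofNat, smul_eq_mul]
    rw [mul_comm (_ + _)]
    exact mul_le_mul' (ENNReal.rpow_le_rpow (measure_mono inter_subset_right) (by norm_num)) le_rfl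

/-- Ehrling's inequality near one point: a field differs little from its averages at a small scale, and
these are controlled by finitely many of them. -/
theorem ehrling_local {Ω U : Set (E d)} (hΩ : IsOpen Ω) {x e : E d} {r ρ : ℝ}
    (h : IsConeChart Ω x r U e ρ) {ε : NNReal} (hε : 0 < ε) :
    ∃ (s : Finset (E d)) (w : E d → E d → ℝ) (C : NNReal),
      (∀ z, Continuous (w z) ∧ HasCompactSupport (w z)) ∧
      ∀ φ : E d → E d, ContDiff ℝ ∞ φ →
        eLpNorm φ 2 (volume.restrict (Ω ∩ Metric.ball x (r / 2)))
          ≤ ε * (eLpNorm (gradField φ) 2 (volume.restrict Ω) + eLpNorm φ 2 (volume.restrict Ω))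
            + C * ∑ z ∈ s, ‖∫ y in Ω, w z y • φ y‖ₑ := by
  let β : ContDiffBump e := ⟨ρ / 3, ρ / 2, by linarith [h.ρ_pos], by linarith [h.ρ_pos]⟩
  set η : E d → ℝ := β.normed volume with hηdef
  have hη : ContDiff ℝ ∞ η := β.contDiff_normed
  have hηc : HasCompactSupport η := β.hasCompactSupport_normed
  have hηs : tsupport η ⊆ Metric.ball e ρ := by
    rw [hηdef, β.tsupport_normed_eq]
    exact Metric.closedBall_subset_ball (by change ρ / 2 < ρ; linarith [h.ρ_pos])
  have hη1 : ∫ y, η y = 1 := β.integral_normed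
  obtain ⟨K, hK⟩ := exists_eLpNorm_sub_average_le h.measurableSet h.stable hη hηc hηs hη1
  obtain ⟨χ, M, hχ, hχc, hχ0, hcut⟩ := exists_cutoff x h.r_pos
  set B := Metric.ball x r with hB
  have hBfin : volume B ≠ ⊤ := Metric.isBounded_ball.measure_lt_top.ne
  set V : NNReal := ((volume B) ^ (2 : ℝ)⁻¹).toNNReal with hV
  have hVe : (volume B) ^ (2 : ℝ)⁻¹ = V :=
    (ENNReal.coe_toNNReal (by finiteness)).symm
  -- half of the budget `ε` goes to the averaging error, half to the discretization error
  set t : NNReal := ε / 2 / ((K + 1) * (M + 1)) with ht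
  have htpos : 0 < t := by positivity
  obtain ⟨L, hL⟩ := exists_lipschitz_dilKernel hη hηc (t := t) htpos
  set δ : NNReal := ε / 2 / ((L + 1) * (V + 1) ^ 2) with hδ
  have hδpos : 0 < δ := by positivity
  obtain ⟨s, -, hs⟩ := (Metric.isBounded_ball (x := x) (r := r)).isCompact_closure.elim_nhds_subcover
    (fun z => Metric.ball z δ) fun z _ => Metric.ball_mem_nhds z hδpos
  refine ⟨s, fun z y => dilKernel η t z y * χ y, V, fun z => ?_, fun φ hφ => ?_⟩
  · exact ⟨(continuous_dilKernel hη.continuous t z).mul hχ.continuous, hχc.mul_left⟩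
  obtain ⟨c1, c2, c3, c4, c5, c6, c7⟩ := hcut φ hφ
  set v : E d → E d := fun y => χ y • φ y with hv
  have hv0 : ∀ y, y ∉ B → v y = 0 := fun y hy => by simp [hv, hχ0 y hy]
  have hΩm := hΩ.measurableSet
  have hBm : MeasurableSet B := Metric.isOpen_ball.measurableSet
  have n1 : eLpNorm v 2 (volume.restrict U) ≤ eLpNorm φ 2 (volume.restrict Ω) := by
    rw [h.eLpNorm_eq hΩm hv0]
    exact eLpNorm_mono c5
  have n2 : eLpNorm (gradField v) 2 (volume.restrict U)
      ≤ eLpNorm (gradField φ) 2 (volume.restrict Ω) + M * eLpNorm φ 2 (volume.restrict Ω) := by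
    rw [h.eLpNorm_eq hΩm c4]
    exact eLpNorm_le_add_of_norm_le (continuous_gradField hφ).aestronglyMeasurable
      hφ.continuous.aestronglyMeasurable c6
  have n3 : ∀ z, ∫ y in U, dilKernel η t z y • v y
      = ∫ y in Ω, (dilKernel η t z y * χ y) • φ y := by
    intro z
    rw [← integral_indicator h.measurableSet, ← integral_indicator hΩm]
    congr 1
    ext1 y
    by_cases hy : y ∈ B
    · by_cases hyU : y ∈ U
      · rw [indicator_of_mem hyU, indicator_of_mem ((h.mem_iff y hy).2 hyU), mul_smul]
      · rw [indicator_of_notMem hyU, indicator_of_notMem fun h' => hyU ((h.mem_iff y hy).1 h')]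
    · simp [indicator, hv0 y hy, hχ0 y hy]
  have hsm : MeasurableSet (Ω ∩ Metric.ball x (r / 2)) :=
    hΩm.inter Metric.isOpen_ball.measurableSet
  have hav : ∀ x ∈ U ∩ B, v x = (v x - ∫ y, η y • v (x + (t : ℝ) • y))
      + ∫ z in U, dilKernel η t x z • v z := by
    intro x hx
    have := integral_average_eq h.measurableSet h.stable hηs v hx.1 (t := (t : ℝ))
      (NNReal.coe_pos.2 htpos)
    rw [this]
    abel
  have hAcont : Continuous fun x => ∫ y, η y • v (x + (t : ℝ) • y) := by
    have hvc := c1.continuous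
    obtain ⟨b, hb⟩ := c2.exists_bound_of_continuous hvc
    refine continuous_of_dominated (bound := fun y => ‖η y‖ * b) (fun x => ?_) (fun x => ?_) ?_ ?_
    · have := hη.continuous
      exact (by fun_prop : Continuous fun y => η y • v (x + (t : ℝ) • y)).aestronglyMeasurable
    · refine ae_of_all _ fun y => ?_
      rw [norm_smul]
      gcongr
      exact hb _
    · exact (hη.continuous.integrable_of_hasCompactSupport hηc).norm.mul_const b
    · exact ae_of_all _ fun y => by fun_prop
  have hIm : AEStronglyMeasurable (fun x => ∫ z in U, dilKernel η t x z • v z)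
      (volume.restrict (U ∩ B)) := by
    refine hAcont.aestronglyMeasurable.congr ?_
    exact (ae_restrict_iff' (h.measurableSet.inter hBm)).2 (ae_of_all _ fun x hx =>
      integral_average_eq h.measurableSet h.stable hηs v hx.1 htpos)
  calc eLpNorm φ 2 (volume.restrict (Ω ∩ Metric.ball x (r / 2)))
      = eLpNorm v 2 (volume.restrict (Ω ∩ Metric.ball x (r / 2))) :=
        eLpNorm_congr_ae ((ae_restrict_iff' hsm).2 (ae_of_all _ fun y hy => ((c3 y hy.2).1).symm))
    _ ≤ eLpNorm v 2 (volume.restrict (U ∩ B)) := by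
        refine eLpNorm_mono_measure _ (Measure.restrict_mono_set _ fun y hy => ?_)
        have hyB : y ∈ B := Metric.ball_subset_ball (by linarith [h.r_pos]) hy.2
        exact ⟨(h.mem_iff y hyB).1 hy.1, hyB⟩
    _ = eLpNorm ((fun x => v x - ∫ y, η y • v (x + (t : ℝ) • y))
          + fun x => ∫ z in U, dilKernel η t x z • v z) 2 (volume.restrict (U ∩ B)) :=
        eLpNorm_congr_ae ((ae_restrict_iff' (h.measurableSet.inter hBm)).2
          (ae_of_all _ fun y hy => hav y hy))
    _ ≤ eLpNorm (fun x => v x - ∫ y, η y • v (x + (t : ℝ) • y)) 2 (volume.restrict U)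
          + eLpNorm (fun x => ∫ z in U, dilKernel η t x z • v z) 2 (volume.restrict (U ∩ B)) := by
        refine (eLpNorm_add_le (c1.continuous.sub hAcont).aestronglyMeasurable hIm
          (by norm_num)).trans ?_
        exact add_le_add (eLpNorm_mono_measure _ (Measure.restrict_mono_set _ inter_subset_left))
          le_rfl
    _ ≤ K * t * (eLpNorm (gradField φ) 2 (volume.restrict Ω)
            + M * eLpNorm φ 2 (volume.restrict Ω))
          + V * (∑ z ∈ s, ‖∫ y in Ω, (dilKernel η t z y * χ y) • φ y‖ₑ
            + L * δ * (V * eLpNorm φ 2 (volume.restrict Ω))) := by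
        refine add_le_add ((hK t htpos v c1).trans (by gcongr)) ?_
        refine (eLpNorm_dilKernel_average_le h.measurableSet hBm hη.continuous hL
          (subset_closure.trans hs) c1.continuous c2 hv0).trans ?_
        rw [hVe]
        simp_rw [n3]
        gcongr
    _ ≤ _ := by
        have a1 : K * t * 1 ≤ ε / 2 := by
          rw [ht, mul_one, mul_div_assoc', div_le_iff₀ (by positivity), mul_comm]
          refine mul_le_mul' le_rfl ?_
          calc K ≤ K + 1 := le_self_add
            _ ≤ (K + 1) * (M + 1) := le_mul_of_one_le_right zero_le (by simp)
        have a2 : K * t * M ≤ ε / 2 := by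
          rw [ht, mul_div_assoc', div_mul_eq_mul_div, div_le_iff₀ (by positivity), mul_comm K,
            mul_assoc]
          refine mul_le_mul' le_rfl (mul_le_mul' (by simp) (by simp))
        have a3 : V * (L * δ * V) ≤ ε / 2 := by
          have : V * (L * δ * V) = (ε / 2) * (L * V ^ 2) / ((L + 1) * (V + 1) ^ 2) := by
            rw [hδ]; field_simp
          rw [this, div_le_iff₀ (by positivity)]
          refine mul_le_mul' le_rfl (mul_le_mul' (by simp) (pow_le_pow_left' (by simp) 2))
        have b1 : (K : ℝ≥0∞) * t ≤ (ε / 2 : NNReal) := by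
          have := a1; rw [mul_one] at this; exact_mod_cast this
        have b2 : (K : ℝ≥0∞) * t * M ≤ (ε / 2 : NNReal) := by exact_mod_cast a2
        have b3 : (V : ℝ≥0∞) * (L * δ * V) ≤ (ε / 2 : NNReal) := by exact_mod_cast a3
        have b4 : (ε : ℝ≥0∞) = (ε / 2 : NNReal) + (ε / 2 : NNReal) := by
          rw [← ENNReal.coe_add, add_halves]
        generalize eLpNorm (gradField φ) 2 (volume.restrict Ω) = G
        generalize eLpNorm φ 2 (volume.restrict Ω) = N
        generalize ∑ z ∈ s, ‖∫ y in Ω, (dilKernel η t z y * χ y) • φ y‖ₑ = S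
        calc (K : ℝ≥0∞) * t * (G + M * N) + V * (S + L * δ * (V * N))
            = (K * t) * G + (K * t * M) * N + (V * (L * δ * V)) * N + V * S := by ring
          _ ≤ (ε / 2 : NNReal) * G + (ε / 2 : NNReal) * N + (ε / 2 : NNReal) * N + V * S := by
              gcongr
          _ ≤ ε * (G + N) + V * S := by
              rw [mul_add, b4]
              have : ((ε / 2 : NNReal) : ℝ≥0∞) * G
                  ≤ ((ε / 2 : NNReal) + (ε / 2 : NNReal)) * G := by gcongr; exact le_self_add
              rw [add_mul _ _ N, add_assoc (_ * G)]
              gcongr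

/-- **Ehrling's inequality**: up to an arbitrarily small multiple of the `H¹` norm, the `L²` norm is
controlled by finitely many bounded functionals on `L²`. -/
theorem ehrling (hd : 2 ≤ d) {Ω : Set (E d)} (hΩ : IsOpen Ω)
    (hb : Bornology.IsBounded Ω) (hL : HasLipschitzBoundary Ω) {ε : NNReal} (hε : 0 < ε) :
    ∃ (ι : Type) (_ : Fintype ι) (w : ι → E d → ℝ) (C : NNReal),
      (∀ z, Continuous (w z) ∧ HasCompactSupport (w z)) ∧
      ∀ φ : E d → E d, ContDiff ℝ ∞ φ →
        eLpNorm φ 2 (volume.restrict Ω)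
          ≤ ε * (eLpNorm (gradField φ) 2 (volume.restrict Ω) + eLpNorm φ 2 (volume.restrict Ω))
            + C * ∑ z, ‖∫ y in Ω, w z y • φ y‖ₑ := by
  obtain ⟨t, r, hcov, hch⟩ := exists_finite_coneCharts hd hΩ hb hL
  set ε' : NNReal := ε / (t.card + 1) with hε'
  have hε'pos : 0 < ε' := by positivity
  have : ∀ x : t, ∃ (s : Finset (E d)) (w : E d → E d → ℝ) (C : NNReal),
      (∀ z, Continuous (w z) ∧ HasCompactSupport (w z)) ∧
      ∀ φ : E d → E d, ContDiff ℝ ∞ φ →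
        eLpNorm φ 2 (volume.restrict (Ω ∩ Metric.ball x.1 (r x.1 / 2)))
          ≤ ε' * (eLpNorm (gradField φ) 2 (volume.restrict Ω) + eLpNorm φ 2 (volume.restrict Ω))
            + C * ∑ z ∈ s, ‖∫ y in Ω, w z y • φ y‖ₑ := fun x => by
    obtain ⟨U, e, ρ, h⟩ := hch x.1 x.2
    exact ehrling_local hΩ h hε'pos
  choose s w C hw hC using this
  refine ⟨(x : t) × s x, inferInstance, fun p => w p.1 p.2, ∑ x, C x, fun p => hw p.1 p.2,
    fun φ hφ => ?_⟩
  have hcov' : Ω ⊆ ⋃ x ∈ (Finset.univ : Finset t), Metric.ball x.1 (r x.1 / 2) := fun y hy => by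
    obtain ⟨x, hx, hyx⟩ := mem_iUnion₂.1 (hcov (subset_closure hy))
    exact mem_iUnion₂.2 ⟨⟨x, hx⟩, Finset.mem_univ _, hyx⟩
  refine (eLpNorm_restrict_le_sum volume _ _ _ hcov').trans
    ((Finset.sum_le_sum fun x _ => hC x φ hφ).trans ?_)
  rw [Finset.sum_add_distrib, Finset.sum_const]
  refine add_le_add ?_ ?_
  · rw [nsmul_eq_mul, ← mul_assoc]
    gcongr
    have : (t.card : NNReal) * ε' ≤ ε := by
      rw [hε', mul_div_assoc', div_le_iff₀ (by positivity), mul_comm]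
      exact mul_le_mul' le_rfl (by simp)
    rw [Finset.card_univ, Fintype.card_coe]
    exact_mod_cast this
  · rw [Fintype.sum_sigma, Finset.mul_sum]
    refine Finset.sum_le_sum fun x _ => ?_
    rw [← Finset.sum_coe_sort (s x)]
    gcongr
    exact Finset.single_le_sum (f := C) (fun _ _ => zero_le) (Finset.mem_univ x)

end Ehrling

/-! ### Boundary graphs and the trace inequality -/

section Trace

open Module

variable {d : ℕ}

/-- The hyperplane orthogonal to `e`. -/
noncomputable abbrev hyperplane (e : E d) : Submodule ℝ (E d) := (Submodule.span ℝ {e})ᗮ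

/-- The parametrization of the graph of `a` over the hyperplane orthogonal to `e`. -/
noncomputable def graphMap (e : E d) (a : E d → ℝ) (w : hyperplane e) : E d := w + a w • e

/-- The graph of `a` over the hyperplane orthogonal to `e`. -/
def graphSet (e : E d) (a : E d → ℝ) : Set (E d) :=
  {y | a (y - inner ℝ y e • e) = inner ℝ y e}

theorem inner_add_smul_unit {e : E d} (he : ‖e‖ = 1) (w : hyperplane e) (s : ℝ) :
    inner ℝ ((w : E d) + s • e) e = s := by
  have h := Submodule.mem_orthogonal_singleton_iff_inner_left.1 w.2
  rw [inner_add_left, h, inner_smul_left, real_inner_self_eq_norm_sq, he]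
  simp

theorem sub_inner_smul_mem {e : E d} (he : ‖e‖ = 1) (y : E d) :
    y - inner ℝ y e • e ∈ hyperplane e := by
  rw [Submodule.mem_orthogonal_singleton_iff_inner_left, inner_sub_left, inner_smul_left,
    real_inner_self_eq_norm_sq, he]
  simp

theorem graphMap_mem {e : E d} (he : ‖e‖ = 1) (a : E d → ℝ) (w : hyperplane e) :
    graphMap e a w ∈ graphSet e a := by
  simp only [graphMap, graphSet, Set.mem_ofPred_eq, inner_add_smul_unit he, add_sub_cancel_right]

theorem exists_graphMap_eq {e : E d} (he : ‖e‖ = 1) {a : E d → ℝ} {y : E d}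
    (hy : y ∈ graphSet e a) : ∃ w, graphMap e a w = y := by
  refine ⟨⟨y - inner ℝ y e • e, sub_inner_smul_mem he y⟩, ?_⟩
  have : a (y - inner ℝ y e • e) = inner ℝ y e := hy
  simp [graphMap, this]

theorem lipschitzWith_graphMap {e : E d} (he : ‖e‖ = 1) {K : NNReal} {a : E d → ℝ}
    (ha : LipschitzWith K a) : LipschitzWith (1 + K) (graphMap e a) := by
  have h1 : LipschitzWith 1 (fun w : hyperplane e => (w : E d)) := LipschitzWith.subtype_val _
  have h2 : LipschitzWith K (fun w : hyperplane e => a w • e) := by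
    refine LipschitzWith.of_dist_le_mul fun w w' => ?_
    rw [dist_eq_norm, ← sub_smul, norm_smul, he, mul_one, ← dist_eq_norm]
    exact ha.dist_le_mul w w'
  exact h1.add h2

theorem finrank_hyperplane {e : E d} (he : ‖e‖ = 1) : finrank ℝ (hyperplane e) = d - 1 := by
  have h := (Submodule.span ℝ {e}).finrank_add_finrank_orthogonal
  have he0 : e ≠ 0 := by rintro rfl; simp at he
  rw [finrank_span_singleton he0, finrank_euclideanSpace_fin] at h
  change finrank ℝ (Submodule.span ℝ {e})ᗮ = d - 1
  omega

/-- Surface measure on a Lipschitz graph is controlled by Lebesgue measure on the hyperplane. -/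
theorem restrict_graphSet_le {e : E d} (he : ‖e‖ = 1) {K : NNReal} {a : E d → ℝ}
    (ha : LipschitzWith K a) :
    (Measure.euclideanHausdorffMeasure (d - 1)).restrict (graphSet e a)
      ≤ (((1 + K) ^ (d - 1) : NNReal) : ℝ≥0∞) • Measure.map (graphMap e a) volume := by
  have hm : Measurable (graphMap e a) := (lipschitzWith_graphMap he ha).continuous.measurable
  refine Measure.le_iff.2 fun s hs => ?_
  have h1 : s ∩ graphSet e a ⊆ graphMap e a '' (graphMap e a ⁻¹' s) := by
    rintro y ⟨hy, hy'⟩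
    obtain ⟨w, rfl⟩ := exists_graphMap_eq he hy'
    exact ⟨w, hy, rfl⟩
  have h2 := (lipschitzWith_graphMap he ha).hausdorffMeasure_image_le (d := ((d - 1 : ℕ) : ℝ))
    (Nat.cast_nonneg _) (graphMap e a ⁻¹' s)
  rw [ENNReal.rpow_natCast] at h2
  have h3 : (volume : Measure (hyperplane e)) = Measure.euclideanHausdorffMeasure (d - 1) := by
    rw [← finrank_hyperplane he, InnerProductSpace.euclideanHausdorffMeasure_eq_volume]
  rw [Measure.restrict_apply hs, Measure.smul_apply, Measure.map_apply hm hs, h3]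
  refine (measure_mono h1).trans ?_
  rw [Measure.euclideanHausdorffMeasure_def, Measure.euclideanHausdorffMeasure_def,
    Measure.smul_apply, Measure.smul_apply, ENNReal.smul_def, ENNReal.smul_def, smul_eq_mul,
    smul_eq_mul, smul_eq_mul, mul_left_comm]
  gcongr
  exact_mod_cast h2

/-- Fubini's theorem for the splitting of `ℝ^d` into a hyperplane and its normal line. -/
theorem lintegral_hyperplane {e : E d} (he : ‖e‖ = 1) {f : E d → ℝ≥0∞} (hf : Measurable f) :
    ∫⁻ y, f y = ∫⁻ w : hyperplane e, ∫⁻ s : ℝ, f ((w : E d) + s • e) := by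
  have hmp := (Submodule.measurePreserving_measurableEquivProd (Submodule.span ℝ {e})
    (0 : E d))
  rw [InnerProductSpace.euclideanHausdorffMeasure_eq_volume] at hmp
  have h1 := (hmp.symm _).lintegral_comp hf
  rw [← h1, Measure.volume_eq_prod, lintegral_prod_symm]
  · refine lintegral_congr fun w => ?_
    let L := LinearIsometryEquiv.toSpanUnitSingleton (𝕜 := ℝ) e he
    have hm : Measurable fun x : Submodule.span ℝ {e} =>
        f ((Submodule.measurableEquivProd (Submodule.span ℝ {e}) (0 : E d)).symm (x, w)) :=
      hf.comp ((MeasurableEquiv.measurable _).comp measurable_prodMk_right)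
    have h2 := L.measurePreserving.lintegral_comp hm
    rw [← h2]
    refine lintegral_congr fun s => ?_
    rw [Submodule.measurableEquivProd_symm_apply]
    simp [L, add_comm]
  · exact (hf.comp (MeasurableEquiv.measurable _)).aemeasurable

/-- The value at a point is controlled by the values on the half-line above it. -/
theorem enorm_sq_le_lintegral_ray {v : E d → E d} (hv : ContDiff ℝ ∞ v)
    (hc : HasCompactSupport v) {e : E d} (he : ‖e‖ = 1) (z : E d) :
    ‖v z‖ₑ ^ 2 ≤ ∫⁻ s in Ioi (0 : ℝ),
      (‖v (z + s • e)‖ₑ ^ 2 + ‖fderiv ℝ v (z + s • e) e‖ₑ ^ 2) := by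
  have hl : ContDiff ℝ ∞ fun s : ℝ => z + s • e := by fun_prop
  have hemb : IsClosedEmbedding fun s : ℝ => z + s • e := by
    refine (Isometry.of_dist_eq fun s t => ?_).isClosedEmbedding
    rw [dist_add_left, dist_eq_norm, ← sub_smul, norm_smul, he, mul_one, dist_eq_norm]
  have hg : ContDiff ℝ 1 fun s : ℝ => ‖v (z + s • e)‖ ^ 2 :=
    ((hv.comp hl).norm_sq ℝ).of_le (by exact_mod_cast le_top)
  have hgc : HasCompactSupport fun s : ℝ => ‖v (z + s • e)‖ ^ 2 :=
    (hc.comp_isClosedEmbedding hemb).comp_left (g := fun y : E d => ‖y‖ ^ 2) (by simp)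
  have h := hgc.integral_Ioi_deriv_eq hg 0
  have hd : ∀ s : ℝ, deriv (fun s : ℝ => ‖v (z + s • e)‖ ^ 2) s
      = 2 * inner ℝ (v (z + s • e)) (fderiv ℝ v (z + s • e) e) := by
    intro s
    have h1 : HasDerivAt (fun s : ℝ => z + s • e) e s := by
      simpa using ((hasDerivAt_id s).smul_const e).const_add z
    exact (((hv.differentiable (by simp) _).hasFDerivAt.comp_hasDerivAt s h1).norm_sq).deriv
  have h2 : ‖v z‖ₑ ^ 2 = ‖∫ s in Ioi (0 : ℝ), deriv (fun s : ℝ => ‖v (z + s • e)‖ ^ 2) s‖ₑ := by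
    rw [h, enorm_neg, zero_smul, add_zero, enorm_pow, enorm_norm]
  rw [h2]
  refine (enorm_integral_le_lintegral_enorm _).trans (lintegral_mono fun s => ?_)
  rw [hd]
  simp only [← ofReal_norm]
  rw [← ENNReal.ofReal_pow (norm_nonneg _), ← ENNReal.ofReal_pow (norm_nonneg _),
    ← ENNReal.ofReal_add (by positivity) (by positivity)]
  refine ENNReal.ofReal_le_ofReal ?_
  rw [norm_mul, Real.norm_of_nonneg (by norm_num : (0 : ℝ) ≤ 2)]
  have := norm_inner_le_norm (𝕜 := ℝ) (v (z + s • e)) (fderiv ℝ v (z + s • e) e)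
  nlinarith [sq_nonneg (‖v (z + s • e)‖ - ‖fderiv ℝ v (z + s • e) e‖)]

/-- Integrating the bound along vertical rays over the hyperplane controls the boundary values on a
graph by the field and its gradient on the epigraph. -/
theorem lintegral_graphSet_le {e : E d} (he : ‖e‖ = 1) {K : NNReal} {a : E d → ℝ}
    (ha : LipschitzWith K a) {v : E d → E d} (hv : ContDiff ℝ ∞ v) (hc : HasCompactSupport v) :
    ∫⁻ y in graphSet e a, ‖v y‖ₑ ^ 2 ∂(Measure.euclideanHausdorffMeasure (d - 1))
      ≤ ((1 + K) ^ (d - 1) : NNReal) *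
        ∫⁻ y in epigraph e a, (‖v y‖ₑ ^ 2 + ‖fderiv ℝ v y e‖ₑ ^ 2) := by
  have hm : Measurable (graphMap e a) := (lipschitzWith_graphMap he ha).continuous.measurable
  have hmv : Measurable fun y => ‖v y‖ₑ ^ 2 := by
    have := hv.continuous.measurable
    fun_prop
  have hmF : Measurable fun y => ‖v y‖ₑ ^ 2 + ‖fderiv ℝ v y e‖ₑ ^ 2 := by
    have h1 := hv.continuous.measurable
    have h2 : Measurable fun y => fderiv ℝ v y e :=
      ((hv.continuous_fderiv (by simp)).clm_apply continuous_const).measurable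
    fun_prop
  have hme : MeasurableSet (epigraph e a) := (isOpen_epigraph e ha.continuous).measurableSet
  refine (lintegral_mono' (restrict_graphSet_le he ha) le_rfl).trans ?_
  rw [lintegral_smul_measure, lintegral_map hmv hm, smul_eq_mul]
  gcongr
  rw [← lintegral_indicator hme, lintegral_hyperplane he (hmF.indicator hme)]
  refine lintegral_mono fun w => ?_
  refine (enorm_sq_le_lintegral_ray hv hc he (graphMap e a w)).trans ?_
  rw [← lintegral_indicator measurableSet_Ioi, ← lintegral_add_right_eq_self (fun s : ℝ =>
    (epigraph e a).indicator (fun y => ‖v y‖ₑ ^ 2 + ‖fderiv ℝ v y e‖ₑ ^ 2) ((w : E d) + s • e))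
    (a w)]
  refine lintegral_mono fun s => ?_
  by_cases hs : s ∈ Ioi (0 : ℝ)
  · have h1 : graphMap e a w + s • e = (w : E d) + (s + a w) • e := by
      simp only [graphMap, add_smul]; abel
    have h2 : (w : E d) + (s + a w) • e ∈ epigraph e a := by
      simp only [epigraph, Set.mem_ofPred_eq, inner_add_smul_unit he, add_sub_cancel_right]
      have : 0 < s := hs
      linarith
    rw [indicator_of_mem hs, indicator_of_mem h2, h1]
  · rw [indicator_of_notMem hs]
    exact zero_le

theorem frontier_inter_ball_subset {Ω : Set (E d)} (hΩ : IsOpen Ω) {x e : E d} {r : ℝ}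
    {a : E d → ℝ} (ha : Continuous a)
    (h : ∀ y ∈ Metric.ball x r, (y ∈ Ω ↔ a (y - inner ℝ y e • e) < inner ℝ y e)) :
    frontier Ω ∩ Metric.ball x r ⊆ graphSet e a := by
  rintro y ⟨hy, hyb⟩
  rw [hΩ.frontier_eq] at hy
  refine le_antisymm ?_ (not_lt.1 fun hlt => hy.2 ((h y hyb).2 hlt))
  by_contra! hlt
  have ho : IsOpen ({y : E d | inner ℝ y e < a (y - inner ℝ y e • e)} ∩ Metric.ball x r) :=
    (isOpen_lt (by fun_prop) (by fun_prop)).inter Metric.isOpen_ball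
  obtain ⟨z, hz, hzΩ⟩ := mem_closure_iff.1 hy.1 _ ho ⟨hlt, hyb⟩
  exact lt_asymm hz.1 ((h z hz.2).1 hzΩ)

theorem graphSet_inter_ball_subset {Ω : Set (E d)} (hΩ : IsOpen Ω) {x e : E d} {r : ℝ}
    (he : ‖e‖ = 1) {a : E d → ℝ}
    (h : ∀ y ∈ Metric.ball x r, (y ∈ Ω ↔ a (y - inner ℝ y e • e) < inner ℝ y e)) :
    graphSet e a ∩ Metric.ball x r ⊆ frontier Ω := by
  rintro y ⟨hy, hyb⟩
  rw [hΩ.frontier_eq]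
  refine ⟨?_, fun hyΩ => ((h y hyb).1 hyΩ).ne hy⟩
  have hlim : Tendsto (fun s : ℝ => y + s • e) (𝓝[>] 0) (𝓝 y) := by
    have : Continuous fun s : ℝ => y + s • e := by fun_prop
    have h0 := this.tendsto 0
    simp only [zero_smul, add_zero] at h0
    exact h0.mono_left nhdsWithin_le_nhds
  refine mem_closure_of_tendsto hlim ?_
  filter_upwards [hlim (Metric.isOpen_ball.mem_nhds hyb), self_mem_nhdsWithin] with s hs hs0
  refine (h _ hs).2 ?_
  have h1 : inner ℝ (y + s • e) e = inner ℝ y e + s := by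
    rw [inner_add_left, inner_smul_left, real_inner_self_eq_norm_sq, he]; simp
  have h2 : y + s • e - inner ℝ (y + s • e) e • e = y - inner ℝ y e • e := by
    rw [h1, add_smul]; abel
  rw [h2, h1]
  have : a (y - inner ℝ y e • e) = inner ℝ y e := hy
  have : 0 < s := hs0
  linarith

theorem trace_local {Ω : Set (E d)} (hΩ : IsOpen Ω) {x e : E d} {r : ℝ} (hr : 0 < r)
    (he : ‖e‖ = 1) {K : NNReal} {a : E d → ℝ} (ha : LipschitzWith K a)
    (h : ∀ y ∈ Metric.ball x r, (y ∈ Ω ↔ a (y - inner ℝ y e • e) < inner ℝ y e)) :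
    ∃ C : NNReal, ∀ φ : E d → E d, ContDiff ℝ ∞ φ →
      eLpNorm φ 2 ((Measure.euclideanHausdorffMeasure (d - 1)).restrict
          (frontier Ω ∩ Metric.ball x (r / 2)))
        ≤ C * (eLpNorm (gradField φ) 2 (volume.restrict Ω)
          + eLpNorm φ 2 (volume.restrict Ω)) := by
  obtain ⟨χ, M, hχ, -, hχ0, hcut⟩ := exists_cutoff x hr
  have hch := isConeChart_epigraph hr he ha h
  set L : NNReal := (1 + K) ^ (d - 1) with hL
  set D : NNReal := ((d * d : ℕ) : NNReal) with hD
  -- the square root of `L` occurs through `L ≤ (1 + L) ^ 2`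
  refine ⟨(1 + L) * ((1 + D) * (1 + M)), fun φ hφ => ?_⟩
  obtain ⟨c1, c2, c3, c4, c5, c6, -⟩ := hcut φ hφ
  set v : E d → E d := fun y => χ y • φ y with hv
  have hb : MeasurableSet (frontier Ω ∩ Metric.ball x (r / 2)) :=
    isClosed_frontier.measurableSet.inter Metric.isOpen_ball.measurableSet
  have hsub : frontier Ω ∩ Metric.ball x (r / 2) ⊆ graphSet e a := fun y hy =>
    frontier_inter_ball_subset hΩ ha.continuous h
      ⟨hy.1, Metric.ball_subset_ball (by linarith) hy.2⟩
  have hA : eLpNorm φ 2 ((Measure.euclideanHausdorffMeasure (d - 1)).restrict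
      (frontier Ω ∩ Metric.ball x (r / 2)))
      ≤ eLpNorm v 2 ((Measure.euclideanHausdorffMeasure (d - 1)).restrict (graphSet e a)) := by
    calc _ = eLpNorm v 2 ((Measure.euclideanHausdorffMeasure (d - 1)).restrict
          (frontier Ω ∩ Metric.ball x (r / 2))) :=
        eLpNorm_congr_ae ((ae_restrict_iff' hb).2 (ae_of_all _ fun y hy => ((c3 y hy.2).1).symm))
      _ ≤ _ := eLpNorm_mono_measure _ (Measure.restrict_mono_set _ hsub)
  have hB : eLpNorm v 2 ((Measure.euclideanHausdorffMeasure (d - 1)).restrict (graphSet e a))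
      ≤ (1 + L : NNReal) * ((1 + D : NNReal) *
        (eLpNorm v 2 (volume.restrict Ω) + eLpNorm (gradField v) 2 (volume.restrict Ω))) := by
    rw [← ENNReal.pow_le_pow_left_iff two_ne_zero, sq_eLpNorm_two]
    refine (lintegral_graphSet_le he ha c1 c2).trans ?_
    have h1 : ∫⁻ y in epigraph e a, (‖v y‖ₑ ^ 2 + ‖fderiv ℝ v y e‖ₑ ^ 2)
        ≤ (1 + D : NNReal) ^ 2 * (eLpNorm v 2 (volume.restrict Ω)
          + eLpNorm (gradField v) 2 (volume.restrict Ω)) ^ 2 := by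
      have hpt : ∀ y, ‖v y‖ₑ ^ 2 + ‖fderiv ℝ v y e‖ₑ ^ 2
          ≤ (1 + D : NNReal) ^ 2 * (‖v y‖ₑ ^ 2 + ‖gradField v y‖ₑ ^ 2) := by
        intro y
        have hf := norm_fderiv_apply_le v y e
        rw [he, mul_one] at hf
        have hf' : ‖fderiv ℝ v y e‖ₑ ≤ (1 + D : NNReal) * ‖gradField v y‖ₑ := by
          have : ‖fderiv ℝ v y e‖₊ ≤ (1 + D) * ‖gradField v y‖₊ := by
            rw [← NNReal.coe_le_coe]
            push_cast [hD]
            refine hf.trans ?_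
            gcongr
            push_cast
            linarith
          simpa [enorm] using ENNReal.coe_le_coe.2 this
        rw [mul_add]
        refine add_le_add ?_ ?_
        · refine le_mul_of_one_le_left zero_le ?_
          exact one_le_pow₀ (by exact_mod_cast (le_self_add : (1 : NNReal) ≤ 1 + D))
        · rw [← mul_pow]
          gcongr
      refine (lintegral_mono hpt).trans ?_
      rw [lintegral_const_mul _ (by
        have h1 := c1.continuous.measurable
        have h2 := (continuous_gradField c1).measurable
        fun_prop), lintegral_add_left (by
        have h1 := c1.continuous.measurable
        fun_prop), ← sq_eLpNorm_two, ← sq_eLpNorm_two,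
        hch.eLpNorm_eq hΩ.measurableSet c4,
        hch.eLpNorm_eq hΩ.measurableSet (fun y hy => by rw [hv]; simp [hχ0 y hy])]
      gcongr
      rw [add_sq]
      gcongr
      exact le_self_add
    rw [mul_pow, mul_pow]
    refine mul_le_mul' ?_ h1
    have : L ≤ (1 + L) ^ 2 := by
      rw [← NNReal.coe_le_coe]; push_cast; nlinarith [L.2, sq_nonneg (L : ℝ)]
    exact_mod_cast this
  refine hA.trans (hB.trans ?_)
  push_cast
  rw [mul_assoc, mul_assoc]
  gcongr
  have h1 : eLpNorm v 2 (volume.restrict Ω) ≤ eLpNorm φ 2 (volume.restrict Ω) := eLpNorm_mono c5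
  have h2 := eLpNorm_le_add_of_norm_le (m := volume.restrict Ω)
    (continuous_gradField hφ).aestronglyMeasurable hφ.continuous.aestronglyMeasurable c6
  refine (add_le_add h1 h2).trans ?_
  calc eLpNorm φ 2 (volume.restrict Ω) + (eLpNorm (gradField φ) 2 (volume.restrict Ω)
        + M * eLpNorm φ 2 (volume.restrict Ω))
      = (eLpNorm (gradField φ) 2 (volume.restrict Ω) + eLpNorm φ 2 (volume.restrict Ω))
        + M * eLpNorm φ 2 (volume.restrict Ω) := by ring
    _ ≤ (eLpNorm (gradField φ) 2 (volume.restrict Ω) + eLpNorm φ 2 (volume.restrict Ω))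
        + M * (eLpNorm (gradField φ) 2 (volume.restrict Ω)
          + eLpNorm φ 2 (volume.restrict Ω)) := by
        gcongr
        exact le_add_self
    _ = _ := by ring

/-- **Trace inequality** on a bounded Lipschitz domain. -/
theorem trace_inequality {Ω : Set (E d)} (hΩ : IsOpen Ω)
    (hb : Bornology.IsBounded Ω) (hL : HasLipschitzBoundary Ω) :
    ∃ C : NNReal, ∀ φ : E d → E d, ContDiff ℝ ∞ φ →
      eLpNorm φ 2 (surface Ω) ≤ C * (eLpNorm (gradField φ) 2 (volume.restrict Ω)
          + eLpNorm φ 2 (volume.restrict Ω)) := by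
  have hloc : ∀ x : frontier Ω, ∃ r > 0, ∃ C : NNReal, ∀ φ : E d → E d, ContDiff ℝ ∞ φ →
      eLpNorm φ 2 ((Measure.euclideanHausdorffMeasure (d - 1)).restrict
          (frontier Ω ∩ Metric.ball x.1 r))
        ≤ C * (eLpNorm (gradField φ) 2 (volume.restrict Ω)
          + eLpNorm φ 2 (volume.restrict Ω)) := fun x => by
    obtain ⟨r, hr, e, he, K, a, ha, h⟩ := hL x x.2
    exact ⟨r / 2, half_pos hr, trace_local hΩ hr he ha h⟩
  choose r hr C hC using hloc
  have hcomp : IsCompact (frontier Ω) :=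
    hb.isCompact_closure.of_isClosed_subset isClosed_frontier frontier_subset_closure
  obtain ⟨t, ht⟩ := hcomp.elim_nhds_subcover' (fun x hx => Metric.ball x (r ⟨x, hx⟩))
    fun x hx => Metric.ball_mem_nhds x (hr _)
  refine ⟨∑ x ∈ t, C x, fun φ hφ => ?_⟩
  refine (eLpNorm_restrict_le_sum _ φ t (fun x => Metric.ball x.1 (r x)) ht).trans ?_
  push_cast
  rw [Finset.sum_mul]
  exact Finset.sum_le_sum fun x _ => hC x φ hφ

end Trace

/-! ### Fields with vanishing strain -/

section Rigidity

variable {d : ℕ}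

open scoped Convolution in
/-- An integrable function with vanishing distributional gradient on a ball is constant on the ball
of half the radius: its mollifications are locally constant. -/
theorem exists_ae_eq_const_ball {f : E d → ℝ} (hf : Integrable f) {x₀ : E d} {r : ℝ} (hr : 0 < r)
    (h : ∀ ψ : E d → ℝ, ContDiff ℝ ∞ ψ → HasCompactSupport ψ →
      tsupport ψ ⊆ Metric.ball x₀ (2 * r) → ∀ k, ∫ x, f x * fderiv ℝ ψ x (basisVec k) = 0) :
    ∃ c, ∀ᵐ x, x ∈ Metric.ball x₀ r → f x = c := by
  let η : ℕ → ContDiffBump (0 : E d) := fun n =>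
    ⟨r / (n + 1) / 2, r / (n + 1), by positivity, half_lt_self (by positivity)⟩
  have hη0 : Tendsto (fun n => (η n).rOut) atTop (𝓝 0) := by
    have := (tendsto_one_div_add_atTop_nhds_zero_nat (𝕜 := ℝ)).const_mul r
    simp only [mul_zero, mul_one_div] at this
    exact this
  have hlim := ContDiffBump.ae_convolution_tendsto_right_of_locallyIntegrable (μ := volume)
    (φ := η) (K := 2) hη0 (Eventually.of_forall fun n => by
      change r / (n + 1) ≤ 2 * (r / (n + 1) / 2); linarith) hf.locallyIntegrable
  have hswap : ∀ n x, ((η n).normed volume ⋆[ContinuousLinearMap.lsmul ℝ ℝ, volume] f) x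
      = (f ⋆[ContinuousLinearMap.mul ℝ ℝ, volume] (η n).normed volume) x := by
    intro n x
    rw [convolution_lsmul_swap, convolution_def]
    refine integral_congr_ae (ae_of_all _ fun t => ?_)
    simp [mul_comm]
  have hconst : ∀ n, ∀ x ∈ Metric.ball x₀ r,
      ((η n).normed volume ⋆[ContinuousLinearMap.lsmul ℝ ℝ, volume] f) x
        = ((η n).normed volume ⋆[ContinuousLinearMap.lsmul ℝ ℝ, volume] f) x₀ := by
    intro n x hx
    rw [hswap, hswap]
    have hsm : ContDiff ℝ ∞ ((η n).normed (volume : Measure (E d))) := (η n).contDiff_normed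
    have hcs := (η n).hasCompactSupport_normed (μ := (volume : Measure (E d)))
    have hD := fun y => hcs.hasFDerivAt_convolution_right (ContinuousLinearMap.mul ℝ ℝ)
      hf.locallyIntegrable (hsm.of_le (by exact_mod_cast le_top)) y
    refine Metric.isOpen_ball.is_const_of_fderiv_eq_zero (𝕜 := ℝ)
      (convex_ball x₀ r).isPreconnected (fun y _ => (hD y).differentiableAt.differentiableWithinAt)
      (fun y hy => ?_) hx (Metric.mem_ball_self hr)
    rw [(hD y).fderiv]
    have hk : ∀ k, (f ⋆[(ContinuousLinearMap.mul ℝ ℝ).precompR (E d), volume]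
        fderiv ℝ ((η n).normed volume)) y (basisVec k) = 0 := by
      intro k
      rw [convolution_precompR_apply _ hf.locallyIntegrable (hcs.fderiv (𝕜 := ℝ))
        (hsm.continuous_fderiv (by simp)), convolution_def]
      have hψ : ContDiff ℝ ∞ fun t => (η n).normed volume (y - t) :=
        hsm.comp (contDiff_const.sub contDiff_id)
      have hsupp : tsupport (fun t => (η n).normed volume (y - t)) ⊆ Metric.closedBall y r := by
        refine closure_minimal (fun t ht => ?_) Metric.isClosed_closedBall
        have h1 : y - t ∈ Function.support ((η n).normed (volume : Measure (E d))) := ht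
        rw [(η n).support_normed_eq, mem_ball_zero_iff] at h1
        rw [Metric.mem_closedBall, dist_comm, dist_eq_norm]
        refine h1.le.trans ?_
        exact div_le_self hr.le (by linarith [n.cast_nonneg (α := ℝ)])
      have h0 := h _ hψ
        (HasCompactSupport.of_support_subset_isCompact (isCompact_closedBall y r)
          (subset_closure.trans hsupp))
        (hsupp.trans fun z hz => by
          rw [Metric.mem_closedBall] at hz
          rw [Metric.mem_ball] at hy ⊢
          linarith [dist_triangle z y x₀]) k
      rw [← neg_eq_zero, ← integral_neg, ← h0]
      refine integral_congr_ae (ae_of_all _ fun t => ?_)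
      have h1 : HasFDerivAt (fun t => (η n).normed volume (y - t))
          ((fderiv ℝ ((η n).normed volume) (y - t)).comp (-ContinuousLinearMap.id ℝ (E d))) t :=
        ((hsm.differentiable (by simp) (y - t)).hasFDerivAt).comp t
          ((hasFDerivAt_id t).const_sub y)
      simp [h1.fderiv]
    ext v
    rw [sum_smul_basisVec v, map_sum]
    simp [hk]
  -- without a point of convergence in the ball the claim is vacuous, since almost every point is one
  by_cases hex : ∃ x ∈ Metric.ball x₀ r, Tendsto (fun n =>
      ((η n).normed volume ⋆[ContinuousLinearMap.lsmul ℝ ℝ, volume] f) x) atTop (𝓝 (f x))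
  · obtain ⟨x, hx, hxl⟩ := hex
    refine ⟨f x, ?_⟩
    filter_upwards [hlim] with y hy hyb
    refine tendsto_nhds_unique (hy.congr fun n => ?_) hxl
    rw [hconst n y hyb, hconst n x hx]
  · refine ⟨0, ?_⟩
    filter_upwards [hlim] with y hy hyb
    exact absurd ⟨y, hyb, hy⟩ hex

/-- On a connected open set, a function with vanishing distributional gradient is constant. -/
theorem exists_ae_eq_const {Ω : Set (E d)} (hΩ : IsOpen Ω) (hc : IsConnected Ω) {f : E d → ℝ}
    (hf : IntegrableOn f Ω)
    (h : ∀ ψ : E d → ℝ, ContDiff ℝ ∞ ψ → HasCompactSupport ψ → tsupport ψ ⊆ Ω →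
      ∀ k, ∫ x in Ω, f x * fderiv ℝ ψ x (basisVec k) = 0) :
    ∃ c, f =ᵐ[volume.restrict Ω] fun _ => c := by
  have hloc : ∀ x : Ω, ∃ r > 0, Metric.ball x.1 r ⊆ Ω ∧ ∃ c, ∀ᵐ y, y ∈ Metric.ball x.1 r →
      f y = c := by
    intro x
    obtain ⟨R, hR, hb⟩ := Metric.isOpen_iff.1 hΩ x x.2
    obtain ⟨c, hc⟩ := exists_ae_eq_const_ball (f := Ω.indicator f) (x₀ := x.1) (r := R / 2)
      ((integrable_indicator_iff hΩ.measurableSet).2 hf) (half_pos hR) (by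
        intro ψ h1 h2 h3 k
        rw [mul_div_cancel₀ _ (two_ne_zero)] at h3
        rw [← h ψ h1 h2 (h3.trans hb) k, ← integral_indicator hΩ.measurableSet]
        refine integral_congr_ae (ae_of_all _ fun y => ?_)
        by_cases hy : y ∈ Ω <;> simp [hy])
    have hsub : Metric.ball x.1 (R / 2) ⊆ Ω :=
      (Metric.ball_subset_ball (by linarith)).trans hb
    refine ⟨R / 2, half_pos hR, hsub, c, ?_⟩
    filter_upwards [hc] with y hy hyb
    rw [← hy hyb, indicator_of_mem (hsub hyb)]
  choose r hr hsub c hcr using hloc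
  -- overlapping balls meet in a set of positive measure, so their constants agree
  have hlc : IsLocallyConstant c := by
    rw [IsLocallyConstant.iff_exists_open]
    intro x
    refine ⟨Subtype.val ⁻¹' Metric.ball x.1 (r x), Metric.isOpen_ball.preimage continuous_subtype_val,
      Metric.mem_ball_self (hr x), fun y hy => ?_⟩
    have hpos : volume (Metric.ball y.1 (r y) ∩ Metric.ball x.1 (r x)) ≠ 0 :=
      ((Metric.isOpen_ball.inter Metric.isOpen_ball).measure_pos volume
        ⟨y.1, Metric.mem_ball_self (hr y), hy⟩).ne'
    obtain ⟨z, hz, h1, h2⟩ := ((frequently_ae_mem_iff.2 hpos).and_eventually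
      ((hcr y).and (hcr x))).exists
    rw [← h1 hz.1, ← h2 hz.2]
  obtain ⟨x₀, hx₀⟩ := hc.nonempty
  have : PreconnectedSpace Ω := isPreconnected_iff_preconnectedSpace.1 hc.isPreconnected
  have hconst : ∀ x, c x = c ⟨x₀, hx₀⟩ := fun x =>
    hlc.apply_eq_of_isPreconnected isPreconnected_univ (mem_univ _) (mem_univ _)
  refine ⟨c ⟨x₀, hx₀⟩, ?_⟩
  rw [EventuallyEq, ae_restrict_iff' hΩ.measurableSet, ae_iff]
  refine measure_null_of_locally_null _ fun x hx => ?_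
  rw [Set.mem_ofPred_eq, Classical.not_imp] at hx
  refine ⟨_, inter_mem_nhdsWithin _ (Metric.ball_mem_nhds x (hr ⟨x, hx.1⟩)), ?_⟩
  refine measure_mono_null (fun y hy => ?_) (ae_iff.1 (hcr ⟨x, hx.1⟩))
  rw [Set.mem_ofPred_eq, Classical.not_imp]
  have := hy.1
  rw [Set.mem_ofPred_eq, Classical.not_imp] at this
  exact ⟨hy.2, fun h0 => this.2 (h0.trans (hconst _))⟩

end Rigidity

section RigidMotion

variable {d : ℕ}

/-- The linear map `y ↦ A y` given by a matrix. -/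
noncomputable def matVec (A : Mat d) : E d →L[ℝ] E d :=
  ∑ p : Fin d × Fin d, A p • (EuclideanSpace.proj (𝕜 := ℝ) (ι := Fin d) p.2).smulRight
    (basisVec p.1)

theorem matVec_apply (A : Mat d) (y : E d) (i : Fin d) :
    matVec A y i = ∑ j, A (i, j) * y j := by
  simp [matVec, Fintype.sum_prod_type, basisVec, Finset.sum_apply, Pi.single_apply]

theorem gradField_affine (A : Mat d) (b x : E d) : gradField (fun y => matVec A y + b) x = A := by
  ext ⟨i, j⟩
  have : HasFDerivAt (fun y => matVec A y + b) (matVec A) x := (matVec A).hasFDerivAt.add_const b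
  rw [gradField_apply, this.fderiv, matVec_apply]
  simp [basisVec]

theorem inner_matVec_of_skew {A : Mat d} (hA : symPart A = 0) (y z : E d) :
    inner ℝ (matVec A y) z = -inner ℝ y (matVec A z) := by
  have h : ∀ i j, A (i, j) = -A (j, i) := fun i j => by
    have := congrArg (fun M : Mat d => M (i, j)) hA
    simp only [symPart_apply, PiLp.zero_apply] at this
    linarith
  simp only [PiLp.inner_apply, matVec_apply, RCLike.inner_apply, conj_trivial, Finset.mul_sum,
    Finset.sum_mul, ← Finset.sum_neg_distrib]
  rw [Finset.sum_comm]
  refine Finset.sum_congr rfl fun i _ => Finset.sum_congr rfl fun j _ => ?_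
  rw [h j i]
  ring

theorem integral_mul_fderiv_smooth {g φ : E d → ℝ} (hg : ContDiff ℝ ∞ g) (hφ : ContDiff ℝ ∞ φ)
    (hc : HasCompactSupport φ) (v : E d) :
    ∫ x, g x * fderiv ℝ φ x v = - ∫ x, fderiv ℝ g x v * φ x := by
  have hg' : Continuous fun x => fderiv ℝ g x v :=
    (hg.continuous_fderiv (by simp)).clm_apply continuous_const
  have hφ' : Continuous fun x => fderiv ℝ φ x v :=
    (hφ.continuous_fderiv (by simp)).clm_apply continuous_const
  refine integral_mul_fderiv_eq_neg_fderiv_mul_of_integrable ?_ ?_ ?_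
    (fun x _ => hg.differentiable (by simp) x) (fun x _ => hφ.differentiable (by simp) x)
  · exact (hg'.mul hφ.continuous).integrable_of_hasCompactSupport hc.mul_left
  · exact (hg.continuous.mul hφ').integrable_of_hasCompactSupport
      (hc.fderiv_apply (𝕜 := ℝ) v).mul_left
  · exact (hg.continuous.mul hφ.continuous).integrable_of_hasCompactSupport hc.mul_left

theorem isWeakGradient_of_contDiff {Ω : Set (E d)} {u : E d → E d} (hu : ContDiff ℝ ∞ u) :
    IsWeakGradient Ω u (gradField u) := by
  intro φ h1 h2 h3 i j
  have hz : ∀ x ∉ Ω, φ x = 0 := fun x hx => image_eq_zero_of_notMem_tsupport fun h => hx (h3 h)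
  have hz' : ∀ x ∉ Ω, fderiv ℝ φ x (basisVec j) = 0 := fun x hx => by
    have : fderiv ℝ φ x = 0 := by
      by_contra h
      exact hx (h3 (support_fderiv_subset ℝ h))
    simp [this]
  rw [setIntegral_eq_integral_of_forall_compl_eq_zero fun x hx => by rw [hz' x hx, mul_zero],
    setIntegral_eq_integral_of_forall_compl_eq_zero fun x hx => by rw [hz x hx, mul_zero]]
  have hui : ContDiff ℝ ∞ fun x => u x i :=
    (EuclideanSpace.proj (𝕜 := ℝ) (ι := Fin d) i).contDiff.comp hu
  rw [integral_mul_fderiv_smooth hui h1 h2]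
  congr 1
  refine integral_congr_ae (ae_of_all _ fun x => ?_)
  have := ((EuclideanSpace.proj (𝕜 := ℝ) (ι := Fin d) i).hasFDerivAt (x := u x)).comp x
    (hu.differentiable (by simp) x).hasFDerivAt
  have h := congrArg (fun L => L (basisVec j)) this.fderiv
  simp only [Function.comp_def] at h
  exact congrArg (· * φ x) h

/-- If the strain vanishes, then the entries of the gradient have vanishing weak gradient: by the
symmetry of second derivatives, `⟨G i j, ∂ₖ ψ⟩` is symmetric in `(j, k)` and skew in `(i, j)`. -/
theorem integral_grad_mul_fderiv_eq_zero {Ω : Set (E d)} {u : E d → E d} {G : E d → Mat d}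
    (hw : IsWeakGradient Ω u G) (hs : ∀ᵐ x ∂(volume.restrict Ω), symPart (G x) = 0)
    {ψ : E d → ℝ} (h1 : ContDiff ℝ ∞ ψ) (h2 : HasCompactSupport ψ) (h3 : tsupport ψ ⊆ Ω)
    (i j k : Fin d) : ∫ x in Ω, G x (i, j) * fderiv ℝ ψ x (basisVec k) = 0 := by
  have hd : ∀ k, ContDiff ℝ ∞ fun x => fderiv ℝ ψ x (basisVec k) := fun k =>
    (h1.fderiv_right (m := ∞) (by simp)).clm_apply contDiff_const
  have hdc : ∀ k, HasCompactSupport fun x => fderiv ℝ ψ x (basisVec k) := fun k =>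
    h2.fderiv_apply (𝕜 := ℝ) (basisVec k)
  have hds : ∀ k, tsupport (fun x => fderiv ℝ ψ x (basisVec k)) ⊆ Ω := fun k =>
    (closure_mono fun x hx => by
      have : fderiv ℝ ψ x ≠ 0 := fun h => hx (by simp [h])
      exact this).trans ((tsupport_fderiv_subset ℝ).trans h3)
  have hdd : ∀ j k x, fderiv ℝ (fun x => fderiv ℝ ψ x (basisVec k)) x (basisVec j)
      = fderiv ℝ (fderiv ℝ ψ) x (basisVec j) (basisVec k) := by
    intro j k x
    have h2 : HasFDerivAt (fderiv ℝ ψ) (fderiv ℝ (fderiv ℝ ψ) x) x :=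
      ((h1.fderiv_right (m := ∞) (by simp)).differentiable (by simp) x).hasFDerivAt
    have h3 := h2.clm_apply (hasFDerivAt_const (basisVec k) x)
    have h4 := congrArg (fun L => L (basisVec j)) h3.fderiv
    simpa using h4
  have hsym : ∀ x v w, fderiv ℝ (fderiv ℝ ψ) x v w = fderiv ℝ (fderiv ℝ ψ) x w v := by
    intro x
    have : IsSymmSndFDerivAt ℝ ψ x :=
      h1.contDiffAt.isSymmSndFDerivAt (by simpa using ENat.LEInfty.out)
    exact fun v w => this v w
  have e1 : ∀ i j k, ∫ x in Ω, G x (i, j) * fderiv ℝ ψ x (basisVec k)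
      = ∫ x in Ω, G x (i, k) * fderiv ℝ ψ x (basisVec j) := by
    intro i j k
    have a1 := hw _ (hd k) (hdc k) (hds k) i j
    have a2 := hw _ (hd j) (hdc j) (hds j) i k
    simp only [hdd] at a1 a2
    have : ∫ x in Ω, u x i * fderiv ℝ (fderiv ℝ ψ) x (basisVec j) (basisVec k)
        = ∫ x in Ω, u x i * fderiv ℝ (fderiv ℝ ψ) x (basisVec k) (basisVec j) := by
      simp only [hsym _ (basisVec j) (basisVec k)]
    linarith
  have e2 : ∀ i j k, ∫ x in Ω, G x (i, j) * fderiv ℝ ψ x (basisVec k)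
      = - ∫ x in Ω, G x (j, i) * fderiv ℝ ψ x (basisVec k) := by
    intro i j k
    rw [← integral_neg]
    refine integral_congr_ae ?_
    filter_upwards [hs] with x hx
    have := congrArg (fun M : Mat d => M (i, j)) hx
    simp only [symPart_apply, PiLp.zero_apply] at this
    have h : G x (i, j) = -G x (j, i) := by linarith
    rw [h]
    ring
  -- alternating `e2` and `e1` returns to `(i, j, k)` after six steps with the opposite sign
  linarith [e2 i j k, e1 j i k, e2 j k i, e1 k j i, e2 k i j, e1 i k j]

/-- A field with vanishing strain on a connected open set is an infinitesimal rigid motion. -/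
theorem exists_rigid_of_strain_zero {Ω : Set (E d)} (hΩ : IsOpen Ω) (hc : IsConnected Ω)
    (hb : Bornology.IsBounded Ω) {u : E d → E d} {G : E d → Mat d}
    (hu : MemLp u 2 (volume.restrict Ω)) (hG : MemLp G 2 (volume.restrict Ω))
    (hw : IsWeakGradient Ω u G) (hs : ∀ᵐ x ∂(volume.restrict Ω), symPart (G x) = 0) :
    ∃ (A : Mat d) (b : E d), symPart A = 0 ∧ G =ᵐ[volume.restrict Ω] (fun _ => A) ∧
      u =ᵐ[volume.restrict Ω] fun y => matVec A y + b := by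
  have hfin : IsFiniteMeasure (volume.restrict Ω) :=
    ⟨by rw [Measure.restrict_apply_univ]; exact hb.measure_lt_top⟩
  have hGi : ∀ p : Fin d × Fin d, ∃ c : ℝ, (fun x => G x p) =ᵐ[volume.restrict Ω] fun _ => c :=
    fun p => exists_ae_eq_const hΩ hc
      ((memLp_grad_coord hG p.1 p.2).integrable (by norm_num))
      fun ψ h1 h2 h3 k => integral_grad_mul_fderiv_eq_zero hw hs h1 h2 h3 p.1 p.2 k
  choose a ha using hGi
  let A : Mat d := WithLp.toLp 2 a
  have hGA : G =ᵐ[volume.restrict Ω] fun _ => A := by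
    filter_upwards [ae_all_iff.2 ha] with x hx
    ext p
    exact hx p
  have hne : (ae (volume.restrict Ω)).NeBot := by
    rw [ae_neBot, Ne, Measure.restrict_eq_zero]
    exact (hΩ.measure_pos volume hc.nonempty).ne'
  have hA : symPart A = 0 := by
    obtain ⟨x, hx, hx'⟩ := (hs.and hGA).exists
    have hx' : G x = A := hx'
    rw [← hx', hx]
  have hsm : ContDiff ℝ ∞ fun y => matVec A y := (matVec A).contDiff
  have hmL : MemLp (fun y => matVec A y) 2 (volume.restrict Ω) := by
    obtain ⟨R, hR⟩ := hb.subset_closedBall (0 : E d)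
    refine MemLp.of_bound hsm.continuous.aestronglyMeasurable (‖matVec A‖ * R) ?_
    refine (ae_restrict_iff' hΩ.measurableSet).2 (ae_of_all _ fun y hy => ?_)
    refine ((matVec A).le_opNorm y).trans ?_
    gcongr
    simpa using hR hy
  -- the gradient is the constant `A`, so subtracting `A y` leaves a field with vanishing gradient
  have hui : ∀ i, ∃ c : ℝ, (fun x => u x i - matVec A x i) =ᵐ[volume.restrict Ω] fun _ => c := by
    intro i
    have m1 := memLp_coord hu i
    have m2 := memLp_coord hmL i
    refine exists_ae_eq_const hΩ hc ((m1.sub m2).integrable (by norm_num)) fun ψ h1 h2 h3 k => ?_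
    have mD := memLp_testGrad (Ω := Ω) h1 h2 k
    have e := isWeakGradient_of_contDiff (Ω := Ω) hsm ψ h1 h2 h3 i k
    have e' : gradField (fun y => matVec A y) = fun _ => A := by
      funext x
      simpa using gradField_affine A 0 x
    rw [e'] at e
    simp only [sub_mul]
    rw [integral_sub (memLp_two_mul_integrable m1 mD) (memLp_two_mul_integrable m2 mD), e, hw ψ h1 h2 h3 i k,
      sub_eq_zero, neg_inj]
    refine integral_congr_ae ?_
    filter_upwards [hGA] with x hx
    rw [hx]
  choose b hb' using hui
  refine ⟨A, WithLp.toLp 2 b, hA, hGA, ?_⟩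
  filter_upwards [ae_all_iff.2 hb'] with x hx
  ext i
  have := hx i
  simp only [PiLp.add_apply]
  linarith

/-- The trace of a field that is smooth up to the boundary is its restriction. -/
theorem IsTrace.ae_eq_of_smooth {Ω : Set (E d)} (hΩ : IsOpen Ω)
    (hb : Bornology.IsBounded Ω) (hL : HasLipschitzBoundary Ω) {u r w : E d → E d}
    {G : E d → Mat d} (ht : IsTrace Ω u G w) (hw : AEStronglyMeasurable w (surface Ω))
    (hr : ContDiff ℝ ∞ r) (hu : u =ᵐ[volume.restrict Ω] r)
    (hG : G =ᵐ[volume.restrict Ω] gradField r) : w =ᵐ[surface Ω] r := by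
  obtain ⟨C, hC⟩ := trace_inequality hΩ hb hL
  obtain ⟨φ, hφ, t1, t2, t3⟩ := ht
  have hsub : ∀ n, ContDiff ℝ ∞ (φ n - r) := fun n => (hφ n).sub hr
  have hgs : ∀ n, gradField (φ n - r) = gradField (φ n) - gradField r := by
    intro n
    ext x p
    simp [gradField, fderiv_sub ((hφ n).differentiable (by simp) x)
      (hr.differentiable (by simp) x)]
  have h1 : Tendsto (fun n => eLpNorm (φ n - r) 2 (surface Ω)) atTop (𝓝 0) := by
    have hlim := ENNReal.Tendsto.const_mul (a := (C : ℝ≥0∞)) (t2.add t1) (Or.inr (by simp))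
    rw [add_zero, mul_zero] at hlim
    refine tendsto_of_tendsto_of_tendsto_of_le_of_le tendsto_const_nhds hlim
      (fun _ => zero_le) fun n => ?_
    refine (hC _ (hsub n)).trans (le_of_eq ?_)
    rw [hgs]
    congr 2
    · refine eLpNorm_congr_ae ?_
      filter_upwards [hG] with x hx
      simp [hx]
    · refine eLpNorm_congr_ae ?_
      filter_upwards [hu] with x hx
      simp [hx]
  have h2 : eLpNorm (w - r) 2 (surface Ω) = 0 := by
    refine le_antisymm (ge_of_tendsto' (x := atTop)
      (f := fun n => eLpNorm (φ n - r) 2 (surface Ω) + eLpNorm (φ n - w) 2 (surface Ω))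
      (by simpa using h1.add t3) fun n => ?_) zero_le
    have : w - r = (φ n - r) - (φ n - w) := by abel
    rw [this]
    exact eLpNorm_sub_le (hsub n).continuous.aestronglyMeasurable
      ((hφ n).continuous.aestronglyMeasurable.sub hw) (by norm_num)
  have h3 := (eLpNorm_eq_zero_iff (hw.sub hr.continuous.aestronglyMeasurable) (by norm_num)).1 h2
  filter_upwards [h3] with x hx
  simpa [sub_eq_zero] using hx

/-- A continuous field that vanishes almost everywhere on a relatively open part of a Lipschitz
graph vanishes there everywhere: the orthogonal projection onto the hyperplane does not increase
the surface measure, so that the projection of the exceptional set is an open null set. -/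
theorem eq_zero_of_ae_eq_zero_graph {e : E d} (he : ‖e‖ = 1) {K : NNReal} {a : E d → ℝ}
    (ha : LipschitzWith K a) {S V : Set (E d)} (hV : IsOpen V) (hVS : graphSet e a ∩ V ⊆ S)
    {r : E d → E d} (hr : Continuous r)
    (h0 : ∀ᵐ x ∂((Measure.euclideanHausdorffMeasure (d - 1)).restrict S), r x = 0)
    {w : hyperplane e} (hw : graphMap e a w ∈ V) : r (graphMap e a w) = 0 := by
  have hΓ : Continuous (graphMap e a) := (lipschitzWith_graphMap he ha).continuous
  have h1 : Measure.euclideanHausdorffMeasure (d - 1) {x | x ∈ graphSet e a ∩ V ∧ r x ≠ 0} = 0 := by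
    have hm : MeasurableSet {x | ¬ r x = 0} :=
      (isOpen_ne_fun hr continuous_const).measurableSet
    have := ae_iff.1 h0
    rw [Measure.restrict_apply hm] at this
    refine measure_mono_null ?_ this
    exact fun x hx => ⟨hx.2, hVS hx.1⟩
  let π : E d → hyperplane e := fun y => ⟨y - inner ℝ y e • e, sub_inner_smul_mem he y⟩
  have hπ : LipschitzWith 1 π := by
    refine LipschitzWith.of_dist_le_mul fun y z => ?_
    rw [NNReal.coe_one, one_mul, Subtype.dist_eq, dist_eq_norm, dist_eq_norm]
    have : (y - inner ℝ y e • e) - (z - inner ℝ z e • e)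
        = (y - z) - inner ℝ (y - z) e • e := by
      rw [inner_sub_left, sub_smul]; abel
    change ‖(y - inner ℝ y e • e) - (z - inner ℝ z e • e)‖ ≤ _
    rw [this]
    exact norm_sub_inner_smul_le he _
  have hπΓ : ∀ w, π (graphMap e a w) = w := fun w => by
    apply Subtype.ext
    simp only [π, graphMap, inner_add_smul_unit he, add_sub_cancel_right]
  have h3 : (volume : Measure (hyperplane e)) = Measure.euclideanHausdorffMeasure (d - 1) := by
    rw [← finrank_hyperplane he, InnerProductSpace.euclideanHausdorffMeasure_eq_volume]
  have h2 : volume {w : hyperplane e | graphMap e a w ∈ V ∧ r (graphMap e a w) ≠ 0} = 0 := by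
    have hle := hπ.hausdorffMeasure_image_le (d := ((d - 1 : ℕ) : ℝ)) (Nat.cast_nonneg _)
      {x | x ∈ graphSet e a ∩ V ∧ r x ≠ 0}
    have hz : Measure.hausdorffMeasure ((d - 1 : ℕ) : ℝ)
        {x | x ∈ graphSet e a ∩ V ∧ r x ≠ 0} = 0 := by
      rw [Measure.euclideanHausdorffMeasure_def, Measure.smul_apply, ENNReal.smul_def,
        smul_eq_mul, mul_eq_zero] at h1
      refine h1.resolve_left ?_
      exact_mod_cast Measure.addHaarScalarFactor_volume_hausdorffMeasure_ne_zero (d - 1)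
    rw [hz, mul_zero] at hle
    rw [h3, Measure.euclideanHausdorffMeasure_def, Measure.smul_apply]
    have : Measure.hausdorffMeasure ((d - 1 : ℕ) : ℝ)
        {w : hyperplane e | graphMap e a w ∈ V ∧ r (graphMap e a w) ≠ 0} = 0 := by
      refine measure_mono_null (fun w hw => ?_) (le_antisymm hle zero_le)
      exact ⟨graphMap e a w, ⟨⟨graphMap_mem he a w, hw.1⟩, hw.2⟩, hπΓ w⟩
    rw [this, smul_zero]
  by_contra hne
  have ho : IsOpen {w : hyperplane e | graphMap e a w ∈ V ∧ r (graphMap e a w) ≠ 0} :=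
    (hV.preimage hΓ).inter ((isOpen_ne_fun hr continuous_const).preimage hΓ)
  exact (ho.measure_pos volume ⟨w, hw, hne⟩).ne' h2

/-- A skew map whose range is spanned by one vector is zero. -/
theorem skew_eq_zero {W : E d →L[ℝ] E d} (hW : ∀ y z, inner ℝ (W y) z = -inner ℝ y (W z))
    {e : E d} (h : ∀ y, ∃ t : ℝ, W y = t • W e) : W = 0 := by
  have hself : ∀ y, inner ℝ (W y) y = 0 := fun y => by
    have := hW y y
    rw [real_inner_comm y] at this
    linarith [real_inner_comm (W y) y]
  have hb : W e = 0 := by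
    by_contra hne
    obtain ⟨t, ht⟩ := h (W e)
    have h1 := hself (W e)
    rw [ht, inner_smul_left, real_inner_self_eq_norm_sq] at h1
    have ht0 : t = 0 := by
      have : ‖W e‖ ^ 2 ≠ 0 := by positivity
      simpa [this] using h1
    have h2 := hW e (W e)
    rw [ht, ht0, zero_smul, inner_zero_right, neg_zero, real_inner_self_eq_norm_sq] at h2
    exact hne (by simpa using h2)
  ext1 y
  obtain ⟨t, ht⟩ := h y
  rw [ht, hb, smul_zero, zero_apply]

/-- An infinitesimal rigid motion that vanishes on a nonempty relatively open part of a Lipschitz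
boundary is zero: differences along the Lipschitz graph show that the range of its linear part has
dimension at most one, which is impossible for a nonzero skew map. -/
theorem rigid_eq_zero {Ω : Set (E d)} (hΩ : IsOpen Ω) (hL : HasLipschitzBoundary Ω) {U : Set (E d)}
    (hU : IsOpen U) (hne : (U ∩ frontier Ω).Nonempty) {A : Mat d} {b : E d} (hA : symPart A = 0)
    (h0 : ∀ᵐ x ∂((Measure.euclideanHausdorffMeasure (d - 1)).restrict (U ∩ frontier Ω)),
      matVec A x + b = 0) : ∀ x, matVec A x + b = 0 := by
  obtain ⟨x₀, hx₀U, hx₀⟩ := hne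
  obtain ⟨r, hr, e, he, K, a, ha, h⟩ := hL x₀ hx₀
  have hV : IsOpen (Metric.ball x₀ r ∩ U) := Metric.isOpen_ball.inter hU
  have hVS : graphSet e a ∩ (Metric.ball x₀ r ∩ U) ⊆ U ∩ frontier Ω := fun y hy =>
    ⟨hy.2.2, graphSet_inter_ball_subset hΩ he h ⟨hy.1, hy.2.1⟩⟩
  have hcont : Continuous fun x => matVec A x + b := by fun_prop
  have hΓ : Continuous (graphMap e a) := (lipschitzWith_graphMap he ha).continuous
  obtain ⟨w₀, hw₀⟩ := exists_graphMap_eq he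
    (frontier_inter_ball_subset hΩ ha.continuous h ⟨hx₀, Metric.mem_ball_self hr⟩)
  have hw₀V : graphMap e a w₀ ∈ Metric.ball x₀ r ∩ U := by
    rw [hw₀]; exact ⟨Metric.mem_ball_self hr, hx₀U⟩
  have hz : ∀ w, graphMap e a w ∈ Metric.ball x₀ r ∩ U → matVec A (graphMap e a w) + b = 0 :=
    fun w hw => eq_zero_of_ae_eq_zero_graph he ha hV hVS hcont h0 hw
  have hW : matVec A = 0 := by
    refine skew_eq_zero (inner_matVec_of_skew hA) (e := e) fun y => ?_
    let v : hyperplane e := ⟨y - inner ℝ y e • e, sub_inner_smul_mem he y⟩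
    have hlim : Tendsto (fun t : ℝ => graphMap e a (w₀ + t • v)) (𝓝[>] 0)
        (𝓝 (graphMap e a w₀)) := by
      have hc : Continuous fun t : ℝ => graphMap e a (w₀ + t • v) := hΓ.comp (by fun_prop)
      have := hc.tendsto 0
      simp only [zero_smul, add_zero] at this
      exact this.mono_left nhdsWithin_le_nhds
    obtain ⟨t, ht, ht0⟩ := ((hlim.eventually (hV.mem_nhds hw₀V)).and self_mem_nhdsWithin).exists
    have ht0' : t ≠ 0 := (show (0 : ℝ) < t from ht0).ne'
    have e1 := hz _ ht
    have e2 := hz _ hw₀V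
    have e3 : t • matVec A v + (a (w₀ + t • v : hyperplane e) - a w₀) • matVec A e = 0 := by
      have : graphMap e a (w₀ + t • v) - graphMap e a w₀
          = t • (v : E d) + (a (w₀ + t • v : hyperplane e) - a w₀) • e := by
        simp only [graphMap, Submodule.coe_add, Submodule.coe_smul, sub_smul]
        abel
      rw [← map_smul, ← map_smul, ← map_add, ← this, map_sub]
      have := congrArg₂ (· - ·) e1 e2
      simpa using this
    set s : ℝ := a (w₀ + t • v : hyperplane e) - a w₀
    have e4 : matVec A v = (-(t⁻¹ * s)) • matVec A e := by
      have := congrArg (fun z => t⁻¹ • z) (eq_neg_of_add_eq_zero_left e3)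
      simpa [smul_smul, inv_mul_cancel₀ ht0'] using this
    refine ⟨-(t⁻¹ * s) + inner ℝ y e, ?_⟩
    have hy : y = (v : E d) + inner ℝ y e • e := by simp [v]
    conv_lhs => rw [hy]
    rw [map_add, map_smul, e4, add_smul]
  intro x
  have := hz w₀ hw₀V
  rw [hW] at this ⊢
  simpa using this

end RigidMotion

/-! ### The space `H¹` as a Hilbert space of limits of smooth fields -/

section Sobolev

variable {d : ℕ}

/-- Fields smooth up to the boundary, together with their gradients and boundary values. -/
def smoothFields (Ω : Set (E d)) : Set (PreH1 Ω) :=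
  {q | ∃ φ : E d → E d, ContDiff ℝ ∞ φ ∧ q.1 =ᵐ[volume.restrict Ω] φ ∧
    q.2.1 =ᵐ[volume.restrict Ω] gradField φ ∧ q.2.2 =ᵐ[surface Ω] φ}

theorem memLp_of_continuous_of_isBounded {F : Type*} [NormedAddCommGroup F] {Ω : Set (E d)}
    (hb : Bornology.IsBounded Ω) {f : E d → F} (hf : Continuous f) :
    MemLp f 2 (volume.restrict Ω) := by
  have hfin : IsFiniteMeasure (volume.restrict (closure Ω)) :=
    ⟨by rw [Measure.restrict_apply_univ]; exact hb.isCompact_closure.measure_lt_top⟩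
  obtain ⟨B, hB⟩ := hb.isCompact_closure.exists_bound_of_continuousOn hf.continuousOn
  have : MemLp f 2 (volume.restrict (closure Ω)) :=
    MemLp.of_bound hf.aestronglyMeasurable B
      ((ae_restrict_iff' isClosed_closure.measurableSet).2 (ae_of_all _ hB))
  exact this.mono_measure (Measure.restrict_mono_set _ subset_closure)

theorem memLp_surface_of_contDiff {Ω : Set (E d)} (hΩ : IsOpen Ω)
    (hb : Bornology.IsBounded Ω) (hL : HasLipschitzBoundary Ω) {φ : E d → E d}
    (hφ : ContDiff ℝ ∞ φ) : MemLp φ 2 (surface Ω) := by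
  obtain ⟨C, hC⟩ := trace_inequality hΩ hb hL
  refine ⟨hφ.continuous.aestronglyMeasurable, (hC φ hφ).trans_lt ?_⟩
  exact ENNReal.mul_lt_top ENNReal.coe_lt_top (ENNReal.add_lt_top.2
    ⟨(memLp_of_continuous_of_isBounded hb (continuous_gradField hφ)).2,
      (memLp_of_continuous_of_isBounded hb hφ.continuous).2⟩)

theorem isTrace_iff_mem_closure {Ω : Set (E d)} (hΩ : IsOpen Ω)
    (hb : Bornology.IsBounded Ω) (hL : HasLipschitzBoundary Ω) (p : PreH1 Ω) :
    IsTrace Ω p.1 p.2.1 p.2.2 ↔ p ∈ closure (smoothFields Ω) := by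
  rw [mem_closure_iff_seq_limit]
  constructor
  · rintro ⟨φ, hφ, t1, t2, t3⟩
    have m1 := fun n => memLp_of_continuous_of_isBounded hb (hφ n).continuous
    have m2 := fun n => memLp_of_continuous_of_isBounded hb (continuous_gradField (hφ n))
    have m3 := fun n => memLp_surface_of_contDiff hΩ hb hL (hφ n)
    refine ⟨fun n => ((m1 n).toLp _, (m2 n).toLp _, (m3 n).toLp _),
      fun n => ⟨φ n, hφ n, (m1 n).coeFn_toLp, (m2 n).coeFn_toLp, (m3 n).coeFn_toLp⟩, ?_⟩
    refine Prod.tendsto_iff _ _ |>.2 ⟨?_, Prod.tendsto_iff _ _ |>.2 ⟨?_, ?_⟩⟩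
    · refine Lp.tendsto_Lp_iff_tendsto_eLpNorm' _ _ |>.2 (t1.congr fun n => ?_)
      exact eLpNorm_congr_ae ((m1 n).coeFn_toLp.symm.sub EventuallyEq.rfl)
    · refine Lp.tendsto_Lp_iff_tendsto_eLpNorm' _ _ |>.2 (t2.congr fun n => ?_)
      exact eLpNorm_congr_ae ((m2 n).coeFn_toLp.symm.sub EventuallyEq.rfl)
    · refine Lp.tendsto_Lp_iff_tendsto_eLpNorm' _ _ |>.2 (t3.congr fun n => ?_)
      exact eLpNorm_congr_ae ((m3 n).coeFn_toLp.symm.sub EventuallyEq.rfl)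
  · rintro ⟨q, hq, hlim⟩
    choose φ hφ e1 e2 e3 using hq
    obtain ⟨t1, t2⟩ := Prod.tendsto_iff _ _ |>.1 hlim
    obtain ⟨t2, t3⟩ := Prod.tendsto_iff _ _ |>.1 t2
    refine ⟨φ, hφ, ?_, ?_, ?_⟩
    · refine (Lp.tendsto_Lp_iff_tendsto_eLpNorm' _ _ |>.1 t1).congr fun n => ?_
      exact eLpNorm_congr_ae ((e1 n).sub EventuallyEq.rfl)
    · refine (Lp.tendsto_Lp_iff_tendsto_eLpNorm' _ _ |>.1 t2).congr fun n => ?_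
      exact eLpNorm_congr_ae ((e2 n).sub EventuallyEq.rfl)
    · refine (Lp.tendsto_Lp_iff_tendsto_eLpNorm' _ _ |>.1 t3).congr fun n => ?_
      exact eLpNorm_congr_ae ((e3 n).sub EventuallyEq.rfl)

theorem IsWeakGradient.congr {Ω : Set (E d)} {u v : E d → E d} {G H : E d → Mat d}
    (h : IsWeakGradient Ω u G) (hu : v =ᵐ[volume.restrict Ω] u)
    (hG : H =ᵐ[volume.restrict Ω] G) : IsWeakGradient Ω v H :=
  h.smul 1 (by rwa [one_smul]) (by rwa [one_smul])

theorem continuous_integral_coord_mul {ι : Type*} [Fintype ι] [DecidableEq ι] {m : Measure (E d)}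
    {ψ : E d → ℝ} (hψ : MemLp ψ 2 m) (i : ι) :
    Continuous fun f : Lp (EuclideanSpace ℝ ι) 2 m => ∫ x, f x i * ψ x ∂m := by
  have hm : MemLp (fun x => ψ x • EuclideanSpace.single i (1 : ℝ)) 2 m := by
    have := ((ContinuousLinearMap.id ℝ ℝ).smulRight
      (EuclideanSpace.single i (1 : ℝ))).comp_memLp' hψ
    exact this
  have h : ∀ f : Lp (EuclideanSpace ℝ ι) 2 m,
      ∫ x, f x i * ψ x ∂m = innerSL ℝ (hm.toLp _) f := by
    intro f
    rw [innerSL_apply_apply, L2.inner_def]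
    refine integral_congr_ae ?_
    filter_upwards [hm.coeFn_toLp] with x hx
    rw [hx, inner_smul_left, EuclideanSpace.inner_single_left]
    simp [mul_comm]
  simp_rw [h]
  exact ContinuousLinearMap.continuous _

theorem isWeakGradient_of_mem_closure {Ω : Set (E d)} {p : PreH1 Ω}
    (hp : p ∈ closure (smoothFields Ω)) : IsWeakGradient Ω p.1 p.2.1 := by
  intro φ h1 h2 h3 i j
  have c1 := continuous_integral_coord_mul (memLp_testGrad (Ω := Ω) h1 h2 j) i
  have c2 := continuous_integral_coord_mul (memLp_two_of_continuous (Ω := Ω) h1.continuous h2)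
    (i, j)
  have hcl : IsClosed {p : PreH1 Ω | ∫ x in Ω, (p.1 x) i * fderiv ℝ φ x (basisVec j)
      = - ∫ x in Ω, p.2.1 x (i, j) * φ x} :=
    isClosed_eq (c1.comp continuous_fst) (c2.comp (continuous_fst.comp continuous_snd)).neg
  refine closure_minimal ?_ hcl hp
  rintro q ⟨ψ, hψ, e1, e2, -⟩
  exact (isWeakGradient_of_contDiff hψ).congr e1 e2 φ h1 h2 h3 i j

/-- A triple is an element of `H¹` as soon as it is a limit of smooth fields: the identity that defines
weak gradients passes to `L²` limits. -/
theorem mem_h1Submodule_iff {Ω : Set (E d)} (hΩ : IsOpen Ω)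
    (hb : Bornology.IsBounded Ω) (hL : HasLipschitzBoundary Ω) {p : PreH1 Ω} :
    p ∈ h1Submodule Ω ↔ p ∈ closure (smoothFields Ω) := by
  rw [← isTrace_iff_mem_closure hΩ hb hL]
  exact ⟨fun h => h.2, fun h =>
    ⟨isWeakGradient_of_mem_closure ((isTrace_iff_mem_closure hΩ hb hL p).1 h), h⟩⟩

theorem isClosed_h1Submodule {Ω : Set (E d)} (hΩ : IsOpen Ω)
    (hb : Bornology.IsBounded Ω) (hL : HasLipschitzBoundary Ω) :
    IsClosed (h1Submodule Ω : Set (PreH1 Ω)) := by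
  have : (h1Submodule Ω : Set (PreH1 Ω)) = closure (smoothFields Ω) :=
    Set.ext fun p => mem_h1Submodule_iff hΩ hb hL
  rw [this]
  exact isClosed_closure

/-- The symmetric part of a gradient field in `L²`, as a continuous operator. -/
noncomputable def strainLp (Ω : Set (E d)) :
    Lp (Mat d) 2 (volume.restrict Ω) →L[ℝ] Lp (Mat d) 2 (volume.restrict Ω) :=
  symPart.compLpL 2 _

theorem coeFn_strainLp {Ω : Set (E d)} (G : Lp (Mat d) 2 (volume.restrict Ω)) :
    strainLp Ω G =ᵐ[volume.restrict Ω] fun x => symPart (G x) :=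
  ContinuousLinearMap.coeFn_compLpL _ _

/-- The mean of an `L²` field against a weight, as a continuous operator. -/
noncomputable def momentLp {m : Measure (E d)} {w : E d → ℝ} (hw : MemLp w 2 m) :
    Lp (E d) 2 m →L[ℝ] E d :=
  ∑ i, (innerSL ℝ ((((ContinuousLinearMap.id ℝ ℝ).smulRight (basisVec i)).comp_memLp' hw).toLp
    _)).smulRight (basisVec i)

theorem momentLp_apply {m : Measure (E d)} {w : E d → ℝ} (hw : MemLp w 2 m) (f : Lp (E d) 2 m) :
    momentLp hw f = ∫ x, w x • f x ∂m := by
  have hint : Integrable (fun x => w x • f x) m :=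
    memLp_one_iff_integrable.1 ((Lp.memLp f).smul hw)
  ext i
  have h1 : (∫ x, w x • f x ∂m) i = ∫ x, w x * f x i ∂m :=
    ((EuclideanSpace.proj (𝕜 := ℝ) (ι := Fin d) i).integral_comp_comm hint).symm
  have h2 : ∀ i, innerSL ℝ ((((ContinuousLinearMap.id ℝ ℝ).smulRight
      (basisVec i)).comp_memLp' hw).toLp _) f = ∫ x, w x * f x i ∂m := by
    intro i
    rw [innerSL_apply_apply, L2.inner_def]
    refine integral_congr_ae ?_
    filter_upwards [(((ContinuousLinearMap.id ℝ ℝ).smulRight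
      (basisVec i)).comp_memLp' hw).coeFn_toLp] with x hx
    rw [hx]
    simp [basisVec, inner_smul_left, EuclideanSpace.inner_single_left]
  rw [h1, ← h2]
  simp [momentLp, basisVec, Finset.sum_apply, Pi.single_apply]

theorem enorm_Lp_eq {α F : Type*} [MeasurableSpace α] [NormedAddCommGroup F] {m : Measure α}
    {f : Lp F 2 m} {g : α → F} (h : f =ᵐ[m] g) : eLpNorm g 2 m = ‖f‖ₑ := by
  rw [Lp.enorm_def, eLpNorm_congr_ae h]

theorem norm_le_of_enorm_le {F G H : Type*} [NormedAddCommGroup F] [NormedAddCommGroup G]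
    [NormedAddCommGroup H] {a : F} {b : G} {c : H} {C : NNReal}
    (h : ‖a‖ₑ ≤ C * (‖b‖ₑ + ‖c‖ₑ)) : ‖a‖ ≤ C * (‖b‖ + ‖c‖) := by
  simp only [enorm_eq_nnnorm] at h
  norm_cast at h

/-- The elementary absorption of the small multiple of the full norm in Ehrling's inequality. -/
theorem absorb_estimates {N₀ N₁ N₂ S M T C₁ C₂ C₃ ε n : ℝ} (hS0 : 0 ≤ S) (hM0 : 0 ≤ M)
    (hC₁0 : 0 ≤ C₁) (hC₂0 : 0 ≤ C₂) (hC₃0 : 0 ≤ C₃) (hε0 : 0 ≤ ε) (hn : 0 ≤ n)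
    (k1 : N₁ ≤ C₁ * (S + N₀)) (k2 : N₂ ≤ C₂ * (N₁ + N₀)) (k3 : N₀ ≤ ε * (N₁ + N₀) + C₃ * T)
    (hT : T ≤ n * M) (hεr : ε * (C₁ + 1) = 1 / 2) :
    max N₀ (max N₁ N₂) ≤ (1 + 2 * C₃ * n + C₁ * (1 + (1 + 2 * C₃ * n))
      + C₂ * (1 + 2 * C₃ * n + C₁ * (1 + (1 + 2 * C₃ * n)))) * (S + M) := by
  set B : ℝ := 1 + 2 * C₃ * n with hB
  have hB1 : 1 ≤ B := by
    have : 0 ≤ C₃ * n := by positivity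
    rw [hB]; linarith
  have h0 : N₀ ≤ B * (S + M) := by
    have a1 : ε * (N₁ + N₀) ≤ ε * C₁ * S + 1 / 2 * N₀ := by
      calc ε * (N₁ + N₀) ≤ ε * (C₁ * (S + N₀) + N₀) := by gcongr
        _ = ε * C₁ * S + ε * (C₁ + 1) * N₀ := by ring
        _ = _ := by rw [hεr]
    have hε1 : ε * C₁ ≤ 1 / 2 := by linarith
    have a2 : ε * C₁ * S ≤ 1 / 2 * S := by gcongr
    have a3 : C₃ * T ≤ C₃ * (n * M) := by gcongr
    have a4 : 0 ≤ C₃ * n * S := by positivity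
    calc N₀ ≤ S + 2 * (C₃ * (n * M)) := by linarith
      _ ≤ S + 2 * (C₃ * (n * M)) + M + 2 * (C₃ * n * S) := by linarith
      _ = B * (S + M) := by rw [hB]; ring
  have h1 : N₁ ≤ C₁ * (1 + B) * (S + M) := by
    calc N₁ ≤ C₁ * (S + N₀) := k1
      _ ≤ C₁ * ((S + M) + B * (S + M)) := by gcongr; linarith
      _ = _ := by ring
  have h2 : N₂ ≤ C₂ * (B + C₁ * (1 + B)) * (S + M) := by
    calc N₂ ≤ C₂ * (N₁ + N₀) := k2
      _ ≤ C₂ * (C₁ * (1 + B) * (S + M) + B * (S + M)) := by gcongr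
      _ = _ := by ring
  have p0 : 0 ≤ B * (S + M) := by positivity
  have p1 : 0 ≤ C₁ * (1 + B) * (S + M) := by positivity
  have p2 : 0 ≤ C₂ * (B + C₁ * (1 + B)) * (S + M) := by positivity
  rw [add_mul, add_mul]
  exact max_le (by linarith) (max_le (by linarith) (by linarith))

/-- On `H¹`, the full norm is controlled by the strain and finitely many functionals: Korn's
inequality removes the skew part of the gradient, the trace inequality the boundary values, and
Ehrling's inequality the field itself. -/
theorem exists_norm_le_strain_add_moments (hd : 2 ≤ d) {Ω : Set (E d)} (hΩ : IsOpen Ω)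
    (hb : Bornology.IsBounded Ω) (hL : HasLipschitzBoundary Ω) :
    ∃ (ι : Type) (_ : Fintype ι) (L : Lp (E d) 2 (volume.restrict Ω) →L[ℝ] (ι → E d)) (C : ℝ),
      ∀ p ∈ h1Submodule Ω, ‖p‖ ≤ C * (‖strainLp Ω p.2.1‖ + ‖L p.1‖) := by
  obtain ⟨C₁, hC₁⟩ := korn_second hd hΩ hb hL
  obtain ⟨C₂, hC₂⟩ := trace_inequality hΩ hb hL
  -- with this choice the term `ε (‖∇u‖ + ‖u‖)` costs only half of `‖u‖`, after Korn's inequality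
  set ε : NNReal := 1 / (2 * (C₁ + 1)) with hε
  have hεpos : 0 < ε := by positivity
  obtain ⟨ι, hι, w, C₃, hw, hC₃⟩ := ehrling hd hΩ hb hL hεpos
  have hwm : ∀ z, MemLp (w z) 2 (volume.restrict Ω) := fun z =>
    memLp_two_of_continuous (hw z).1 (hw z).2
  let L : Lp (E d) 2 (volume.restrict Ω) →L[ℝ] (ι → E d) :=
    ContinuousLinearMap.pi fun z => momentLp (hwm z)
  set B : ℝ := 1 + 2 * C₃ * Fintype.card ι
  refine ⟨ι, hι, L, B + C₁ * (1 + B) + C₂ * (B + C₁ * (1 + B)), fun p hp => ?_⟩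
  have hcl : IsClosed {p : PreH1 Ω | ‖p‖ ≤ (B + C₁ * (1 + B) + C₂ * (B + C₁ * (1 + B)))
      * (‖strainLp Ω p.2.1‖ + ‖L p.1‖)} :=
    isClosed_le continuous_norm (by fun_prop)
  -- the estimate is closed in `p`, so it suffices to prove it for smooth fields
  refine closure_minimal ?_ hcl ((mem_h1Submodule_iff hΩ hb hL).1 hp)
  rintro q ⟨φ, hφ, e1, e2, e3⟩
  have eS : strainLp Ω q.2.1 =ᵐ[volume.restrict Ω] fun x => symPart (gradField φ x) := by
    filter_upwards [coeFn_strainLp q.2.1, e2] with x hx hx'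
    rw [hx, hx']
  have k1 := hC₁ φ hφ
  have k2 := hC₂ φ hφ
  have k3 := hC₃ φ hφ
  rw [enorm_Lp_eq e1, enorm_Lp_eq e2] at k1 k2 k3
  rw [enorm_Lp_eq eS] at k1
  rw [enorm_Lp_eq e3] at k2
  have k1 := norm_le_of_enorm_le k1
  have k2 := norm_le_of_enorm_le k2
  have hm : ∀ z, ∫ y in Ω, w z y • φ y = L q.1 z := fun z => by
    change _ = momentLp (hwm z) q.1
    rw [momentLp_apply]
    refine integral_congr_ae ?_
    filter_upwards [e1] with x hx
    rw [hx]
  have k3 : ‖q.1‖ ≤ ε * (‖q.2.1‖ + ‖q.1‖) + C₃ * ∑ z, ‖L q.1 z‖ := by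
    simp only [hm, enorm_eq_nnnorm] at k3
    norm_cast at k3
    have := NNReal.coe_le_coe.2 k3
    push_cast at this
    exact this
  have hsum : ∑ z, ‖L q.1 z‖ ≤ Fintype.card ι * ‖L q.1‖ := by
    refine (Finset.sum_le_card_nsmul _ _ _ fun z _ => norm_le_pi_norm (L q.1) z).trans
      (le_of_eq ?_)
    simp
  have hεr : (ε : ℝ) * (C₁ + 1) = 1 / 2 := by
    rw [hε]; push_cast; field_simp
  exact absorb_estimates (norm_nonneg _) (norm_nonneg _) C₁.2 C₂.2 C₃.2 ε.2 (Nat.cast_nonneg _)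
    k1 k2 k3 hsum hεr

/-- **Peetre's lemma**: an operator that is injective on a closed subspace and controls the norm up
to a finite-dimensional remainder is bounded below on that subspace. -/
theorem exists_norm_le_of_finite_remainder {X Y F : Type*} [NormedAddCommGroup X] [NormedSpace ℝ X]
    [CompleteSpace X] [NormedAddCommGroup Y] [NormedSpace ℝ Y] [NormedAddCommGroup F]
    [NormedSpace ℝ F] [FiniteDimensional ℝ F] (V : Submodule ℝ X) (hV : IsClosed (V : Set X))
    (S : X →L[ℝ] Y) (L : X →L[ℝ] F) (C : ℝ) (hC : ∀ x ∈ V, ‖x‖ ≤ C * (‖S x‖ + ‖L x‖))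
    (hinj : ∀ x ∈ V, S x = 0 → x = 0) : ∃ K, 0 < K ∧ ∀ x ∈ V, ‖x‖ ≤ K * ‖S x‖ := by
  by_contra! hcon
  have hn : ∀ n : ℕ, ∃ x ∈ V, ‖x‖ = 1 ∧ ‖S x‖ ≤ 1 / (n + 1) := by
    intro n
    obtain ⟨x, hx, hlt⟩ := hcon (n + 1) (by positivity)
    have hx0 : 0 < ‖x‖ := lt_of_le_of_lt (by positivity) hlt
    refine ⟨‖x‖⁻¹ • x, V.smul_mem _ hx, by rw [norm_smul, norm_inv, norm_norm,
      inv_mul_cancel₀ hx0.ne'], ?_⟩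
    rw [map_smul, norm_smul, norm_inv, norm_norm, inv_mul_le_iff₀ hx0, mul_one_div,
      le_div_iff₀ (by positivity)]
    linarith
  choose x hxV hx1 hxS using hn
  have hbdd : ∀ n, L (x n) ∈ Metric.closedBall (0 : F) ‖L‖ := fun n => by
    rw [mem_closedBall_zero_iff]
    simpa [hx1 n] using L.le_opNorm (x n)
  have : ProperSpace F := FiniteDimensional.proper ℝ F
  obtain ⟨l, -, φ, hφ, hl⟩ := (isCompact_closedBall (0 : F) ‖L‖).tendsto_subseq hbdd
  have hS0 : Tendsto (fun n => S (x (φ n))) atTop (𝓝 0) := by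
    have h0 : Tendsto (fun n => S (x n)) atTop (𝓝 0) :=
      squeeze_zero_norm hxS tendsto_one_div_add_atTop_nhds_zero_nat
    exact h0.comp hφ.tendsto_atTop
  have hcauchy : CauchySeq fun n => x (φ n) := by
    have h1 : Tendsto (fun p : ℕ × ℕ => C * (‖S (x (φ p.1)) - S (x (φ p.2))‖
        + ‖L (x (φ p.1)) - L (x (φ p.2))‖)) atTop (𝓝 0) := by
      have a1 := (cauchySeq_iff_tendsto_dist_atTop_0.1 hS0.cauchySeq)
      have a2 := (cauchySeq_iff_tendsto_dist_atTop_0.1 hl.cauchySeq)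
      simp only [dist_eq_norm] at a1 a2
      simpa using (a1.add a2).const_mul C
    rw [cauchySeq_iff_tendsto_dist_atTop_0]
    refine squeeze_zero (fun _ => dist_nonneg) (fun p => ?_) h1
    rw [dist_eq_norm, ← map_sub, ← map_sub]
    exact hC _ (V.sub_mem (hxV _) (hxV _))
  obtain ⟨y, hy⟩ := cauchySeq_tendsto_of_complete hcauchy
  have hyV : y ∈ V := hV.mem_of_tendsto hy (Eventually.of_forall fun n => hxV _)
  have hSy : S y = 0 := tendsto_nhds_unique ((S.continuous.tendsto y).comp hy) hS0
  have hy1 : ‖y‖ = 1 := by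
    refine tendsto_nhds_unique hy.norm ?_
    simp [hx1]
  rw [hinj y hyV hSy, norm_zero] at hy1
  exact zero_ne_one hy1

/-- The `H¹` fields whose trace vanishes on the part of the boundary that lies in `U`. -/
noncomputable def dirichletSubmodule (Ω U : Set (E d)) : Submodule ℝ (PreH1 Ω) :=
  h1Submodule Ω ⊓ LinearMap.ker (((LpToLpRestrictCLM (E d) (E d) ℝ (surface Ω) 2 U).comp
    ((ContinuousLinearMap.snd ℝ _ _).comp (ContinuousLinearMap.snd ℝ _ _))).toLinearMap)

theorem surface_restrict {Ω U : Set (E d)} (hU : IsOpen U) :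
    (surface Ω).restrict U
      = (Measure.euclideanHausdorffMeasure (d - 1)).restrict (U ∩ frontier Ω) :=
  Measure.restrict_restrict hU.measurableSet

theorem mem_dirichletSubmodule_iff {Ω U : Set (E d)} (hU : IsOpen U) {p : PreH1 Ω} :
    p ∈ dirichletSubmodule Ω U ↔ p ∈ h1Submodule Ω ∧
      ∀ᵐ x ∂((Measure.euclideanHausdorffMeasure (d - 1)).restrict (U ∩ frontier Ω)),
        p.2.2 x = 0 := by
  rw [← surface_restrict hU]
  refine and_congr_right fun _ => ?_
  have h := LpToLpRestrictCLM_coeFn (F := E d) (p := 2) ℝ U p.2.2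
  change LpToLpRestrictCLM (E d) (E d) ℝ (surface Ω) 2 U p.2.2 = 0 ↔ _
  rw [Lp.eq_zero_iff_ae_eq_zero]
  constructor
  · intro h0
    filter_upwards [h, h0] with x h1 h2
    rw [← h1, h2, Pi.zero_apply]
  · intro h0
    filter_upwards [h, h0] with x h1 h2
    rw [h1, h2, Pi.zero_apply]

theorem isClosed_dirichletSubmodule {Ω : Set (E d)} (hΩ : IsOpen Ω)
    (hb : Bornology.IsBounded Ω) (hL : HasLipschitzBoundary Ω) (U : Set (E d)) :
    IsClosed (dirichletSubmodule Ω U : Set (PreH1 Ω)) :=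
  (isClosed_h1Submodule hΩ hb hL).inter (ContinuousLinearMap.isClosed_ker _)

/-- **Korn's first inequality**: on the fields that vanish on a nonempty relatively open part of the
boundary, the strain controls the full norm. A field without strain is a rigid motion, and the
Dirichlet condition excludes it, so that Peetre's lemma applies. -/
theorem korn_first (hd : 2 ≤ d) {Ω : Set (E d)} (hΩ : IsOpen Ω) (hc : IsConnected Ω)
    (hb : Bornology.IsBounded Ω) (hL : HasLipschitzBoundary Ω) {U : Set (E d)} (hU : IsOpen U)
    (hne : (U ∩ frontier Ω).Nonempty) :
    ∃ K : ℝ, 0 < K ∧ ∀ p ∈ dirichletSubmodule Ω U, ‖p‖ ≤ K * ‖strainLp Ω p.2.1‖ := by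
  obtain ⟨ι, hι, L, C, hC⟩ := exists_norm_le_strain_add_moments hd hΩ hb hL
  refine exists_norm_le_of_finite_remainder (dirichletSubmodule Ω U)
    (isClosed_dirichletSubmodule hΩ hb hL U)
    ((strainLp Ω).comp ((ContinuousLinearMap.fst ℝ _ _).comp (ContinuousLinearMap.snd ℝ _ _)))
    (L.comp (ContinuousLinearMap.fst ℝ _ _)) C (fun p hp => hC p hp.1) fun p hp h0 => ?_
  obtain ⟨⟨hw, ht⟩, hz⟩ := (mem_dirichletSubmodule_iff hU).1 hp
  have hs : ∀ᵐ x ∂(volume.restrict Ω), symPart (p.2.1 x) = 0 := by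
    have h1 : strainLp Ω p.2.1 = 0 := h0
    filter_upwards [coeFn_strainLp p.2.1, (Lp.eq_zero_iff_ae_eq_zero).1 h1] with x hx hx'
    rw [← hx, hx', Pi.zero_apply]
  obtain ⟨A, b, hA, hGA, hu⟩ := exists_rigid_of_strain_zero hΩ hc hb (Lp.memLp _) (Lp.memLp _)
    hw hs
  have hsm : ContDiff ℝ ∞ fun y => matVec A y + b := (matVec A).contDiff.add contDiff_const
  have htr := ht.ae_eq_of_smooth hΩ hb hL (Lp.aestronglyMeasurable _) hsm hu (by
    filter_upwards [hGA] with x hx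
    rw [hx, gradField_affine])
  have hr : ∀ x, matVec A x + b = 0 := by
    refine rigid_eq_zero hΩ hL hU hne hA ?_
    have h1 := ae_mono (Measure.restrict_le_self (s := U)) htr
    rw [surface_restrict hU] at h1
    filter_upwards [h1, hz] with x hx hx'
    rw [← hx, hx']
  have hA0 : A = 0 := by
    have := gradField_affine A b 0
    rw [← this]
    have h0 : (fun y => matVec A y + b) = 0 := funext hr
    rw [h0]
    ext q
    simp [gradField]
  have z1 : p.1 = 0 := (Lp.eq_zero_iff_ae_eq_zero).2 (by
    filter_upwards [hu] with x hx
    rw [hx, hr, Pi.zero_apply])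
  have z2 : p.2.1 = 0 := (Lp.eq_zero_iff_ae_eq_zero).2 (by
    filter_upwards [hGA] with x hx
    rw [hx, hA0, Pi.zero_apply])
  have z3 : p.2.2 = 0 := (Lp.eq_zero_iff_ae_eq_zero).2 (by
    filter_upwards [htr] with x hx
    rw [hx, hr, Pi.zero_apply])
  exact Prod.ext z1 (Prod.ext z2 z3)

end Sobolev

/-! ### Minimization of uniformly convex functionals -/

section Minimization

/-- A uniformly convex continuous function plus a convex sequentially lower semicontinuous function
with values in `[0, ∞]` attains its infimum: minimizing sequences are Cauchy. -/
theorem exists_minimizer {V : Type*} [NormedAddCommGroup V] [NormedSpace ℝ V] [CompleteSpace V]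
    {F : V → ℝ} {G : V → ℝ≥0∞} (hF : Continuous F) {c M : ℝ} (hc : 0 < c)
    (hFc : ∀ u v, F ((1 / 2 : ℝ) • u + (1 / 2 : ℝ) • v) ≤ (F u + F v) / 2 - c * ‖u - v‖ ^ 2)
    (hM : ∀ v, M ≤ F v)
    (hGc : ∀ u v, G ((1 / 2 : ℝ) • u + (1 / 2 : ℝ) • v)
      ≤ ENNReal.ofReal (1 / 2) * G u + ENNReal.ofReal (1 / 2) * G v)
    (hG : ∀ (v : ℕ → V) (v₀ : V) (L : ℝ≥0∞), Tendsto v atTop (𝓝 v₀) →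
      Tendsto (fun n => G (v n)) atTop (𝓝 L) → G v₀ ≤ L)
    (hdom : ∃ v, G v ≠ ⊤) :
    ∃ u, G u ≠ ⊤ ∧ ∀ v, G v ≠ ⊤ → F u + (G u).toReal ≤ F v + (G v).toReal := by
  set J : V → ℝ := fun v => F v + (G v).toReal with hJ
  set m : ℝ := sInf (J '' {v | G v ≠ ⊤}) with hm
  have hne : (J '' {v | G v ≠ ⊤}).Nonempty := by
    obtain ⟨v, hv⟩ := hdom
    exact ⟨J v, v, hv, rfl⟩
  have hbdd : BddBelow (J '' {v | G v ≠ ⊤}) := by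
    refine ⟨M, ?_⟩
    rintro _ ⟨v, -, rfl⟩
    exact (hM v).trans (le_add_of_nonneg_right ENNReal.toReal_nonneg)
  have hle : ∀ v, G v ≠ ⊤ → m ≤ J v := fun v hv => csInf_le hbdd ⟨v, hv, rfl⟩
  have hseq : ∀ n : ℕ, ∃ v, G v ≠ ⊤ ∧ J v < m + 1 / (n + 1) := by
    intro n
    obtain ⟨_, ⟨v, hv, rfl⟩, hlt⟩ := exists_lt_of_csInf_lt hne
      (show m < m + 1 / ((n : ℝ) + 1) by have : 0 < 1 / ((n : ℝ) + 1) := by positivity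
                                         linarith)
    exact ⟨v, hv, hlt⟩
  choose v hvG hvJ using hseq
  have hJm : Tendsto (fun n => J (v n)) atTop (𝓝 m) := by
    have h1 : Tendsto (fun n : ℕ => m + 1 / ((n : ℝ) + 1)) atTop (𝓝 m) := by
      simpa using (tendsto_one_div_add_atTop_nhds_zero_nat (𝕜 := ℝ)).const_add m
    exact tendsto_of_tendsto_of_tendsto_of_le_of_le tendsto_const_nhds h1
      (fun n => hle _ (hvG n)) (fun n => (hvJ n).le)
  -- the midpoint is a competitor, so uniform convexity bounds the distance by the excess of `J`
  have hmid : ∀ i j, c * ‖v i - v j‖ ^ 2 ≤ (J (v i) + J (v j)) / 2 - m := by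
    intro i j
    have h1 := hGc (v i) (v j)
    have hfin : ENNReal.ofReal (1 / 2) * G (v i) + ENNReal.ofReal (1 / 2) * G (v j) ≠ ⊤ :=
      ENNReal.add_ne_top.2 ⟨ENNReal.mul_ne_top ENNReal.ofReal_ne_top (hvG i),
        ENNReal.mul_ne_top ENNReal.ofReal_ne_top (hvG j)⟩
    have h2 := hle _ (ne_top_of_le_ne_top hfin h1)
    have h3 := ENNReal.toReal_mono hfin h1
    rw [ENNReal.toReal_add (ENNReal.mul_ne_top ENNReal.ofReal_ne_top (hvG i))
      (ENNReal.mul_ne_top ENNReal.ofReal_ne_top (hvG j)), ENNReal.toReal_mul, ENNReal.toReal_mul,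
      ENNReal.toReal_ofReal (by norm_num)] at h3
    have h4 := hFc (v i) (v j)
    simp only [hJ] at h2 ⊢
    linarith
  have hcauchy : CauchySeq v := by
    rw [cauchySeq_iff_tendsto_dist_atTop_0]
    have h1 : Tendsto (fun p : ℕ × ℕ => ((J (v p.1) + J (v p.2)) / 2 - m) / c) atTop (𝓝 0) := by
      have a1 := hJm.comp (tendsto_fst (f := (atTop : Filter ℕ)) (g := (atTop : Filter ℕ)))
      have a2 := hJm.comp (tendsto_snd (f := (atTop : Filter ℕ)) (g := (atTop : Filter ℕ)))
      rw [prod_atTop_atTop_eq] at a1 a2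
      have := ((a1.add a2).div_const 2).sub_const m |>.div_const c
      simpa using this
    have h2 := h1.sqrt
    rw [Real.sqrt_zero] at h2
    refine squeeze_zero (fun _ => dist_nonneg) (fun p => ?_) h2
    rw [dist_eq_norm]
    refine Real.le_sqrt_of_sq_le ?_
    rw [le_div_iff₀ hc, mul_comm]
    exact hmid _ _
  obtain ⟨u, hu⟩ := cauchySeq_tendsto_of_complete hcauchy
  have hGr : Tendsto (fun n => (G (v n)).toReal) atTop (𝓝 (m - F u)) := by
    have := hJm.sub ((hF.tendsto u).comp hu)
    refine this.congr fun n => ?_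
    simp [hJ]
  have hGu : G u ≤ ENNReal.ofReal (m - F u) := by
    refine hG v u _ hu (((ENNReal.continuous_ofReal.tendsto _).comp hGr).congr fun n => ?_)
    exact ENNReal.ofReal_toReal (hvG n)
  have h0 : 0 ≤ m - F u := ge_of_tendsto' hGr fun n => ENNReal.toReal_nonneg
  refine ⟨u, ne_top_of_le_ne_top ENNReal.ofReal_ne_top hGu, fun w hw => ?_⟩
  have h1 := ENNReal.toReal_le_of_le_ofReal h0 hGu
  have h2 := hle w hw
  simp only [hJ] at h2
  linarith

end Minimization

/-! ### The quadratic forms of the moduli -/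

section Forms

variable {d : ℕ}

/-- The moduli tensor as an operator on matrices. -/
noncomputable def ModuliTensor.toCLM (C : ModuliTensor d) : Mat d →L[ℝ] Mat d :=
  LinearMap.toContinuousLinearMap
    { toFun := fun A => WithLp.toLp 2 fun p => ∑ k, ∑ l, C.coeff p.1 p.2 k l * A (k, l)
      map_add' := fun A B => by
        ext p
        simp [mul_add, Finset.sum_add_distrib]
      map_smul' := fun c A => by
        ext p
        simp only [PiLp.smul_apply, smul_eq_mul, RingHom.id_apply, Finset.mul_sum]
        exact Finset.sum_congr rfl fun k _ => Finset.sum_congr rfl fun l _ => by ring }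

theorem ModuliTensor.inner_toCLM (C : ModuliTensor d) (A B : Mat d) :
    inner ℝ (C.toCLM A) B = ddot (C.app fun i j => A (i, j)) fun i j => B (i, j) := by
  rw [PiLp.inner_apply, Fintype.sum_prod_type]
  unfold ddot
  refine Finset.sum_congr rfl fun i _ => Finset.sum_congr rfl fun j _ => ?_
  simp [ModuliTensor.toCLM, ModuliTensor.app, mul_comm]

theorem ModuliTensor.inner_toCLM_comm (C : ModuliTensor d) (A B : Mat d) :
    inner ℝ (C.toCLM A) B = inner ℝ (C.toCLM B) A := by
  have h : ∀ A B : Mat d, inner ℝ (C.toCLM A) B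
      = ∑ p : Fin d × Fin d, ∑ q : Fin d × Fin d,
        C.coeff p.1 p.2 q.1 q.2 * A q * B p := by
    intro A B
    rw [C.inner_toCLM, Fintype.sum_prod_type]
    unfold ddot
    refine Finset.sum_congr rfl fun i _ => Finset.sum_congr rfl fun j _ => ?_
    unfold ModuliTensor.app
    rw [Finset.sum_mul, Fintype.sum_prod_type]
    exact Finset.sum_congr rfl fun k _ => Finset.sum_mul _ _ _
  rw [h, h, Finset.sum_comm]
  refine Finset.sum_congr rfl fun p _ => Finset.sum_congr rfl fun q _ => ?_
  rw [C.major_symm]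
  ring

/-- Positive definiteness is uniform, by compactness of the unit sphere of symmetric matrices. -/
theorem ModuliTensor.exists_le_inner (C : ModuliTensor d) :
    ∃ c : ℝ, 0 < c ∧ ∀ A : Mat d, c * ‖symPart A‖ ^ 2 ≤ inner ℝ (C.toCLM (symPart A)) (symPart A) := by
  have hidem : ∀ A : Mat d, symPart (symPart A) = symPart A := fun A => by
    ext ⟨i, j⟩
    simp only [symPart_apply]
    ring
  have hpos : ∀ A : Mat d, symPart A = A → A ≠ 0 → 0 < inner ℝ (C.toCLM A) A := by
    intro A hA h0
    have hs : ∀ i j, A (i, j) = A (j, i) := fun i j => by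
      have := congrArg (fun M : Mat d => M (i, j)) hA
      simp only [symPart_apply] at this
      linarith
    have := C.posDef (fun i j => A (i, j)) (Matrix.IsSymm.ext fun i j => hs j i) (fun h => h0 (by
      ext p
      exact congrFun (congrFun h p.1) p.2))
    refine this.trans_le (le_of_eq ?_)
    rw [C.inner_toCLM]
    unfold ddot
    refine Finset.sum_congr rfl fun i _ => Finset.sum_congr rfl fun j _ => ?_
    unfold ModuliTensor.app
    rw [Finset.sum_mul]
    refine Finset.sum_congr rfl fun k _ => ?_
    rw [Finset.sum_mul]
    exact Finset.sum_congr rfl fun l _ => by ring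
  let S : Set (Mat d) := Metric.sphere 0 1 ∩ {A | symPart A = A}
  have hS : IsCompact S := (isCompact_sphere 0 1).inter_right
    (isClosed_eq symPart.continuous continuous_id)
  have hcont : Continuous fun A : Mat d => (inner ℝ (C.toCLM A) A : ℝ) := by fun_prop
  obtain ⟨c, hc, hcS⟩ : ∃ c : ℝ, 0 < c ∧ ∀ A ∈ S, c ≤ inner ℝ (C.toCLM A) A := by
    rcases S.eq_empty_or_nonempty with h | h
    · exact ⟨1, one_pos, fun A hA => by simp [h] at hA⟩
    · obtain ⟨A₀, hA₀, hmin⟩ := hS.exists_isMinOn h hcont.continuousOn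
      refine ⟨_, hpos A₀ hA₀.2 ?_, fun A hA => hmin hA⟩
      rintro rfl
      simpa using hA₀.1
  refine ⟨c, hc, fun A => ?_⟩
  set B := symPart A with hB
  by_cases h0 : B = 0
  · simp [h0]
  have hn : ‖B‖ ≠ 0 := norm_ne_zero_iff.2 h0
  have := hcS (‖B‖⁻¹ • B) ⟨by simp [norm_smul, hn], by
    change symPart (‖B‖⁻¹ • B) = _
    rw [map_smul, hB, hidem]⟩
  rw [map_smul, inner_smul_left, inner_smul_right] at this
  simp only [conj_trivial] at this
  have h2 : ‖B‖⁻¹ * (‖B‖⁻¹ * inner ℝ (C.toCLM B) B) * ‖B‖ ^ 2 = inner ℝ (C.toCLM B) B := by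
    field_simp
  rw [← h2]
  gcongr

/-- The bilinear form `∫ e(u) : C : e(v)` on gradients in `L²`. -/
noncomputable def gradForm (Ω : Set (E d)) (C : ModuliTensor d)
    (G H : Lp (Mat d) 2 (volume.restrict Ω)) : ℝ :=
  inner ℝ (C.toCLM.compLpL 2 (volume.restrict Ω) (strainLp Ω G)) (strainLp Ω H)

theorem gradForm_eq_integral {Ω : Set (E d)} (C : ModuliTensor d)
    (G H : Lp (Mat d) 2 (volume.restrict Ω)) :
    gradForm Ω C G H = ∫ x in Ω, inner ℝ (C.toCLM (symPart (G x))) (symPart (H x)) := by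
  rw [gradForm, L2.inner_def]
  refine integral_congr_ae ?_
  filter_upwards [coeFn_strainLp G, coeFn_strainLp H,
    ContinuousLinearMap.coeFn_compLpL (p := 2) (μ := volume.restrict Ω) C.toCLM (strainLp Ω G)]
    with x h1 h2 h3
  rw [h3, h1, h2]

theorem gradForm_comm {Ω : Set (E d)} (C : ModuliTensor d)
    (G H : Lp (Mat d) 2 (volume.restrict Ω)) : gradForm Ω C G H = gradForm Ω C H G := by
  rw [gradForm_eq_integral, gradForm_eq_integral]
  simp_rw [C.inner_toCLM_comm (symPart (G _))]

theorem exists_le_gradForm (C : ModuliTensor d) : ∃ c : ℝ, 0 < c ∧ ∀ (Ω : Set (E d))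
    (G : Lp (Mat d) 2 (volume.restrict Ω)), c * ‖strainLp Ω G‖ ^ 2 ≤ gradForm Ω C G G := by
  obtain ⟨c, hc, h⟩ := C.exists_le_inner
  refine ⟨c, hc, fun Ω G => ?_⟩
  have i1 : Integrable (fun x => ‖strainLp Ω G x‖ ^ 2) (volume.restrict Ω) :=
    (memLp_two_iff_integrable_sq_norm (Lp.aestronglyMeasurable _)).1 (Lp.memLp _)
  have i2 := L2.integrable_inner (𝕜 := ℝ) (C.toCLM.compLpL 2 (volume.restrict Ω) (strainLp Ω G))
    (strainLp Ω G)
  have e1 : ‖strainLp Ω G‖ ^ 2 = ∫ x in Ω, ‖strainLp Ω G x‖ ^ 2 := by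
    rw [← real_inner_self_eq_norm_sq, L2.inner_def]
    simp_rw [real_inner_self_eq_norm_sq]
  rw [e1, gradForm, L2.inner_def, ← integral_const_mul]
  refine integral_mono_ae (i1.const_mul c) i2 ?_
  filter_upwards [coeFn_strainLp G,
    ContinuousLinearMap.coeFn_compLpL (p := 2) (μ := volume.restrict Ω) C.toCLM (strainLp Ω G)]
    with x h1 h3
  rw [h3, h1]
  exact h _

end Forms

/-! ### The functionals of the contact problem -/

section Functionals

variable {d : ℕ}

/-- The normed space of pairs of triples (field, gradient, trace), one for each body. -/
def Geometry.State (P : Geometry d) : Type := (η : Body) → PreH1 (P.Ω η)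

noncomputable instance (P : Geometry d) : NormedAddCommGroup P.State :=
  inferInstanceAs (NormedAddCommGroup ((η : Body) → PreH1 (P.Ω η)))

noncomputable instance (P : Geometry d) : NormedSpace ℝ P.State :=
  inferInstanceAs (NormedSpace ℝ ((η : Body) → PreH1 (P.Ω η)))

instance (P : Geometry d) : CompleteSpace P.State :=
  inferInstanceAs (CompleteSpace ((η : Body) → PreH1 (P.Ω η)))

/-- The triple of one body. -/
noncomputable def Geometry.proj (P : Geometry d) (η : Body) : P.State →L[ℝ] PreH1 (P.Ω η) :=
  ContinuousLinearMap.proj (R := ℝ) (φ := fun η => PreH1 (P.Ω η)) η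

theorem Geometry.proj_apply (P : Geometry d) (η : Body) (x : P.State) : P.proj η x = x η := rfl

theorem Geometry.state_norm_le_iff (P : Geometry d) {x : P.State} {r : ℝ} (hr : 0 ≤ r) :
    ‖x‖ ≤ r ↔ ∀ η, ‖x η‖ ≤ r :=
  pi_norm_le_iff_of_nonneg (G := fun η => PreH1 (P.Ω η)) hr

/-- The displacements as elements of the normed space of triples. -/
def Geometry.toState (P : Geometry d) : P.Disp →ₗ[ℝ] P.State where
  toFun u η := (u η).1
  map_add' _ _ := rfl
  map_smul' _ _ := rfl

theorem Geometry.toState_injective (P : Geometry d) : Function.Injective P.toState :=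
  fun _ _ h => funext fun η => Subtype.ext (congrFun h η)

/-- The bilinear form `∑ η, ∫ e(x) : C : e(y)`. -/
noncomputable def Geometry.form (P : Geometry d) (C : Body → ModuliTensor d) :
    P.State →ₗ[ℝ] P.State →ₗ[ℝ] ℝ :=
  LinearMap.mk₂ ℝ (fun x y => ∑ η, gradForm (P.Ω η) (C η) (P.proj η x).2.1 (P.proj η y).2.1)
    (fun x y z => by simp [gradForm, inner_add_left, Finset.sum_add_distrib])
    (fun c x y => by simp [gradForm, inner_smul_left, Finset.mul_sum])
    (fun x y z => by simp [gradForm, inner_add_right, Finset.sum_add_distrib])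
    (fun c x y => by simp [gradForm, inner_smul_right, Finset.mul_sum])

theorem Geometry.form_apply (P : Geometry d) (C : Body → ModuliTensor d) (x y : P.State) :
    P.form C x y = ∑ η, gradForm (P.Ω η) (C η) (x η).2.1 (y η).2.1 := rfl

theorem Geometry.form_comm (P : Geometry d) (C : Body → ModuliTensor d) (x y : P.State) :
    P.form C x y = P.form C y x := by
  rw [P.form_apply, P.form_apply]
  exact Finset.sum_congr rfl fun η _ => gradForm_comm _ _ _

theorem Geometry.continuous_form (P : Geometry d) (C : Body → ModuliTensor d)
    {α : Type*} [TopologicalSpace α] {f g : α → P.State} (hf : Continuous f) (hg : Continuous g) :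
    Continuous fun a => P.form C (f a) (g a) := by
  simp only [P.form_apply, gradForm, ← P.proj_apply]
  fun_prop

theorem Geometry.form_self_nonneg (P : Geometry d) (C : Body → ModuliTensor d) (x : P.State) :
    0 ≤ P.form C x x := by
  rw [P.form_apply]
  refine Finset.sum_nonneg fun η _ => ?_
  obtain ⟨c, hc, h⟩ := exists_le_gradForm (C η)
  exact le_trans (by positivity) (h (P.Ω η) (x η).2.1)

theorem Geometry.form_toState (P : Geometry d) (C : Body → ModuliTensor d) (u v : P.Disp) :
    P.form C (P.toState u) (P.toState v)
      = ∑ η, ∫ x in P.Ω η, ddot ((C η).app ((u η).strain x)) ((v η).strain x) := by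
  rw [P.form_apply]
  refine Finset.sum_congr rfl fun η _ => ?_
  rw [gradForm_eq_integral]
  refine integral_congr_ae (ae_of_all _ fun x => ?_)
  simp only [ModuliTensor.inner_toCLM, symPart_apply]
  rfl

theorem quad_eq_form {P : Geometry d} (C : Body → ModuliTensor d) (u : P.Disp) :
    quad C u = 1 / 2 * P.form C (P.toState u) (P.toState u) := by
  rw [P.form_toState, quad, Finset.mul_sum]
  exact Finset.sum_congr rfl fun η _ => integral_const_mul _ _

theorem integrable_ddot_strain {Ω : Set (E d)} (C : ModuliTensor d) (u v : H1 Ω) :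
    Integrable (fun x => ddot (C.app (u.strain x)) (v.strain x)) (volume.restrict Ω) := by
  have h := L2.integrable_inner (𝕜 := ℝ)
    (C.toCLM.compLpL 2 (volume.restrict Ω) (strainLp Ω u.1.2.1)) (strainLp Ω v.1.2.1)
  refine h.congr ?_
  filter_upwards [coeFn_strainLp u.1.2.1, coeFn_strainLp v.1.2.1,
    ContinuousLinearMap.coeFn_compLpL (p := 2) (μ := volume.restrict Ω) C.toCLM
      (strainLp Ω u.1.2.1)] with x h1 h2 h3
  rw [h3, h1, h2]
  simp only [ModuliTensor.inner_toCLM, symPart_apply]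
  rfl

theorem ddot_add_left (A B D : Matrix (Fin d) (Fin d) ℝ) : ddot (A + B) D = ddot A D + ddot B D := by
  simp [ddot, add_mul, Finset.sum_add_distrib]

theorem dirichletWork_eq_form {P : Geometry d} (C D : Body → ModuliTensor d) (τ : ℝ)
    (w u δ : P.Disp) :
    dirichletWork C D τ w u δ = P.form C (P.toState w) (P.toState δ)
      + τ⁻¹ * P.form D (P.toState (u - w)) (P.toState δ)
      + 1 / 2 * P.form C (P.toState δ) (P.toState δ) := by
  have h1 : τ⁻¹ * P.form D (P.toState (u - w)) (P.toState δ)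
      = P.form D (P.toState (τ⁻¹ • (u - w))) (P.toState δ) := by
    rw [map_smul, map_smul, LinearMap.smul_apply, smul_eq_mul]
  suffices h2 : P.form C (P.toState w) (P.toState δ) + P.form D (P.toState (τ⁻¹ • (u - w)))
      (P.toState δ) = ∑ η, ∫ x in P.Ω η, ddot ((C η).app ((w η).strain x)
        + (D η).app ((τ⁻¹ • (u η - w η)).strain x)) ((δ η).strain x) by
    rw [h1, h2, P.form_toState, dirichletWork, Finset.mul_sum]
  rw [P.form_toState, P.form_toState, ← Finset.sum_add_distrib]
  refine Finset.sum_congr rfl fun η _ => ?_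
  have i1 := integrable_ddot_strain (C η) (w η) (δ η)
  have i2 := integrable_ddot_strain (D η) ((τ⁻¹ • (u - w)) η) (δ η)
  rw [← integral_add i1 i2]
  refine integral_congr_ae (ae_of_all _ fun x => ?_)
  exact (ddot_add_left _ _ _).symm

theorem Geometry.measurableSet_ΓN (P : Geometry d) (η : Body) : MeasurableSet (P.ΓN η) := by
  obtain ⟨U, hU, h⟩ := P.ΓN_open η
  rw [h]
  exact hU.measurableSet.inter isClosed_frontier.measurableSet

theorem Geometry.surface_restrict_ΓN (P : Geometry d) (η : Body) :
    (surface (P.Ω η)).restrict (P.ΓN η) = P.σN η := by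
  rw [surface, Measure.restrict_restrict (P.measurableSet_ΓN η), Geometry.σN]
  congr 1
  obtain ⟨U, hU, h⟩ := P.ΓN_open η
  rw [h, inter_assoc, inter_self]

theorem Geometry.memLp_indicator_load (P : Geometry d) (f : P.NeumannData) (η : Body) :
    MemLp ((P.ΓN η).indicator (f η : E d → E d)) 2 (surface (P.Ω η)) := by
  rw [memLp_indicator_iff_restrict (P.measurableSet_ΓN η), P.surface_restrict_ΓN]
  exact Lp.memLp _

/-- The load as a bounded functional of the triples. -/
noncomputable def Geometry.loadCLM (P : Geometry d) (f : P.NeumannData) : P.State →L[ℝ] ℝ :=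
  ∑ η, (innerSL ℝ ((P.memLp_indicator_load f η).toLp _)).comp
    (((ContinuousLinearMap.snd ℝ _ _).comp (ContinuousLinearMap.snd ℝ _ _)).comp
      (P.proj η))

theorem load_eq_loadCLM {P : Geometry d} (f : P.NeumannData) (u : P.Disp) :
    load f u = P.loadCLM f (P.toState u) := by
  rw [load, Geometry.loadCLM, sum_apply]
  refine Finset.sum_congr rfl fun η _ => ?_
  change _ = inner ℝ ((P.memLp_indicator_load f η).toLp _) (u η).1.2.2
  have hσ : ∀ h t : E d → E d, ∫ x, inner ℝ (h x) (t x) ∂(P.σN η)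
      = ∫ x, (P.ΓN η).indicator (fun x => (inner ℝ (h x) (t x) : ℝ)) x ∂(surface (P.Ω η)) := by
    intro h t
    rw [integral_indicator (P.measurableSet_ΓN η), P.surface_restrict_ΓN]
  rw [L2.inner_def, hσ]
  refine integral_congr_ae ?_
  filter_upwards [(P.memLp_indicator_load f η).coeFn_toLp] with x hx
  rw [hx]
  by_cases h : x ∈ P.ΓN η
  · rw [indicator_of_mem h, indicator_of_mem h]
    rfl
  · rw [indicator_of_notMem h, indicator_of_notMem h, inner_zero_left]

/-! ### The contact energy and the frictional potential -/

theorem Geometry.σC_le (P : Geometry d) (η : Body) : P.σC ≤ surface (P.Ω η) := by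
  refine Measure.restrict_mono_set _ ?_
  cases η
  · exact inter_subset_left
  · exact inter_subset_right

theorem Geometry.aestronglyMeasurable_trace (P : Geometry d) (u : P.Disp) (η : Body) :
    AEStronglyMeasurable (u η).trace P.σC :=
  (Lp.aestronglyMeasurable (u η).1.2.2).mono_measure (P.σC_le η)

theorem aestronglyMeasurable_gap {P : Geometry d} (u : P.Disp) :
    AEStronglyMeasurable (gap u) P.σC :=
  (P.aestronglyMeasurable_trace u _).sub (P.aestronglyMeasurable_trace u _)

theorem aestronglyMeasurable_gapN {P : Geometry d} (u : P.Disp) :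
    AEStronglyMeasurable (gapN u) P.σC :=
  (aestronglyMeasurable_gap u).inner P.measurable_nB.aestronglyMeasurable

theorem aestronglyMeasurable_gapT {P : Geometry d} (u : P.Disp) :
    AEStronglyMeasurable (gapT u) P.σC :=
  (aestronglyMeasurable_gap u).sub
    ((aestronglyMeasurable_gapN u).smul P.measurable_nB.aestronglyMeasurable)

theorem ae_trace_comb {P : Geometry d} (a b : ℝ) (u v : P.Disp) (η : Body) :
    ∀ᵐ x ∂(surface (P.Ω η)), ((a • u + b • v) η).trace x
      = a • (u η).trace x + b • (v η).trace x := by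
  have h1 := Lp.coeFn_add (a • (u η).1.2.2) (b • (v η).1.2.2)
  have h2 := Lp.coeFn_smul a (u η).1.2.2
  have h3 := Lp.coeFn_smul b (v η).1.2.2
  filter_upwards [h1, h2, h3] with x h1 h2 h3
  change (a • (u η).1.2.2 + b • (v η).1.2.2 : Lp (E d) 2 (surface (P.Ω η))) x = _
  rw [h1, Pi.add_apply, h2, h3]
  rfl

theorem ae_gap_comb {P : Geometry d} (a b : ℝ) (u v : P.Disp) :
    ∀ᵐ x ∂P.σC, gap (a • u + b • v) x = a • gap u x + b • gap v x := by
  filter_upwards [ae_mono (P.σC_le Body.A) (ae_trace_comb a b u v Body.A),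
    ae_mono (P.σC_le Body.B) (ae_trace_comb a b u v Body.B)] with x hA hB
  rw [gap, hA, hB, gap, gap]
  module

theorem ae_gapN_comb {P : Geometry d} (a b : ℝ) (u v : P.Disp) :
    ∀ᵐ x ∂P.σC, gapN (a • u + b • v) x = a * gapN u x + b * gapN v x := by
  filter_upwards [ae_gap_comb a b u v] with x hx
  rw [gapN, hx, inner_add_left, inner_smul_left, inner_smul_left]
  rfl

theorem ae_gapT_comb {P : Geometry d} (a b : ℝ) (u v : P.Disp) :
    ∀ᵐ x ∂P.σC, gapT (a • u + b • v) x = a • gapT u x + b • gapT v x := by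
  filter_upwards [ae_gap_comb a b u v, ae_gapN_comb a b u v] with x hx hx'
  rw [gapT, hx, hx', gapT, gapT]
  module

theorem lintegral_le_of_convex {α : Type*} [MeasurableSpace α] {m : Measure α} {f g h : α → ℝ≥0∞}
    {a b : ℝ} (hg : AEMeasurable g m)
    (hle : ∀ᵐ x ∂m, f x ≤ ENNReal.ofReal a * g x + ENNReal.ofReal b * h x) :
    ∫⁻ x, f x ∂m ≤ ENNReal.ofReal a * ∫⁻ x, g x ∂m + ENNReal.ofReal b * ∫⁻ x, h x ∂m := by
  refine (lintegral_mono_ae hle).trans (le_of_eq ?_)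
  rw [lintegral_add_left' (hg.const_mul _), lintegral_const_mul' _ _ ENNReal.ofReal_ne_top,
    lintegral_const_mul' _ _ ENNReal.ofReal_ne_top]

/-- The contact energy, with values in `[0, ∞]`. -/
noncomputable def contactEnergy {P : Geometry d} (γ : ℝ → ℝ) (u : P.Disp) : ℝ≥0∞ :=
  ∫⁻ x, ENNReal.ofReal (γ (gapN u x)) ∂P.σC

/-- The frictional potential, with values in `[0, ∞]`. -/
noncomputable def friction {P : Geometry d} (γ : ℝ → ℝ) (μ : ℝ) (w v : P.Disp) : ℝ≥0∞ :=
  ∫⁻ x, ENNReal.ofReal (-μ * deriv γ (gapN w x) * ‖gapT v x‖) ∂P.σC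

theorem R1_eq_friction {P : Geometry d} (γ : ℝ → ℝ) (μ : ℝ) (w v : P.Disp) :
    R1 γ μ w v = ((friction γ μ w v : ℝ≥0∞) : EReal) := rfl

theorem energyC_eq_contactEnergy {P : Geometry d} (γ : ℝ → ℝ) (u : P.Disp) :
    energyC γ u = ((contactEnergy γ u : ℝ≥0∞) : EReal) := rfl

theorem aemeasurable_contactEnergy {P : Geometry d} {γ : ℝ → ℝ} (hγ : Continuous γ) (u : P.Disp) :
    AEMeasurable (fun x => ENNReal.ofReal (γ (gapN u x))) P.σC :=
  (hγ.comp_aestronglyMeasurable (aestronglyMeasurable_gapN u)).aemeasurable.ennreal_ofReal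

theorem aemeasurable_friction {P : Geometry d} {γ : ℝ → ℝ} (hγ : Continuous (deriv γ)) (μ : ℝ)
    (w v : P.Disp) :
    AEMeasurable (fun x => ENNReal.ofReal (-μ * deriv γ (gapN w x) * ‖gapT v x‖)) P.σC :=
  (((hγ.comp_aestronglyMeasurable (aestronglyMeasurable_gapN w)).const_mul (-μ)).mul
    (aestronglyMeasurable_gapT v).norm).aemeasurable.ennreal_ofReal

theorem contactEnergy_comb_le {P : Geometry d} {γ : ℝ → ℝ} (hγ0 : ∀ r, 0 ≤ γ r)
    (hγc : ConvexOn ℝ univ γ) (hγ : Continuous γ) {a b : ℝ} (ha : 0 ≤ a) (hb : 0 ≤ b)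
    (hab : a + b = 1) (u v : P.Disp) :
    contactEnergy γ (a • u + b • v)
      ≤ ENNReal.ofReal a * contactEnergy γ u + ENNReal.ofReal b * contactEnergy γ v := by
  refine lintegral_le_of_convex (aemeasurable_contactEnergy hγ u) ?_
  filter_upwards [ae_gapN_comb a b u v] with x hx
  rw [hx, ← ENNReal.ofReal_mul ha, ← ENNReal.ofReal_mul hb,
    ← ENNReal.ofReal_add (mul_nonneg ha (hγ0 _)) (mul_nonneg hb (hγ0 _))]
  exact ENNReal.ofReal_le_ofReal (hγc.2 (mem_univ _) (mem_univ _) ha hb hab)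

theorem friction_comb_le {P : Geometry d} {γ : ℝ → ℝ} (hγ' : ∀ r, deriv γ r ≤ 0)
    (hγ : Continuous (deriv γ)) {μ : ℝ} (hμ : 0 ≤ μ) {a b : ℝ} (ha : 0 ≤ a) (hb : 0 ≤ b)
    (w u v : P.Disp) :
    friction γ μ w (a • u + b • v)
      ≤ ENNReal.ofReal a * friction γ μ w u + ENNReal.ofReal b * friction γ μ w v := by
  refine lintegral_le_of_convex (aemeasurable_friction hγ μ w u) ?_
  filter_upwards [ae_gapT_comb a b u v] with x hx
  have hc : 0 ≤ -μ * deriv γ (gapN w x) := by nlinarith [hγ' (gapN w x)]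
  rw [hx, ← ENNReal.ofReal_mul ha, ← ENNReal.ofReal_mul hb,
    ← ENNReal.ofReal_add (by positivity) (by positivity)]
  refine ENNReal.ofReal_le_ofReal ?_
  have h1 : ‖a • gapT u x + b • gapT v x‖ ≤ a * ‖gapT u x‖ + b * ‖gapT v x‖ := by
    refine (norm_add_le _ _).trans (le_of_eq ?_)
    rw [norm_smul, norm_smul, Real.norm_of_nonneg ha, Real.norm_of_nonneg hb]
  calc _ ≤ -μ * deriv γ (gapN w x) * (a * ‖gapT u x‖ + b * ‖gapT v x‖) := by gcongr
    _ = _ := by ring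

theorem friction_smul {P : Geometry d} (γ : ℝ → ℝ) (μ : ℝ) {a : ℝ} (ha : 0 ≤ a) (w v : P.Disp) :
    friction γ μ w (a • v) = ENNReal.ofReal a * friction γ μ w v := by
  rw [friction, friction, ← lintegral_const_mul' _ _ ENNReal.ofReal_ne_top]
  refine lintegral_congr_ae ?_
  filter_upwards [ae_gapT_comb a 0 v v] with x hx
  rw [zero_smul, zero_smul, add_zero, add_zero] at hx
  rw [hx, norm_smul, Real.norm_of_nonneg ha, ← ENNReal.ofReal_mul ha]
  congr 1
  ring

/-- The nonsmooth part of the incremental functional: contact energy plus frictional potential of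
the increment. -/
noncomputable def nonsmooth {P : Geometry d} (γ : ℝ → ℝ) (μ : ℝ) (w u : P.Disp) : ℝ≥0∞ :=
  friction γ μ w (u - w) + contactEnergy γ u

theorem nonsmooth_comb_le {P : Geometry d} {γ : ℝ → ℝ} (hγ0 : ∀ r, 0 ≤ γ r)
    (hγ' : ∀ r, deriv γ r ≤ 0) (hγc : ConvexOn ℝ univ γ) (hγ : ContDiff ℝ 1 γ) {μ : ℝ} (hμ : 0 ≤ μ)
    {a b : ℝ} (ha : 0 ≤ a) (hb : 0 ≤ b) (hab : a + b = 1) (w u v : P.Disp) :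
    nonsmooth γ μ w (a • u + b • v)
      ≤ ENNReal.ofReal a * nonsmooth γ μ w u + ENNReal.ofReal b * nonsmooth γ μ w v := by
  have h1 := friction_comb_le hγ' (hγ.continuous_deriv le_rfl) hμ ha hb w (u - w) (v - w)
  have h2 := contactEnergy_comb_le hγ0 hγc hγ.continuous ha hb hab u v
  have h3 : a • u + b • v - w = a • (u - w) + b • (v - w) := by
    rw [smul_sub, smul_sub, sub_add_sub_comm, ← add_smul, hab, one_smul]
  rw [← h3] at h1
  refine (add_le_add h1 h2).trans (le_of_eq ?_)
  rw [nonsmooth, nonsmooth]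
  ring

/-- Sequential lower semicontinuity of the nonsmooth part, by Fatou's lemma: along a subsequence the
traces converge almost everywhere. -/
theorem nonsmooth_le_of_tendsto {P : Geometry d} {γ : ℝ → ℝ} (hγ : ContDiff ℝ 1 γ) {μ : ℝ}
    (w : P.Disp) {v : ℕ → P.Disp} {u : P.Disp}
    (hv : ∀ η, Tendsto (fun n => (v n η).1.2.2) atTop (𝓝 (u η).1.2.2)) {L : ℝ≥0∞}
    (hL : Tendsto (fun n => nonsmooth γ μ w (v n)) atTop (𝓝 L)) : nonsmooth γ μ w u ≤ L := by
  have hγd := hγ.continuous_deriv le_rfl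
  have hsub : ∀ η, ∀ φ : ℕ → ℕ, StrictMono φ → ∃ ψ : ℕ → ℕ, StrictMono ψ ∧
      ∀ᵐ x ∂P.σC, Tendsto (fun n => (v (φ (ψ n)) η).trace x) atTop (𝓝 ((u η).trace x)) := by
    intro η φ hφ
    have h1 := tendstoInMeasure_of_tendsto_Lp ((hv η).comp hφ.tendsto_atTop)
    obtain ⟨ψ, hψ, h2⟩ := h1.exists_seq_tendsto_ae
    exact ⟨ψ, hψ, ae_mono (P.σC_le η) h2⟩
  obtain ⟨φ, hφ, hA⟩ := hsub Body.A id strictMono_id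
  obtain ⟨ψ, hψ, hB⟩ := hsub Body.B φ hφ
  let p : P.Disp → E d → ℝ≥0∞ := fun u x =>
    ENNReal.ofReal (-μ * deriv γ (gapN w x) * ‖gapT (u - w) x‖) + ENNReal.ofReal (γ (gapN u x))
  have hp : ∀ u, nonsmooth γ μ w u = ∫⁻ x, p u x ∂P.σC := fun u =>
    (lintegral_add_left' (aemeasurable_friction hγd μ w (u - w)) _).symm
  have hpm : ∀ u, AEMeasurable (p u) P.σC := fun u =>
    (aemeasurable_friction hγd μ w (u - w)).add (aemeasurable_contactEnergy hγ.continuous u)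
  have hsubw : ∀ u : P.Disp, ∀ᵐ x ∂P.σC, gapT (u - w) x = gapT u x - gapT w x := by
    intro u
    filter_upwards [ae_gapT_comb 1 (-1) u w] with x hx
    rw [one_smul, one_smul, neg_smul, neg_smul, one_smul, one_smul, ← sub_eq_add_neg,
      ← sub_eq_add_neg] at hx
    exact hx
  have hlim : ∀ᵐ x ∂P.σC, Tendsto (fun n => p (v (φ (ψ n))) x) atTop (𝓝 (p u x)) := by
    filter_upwards [hA, hB, hsubw u, ae_all_iff.2 fun n => hsubw (v n)] with x hA hB hu hvn
    have hg : Tendsto (fun n => gap (v (φ (ψ n))) x) atTop (𝓝 (gap u x)) :=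
      (hA.comp hψ.tendsto_atTop).sub hB
    have hN : Tendsto (fun n => gapN (v (φ (ψ n))) x) atTop (𝓝 (gapN u x)) :=
      hg.inner tendsto_const_nhds
    have hT : Tendsto (fun n => gapT (v (φ (ψ n))) x) atTop (𝓝 (gapT u x)) :=
      hg.sub (hN.smul_const _)
    simp only [p, hu, hvn]
    refine Tendsto.add ?_ ?_
    · exact (ENNReal.continuous_ofReal.tendsto _).comp ((hT.sub_const _).norm.const_mul _)
    · exact (ENNReal.continuous_ofReal.tendsto _).comp ((hγ.continuous.tendsto _).comp hN)
  calc nonsmooth γ μ w u = ∫⁻ x, liminf (fun n => p (v (φ (ψ n))) x) atTop ∂P.σC := by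
        rw [hp]
        refine lintegral_congr_ae ?_
        filter_upwards [hlim] with x hx
        exact hx.liminf_eq.symm
    _ ≤ liminf (fun n => ∫⁻ x, p (v (φ (ψ n))) x ∂P.σC) atTop :=
        lintegral_liminf_le' fun n => hpm _
    _ = L := by
        simp only [← hp]
        exact (hL.comp (hφ.comp hψ).tendsto_atTop).liminf_eq

end Functionals

/-! ### The incremental functional -/

section Incremental

variable {d : ℕ}

/-- The states of `H¹` fields whose trace vanishes on the Dirichlet parts. -/
noncomputable def Geometry.zeroDirichlet (P : Geometry d) : Submodule ℝ P.State :=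
  ⨅ η, (dirichletSubmodule (P.Ω η) (P.ΓD_open η).choose).comap (P.proj η).toLinearMap

theorem Geometry.mem_zeroDirichlet_iff (P : Geometry d) {x : P.State} :
    x ∈ P.zeroDirichlet ↔ ∀ η, x η ∈ h1Submodule (P.Ω η) ∧ ∀ᵐ y ∂(P.σD η), (x η).2.2 y = 0 := by
  rw [Geometry.zeroDirichlet, Submodule.mem_iInf]
  refine forall_congr' fun η => ?_
  rw [Submodule.mem_comap, mem_dirichletSubmodule_iff (P.ΓD_open η).choose_spec.1,
    ← (P.ΓD_open η).choose_spec.2]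
  rfl

theorem Geometry.isClosed_zeroDirichlet (P : Geometry d) :
    IsClosed (P.zeroDirichlet : Set P.State) := by
  rw [Geometry.zeroDirichlet, Submodule.coe_iInf]
  exact isClosed_iInter fun η => (isClosed_dirichletSubmodule (P.isOpen η) (P.isBounded η)
    (P.lipschitz η) _).preimage (P.proj η).continuous

theorem Geometry.σD_le (P : Geometry d) (η : Body) : P.σD η ≤ surface (P.Ω η) := by
  refine Measure.restrict_mono_set _ ?_
  obtain ⟨U, -, h⟩ := P.ΓD_open η
  rw [h]
  exact inter_subset_right

theorem HasDirichletData.comb {P : Geometry d} {g h : P.DirichletData} {u v : P.Disp}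
    (hu : HasDirichletData g u) (hv : HasDirichletData h v) (a b : ℝ) (η : Body) :
    ∀ᵐ x ∂(P.σD η), ((a • u + b • v) η).trace x = a • g η x + b • h η x := by
  filter_upwards [ae_mono (P.σD_le η) (ae_trace_comb a b u v η), hu η, hv η] with x h1 h2 h3
  rw [h1, h2, h3]

theorem HasDirichletData.convex {P : Geometry d} {g : P.DirichletData} {u v : P.Disp}
    (hu : HasDirichletData g u) (hv : HasDirichletData g v) {a b : ℝ} (hab : a + b = 1) :
    HasDirichletData g (a • u + b • v) := by
  intro η
  filter_upwards [hu.comb hv a b η] with x hx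
  rw [hx, ← add_smul, hab, one_smul]

theorem HasDirichletData.sub_mem {P : Geometry d} {g : P.DirichletData} {u v : P.Disp}
    (hu : HasDirichletData g u) (hv : HasDirichletData g v) :
    P.toState u - P.toState v ∈ P.zeroDirichlet := by
  rw [P.mem_zeroDirichlet_iff]
  intro η
  refine ⟨(h1Submodule (P.Ω η)).sub_mem (u η).2 (v η).2, ?_⟩
  have h := hu.comb hv 1 (-1) η
  rw [one_smul, neg_smul, one_smul, ← sub_eq_add_neg] at h
  filter_upwards [h] with x hx
  refine Eq.trans hx ?_
  rw [one_smul, neg_smul, one_smul, add_neg_cancel]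

/-- The displacement with a given state in `zeroDirichlet`. -/
def Geometry.ofZeroDirichlet (P : Geometry d) (x : P.zeroDirichlet) : P.Disp := fun η =>
  ⟨x.1 η, ((P.mem_zeroDirichlet_iff).1 x.2 η).1⟩

theorem HasDirichletData.add_zero {P : Geometry d} {g : P.DirichletData} {u : P.Disp}
    (hu : HasDirichletData g u) (x : P.zeroDirichlet) :
    HasDirichletData g (u + P.ofZeroDirichlet x) := by
  intro η
  have h := ae_mono (P.σD_le η) (ae_trace_comb 1 1 u (P.ofZeroDirichlet x) η)
  rw [one_smul, one_smul] at h
  filter_upwards [h, hu η, ((P.mem_zeroDirichlet_iff).1 x.2 η).2] with y h1 h2 h3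
  have h4 : (P.ofZeroDirichlet x η).trace y = 0 := h3
  rw [h1, h2, h4, smul_zero, _root_.add_zero, one_smul]

theorem Geometry.form_comb (P : Geometry d) (C : Body → ModuliTensor d) {a b : ℝ} (hab : a + b = 1)
    (x y : P.State) : P.form C (a • x + b • y) (a • x + b • y)
      = a * P.form C x x + b * P.form C y y - a * b * P.form C (x - y) (x - y) := by
  simp only [map_add, map_sub, map_smul, LinearMap.add_apply, LinearMap.sub_apply,
    LinearMap.smul_apply, smul_eq_mul]
  rw [P.form_comm C y x]
  obtain rfl : b = 1 - a := by linarith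
  ring

/-- The quadratic form `½ C(x, x) + (1/τ) ½ D(x, x)` that governs one time step. -/
noncomputable def Geometry.stepForm (P : Geometry d) (C D : Body → ModuliTensor d) (τ : ℝ)
    (x : P.State) : ℝ :=
  1 / 2 * P.form C x x + τ⁻¹ * (1 / 2 * P.form D x x)

/-- Korn's inequality on both bodies makes the step form coercive. -/
theorem Geometry.exists_coercive (hd : 2 ≤ d) (P : Geometry d) (C D : Body → ModuliTensor d)
    {τ : ℝ} (hτ : 0 < τ) :
    ∃ c : ℝ, 0 < c ∧ ∀ x ∈ P.zeroDirichlet, c * ‖x‖ ^ 2 ≤ P.stepForm C D τ x := by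
  have hη : ∀ η, ∃ c : ℝ, 0 < c ∧ ∀ x ∈ P.zeroDirichlet,
      c * ‖x η‖ ^ 2 ≤ gradForm (P.Ω η) (C η) (x η).2.1 (x η).2.1 := by
    intro η
    obtain ⟨c, hc, h⟩ := exists_le_gradForm (C η)
    obtain ⟨K, hK, hk⟩ := korn_first hd (P.isOpen η) (P.isConnected η) (P.isBounded η)
      (P.lipschitz η) (P.ΓD_open η).choose_spec.1 (by
        rw [← (P.ΓD_open η).choose_spec.2]; exact P.ΓD_nonempty η)
    refine ⟨c / K ^ 2, by positivity, fun x hx => le_trans ?_ (h (P.Ω η) (x η).2.1)⟩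
    have h1 := hk (x η) ((Submodule.mem_iInf _).1 hx η)
    rw [div_mul_eq_mul_div, div_le_iff₀ (by positivity), mul_assoc]
    gcongr
    rw [← mul_pow, mul_comm]
    gcongr
  choose c hc h using hη
  set m := min (c Body.A) (c Body.B) with hm
  have hm0 : 0 < m := lt_min (hc _) (hc _)
  have hmc : ∀ η, m ≤ c η := fun η => by
    cases η
    · exact min_le_left _ _
    · exact min_le_right _ _
  have hg0 : ∀ x : P.State, ∀ η, 0 ≤ gradForm (P.Ω η) (C η) (x η).2.1 (x η).2.1 := by
    intro x η
    obtain ⟨c, hc, h⟩ := exists_le_gradForm (C η)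
    exact le_trans (by positivity) (h (P.Ω η) (x η).2.1)
  refine ⟨m / 2, half_pos hm0, fun x hx => ?_⟩
  have hD := P.form_self_nonneg D x
  have hC : m * ‖x‖ ^ 2 ≤ P.form C x x := by
    have hb : ∀ η, m * ‖x η‖ ^ 2 ≤ P.form C x x := fun η => by
      calc m * ‖x η‖ ^ 2 ≤ c η * ‖x η‖ ^ 2 := by gcongr; exact hmc η
        _ ≤ gradForm (P.Ω η) (C η) (x η).2.1 (x η).2.1 := h η x hx
        _ ≤ P.form C x x := Finset.single_le_sum
          (f := fun η => gradForm (P.Ω η) (C η) (x η).2.1 (x η).2.1)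
          (fun η _ => hg0 x η) (Finset.mem_univ η)
    have hn : ‖x‖ ≤ Real.sqrt (P.form C x x / m) :=
      (P.state_norm_le_iff (Real.sqrt_nonneg _)).2 fun η =>
        Real.le_sqrt_of_sq_le (by rw [le_div_iff₀ hm0, mul_comm]; exact hb η)
    have h2 : ‖x‖ ^ 2 ≤ P.form C x x / m := by
      calc ‖x‖ ^ 2 ≤ Real.sqrt (P.form C x x / m) ^ 2 := by gcongr
        _ = _ := Real.sq_sqrt (div_nonneg (P.form_self_nonneg C x) hm0.le)
    rwa [le_div_iff₀ hm0, mul_comm] at h2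
  have : 0 ≤ τ⁻¹ * (1 / 2 * P.form D x x) := by positivity
  rw [Geometry.stepForm]
  linarith

/-- The smooth part of the incremental functional with previous state `w` and load `l`. -/
noncomputable def Geometry.smoothPart (P : Geometry d) (C D : Body → ModuliTensor d) (τ : ℝ)
    (l : P.State →L[ℝ] ℝ) (w x : P.State) : ℝ :=
  τ⁻¹ * (1 / 2 * P.form D (x - w) (x - w)) + 1 / 2 * P.form C x x - l x

theorem Geometry.smoothPart_comb (P : Geometry d) (C D : Body → ModuliTensor d) (τ : ℝ)
    (l : P.State →L[ℝ] ℝ) (w x y : P.State) {a b : ℝ} (hab : a + b = 1) :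
    P.smoothPart C D τ l w (a • x + b • y) = a * P.smoothPart C D τ l w x
      + b * P.smoothPart C D τ l w y - a * b * P.stepForm C D τ (x - y) := by
  have h1 : a • x + b • y - w = a • (x - w) + b • (y - w) := by
    rw [smul_sub, smul_sub, sub_add_sub_comm, ← add_smul, hab, one_smul]
  have h2 : (x - w) - (y - w) = x - y := by abel
  have e1 := P.form_comb D hab (x - w) (y - w)
  have e2 := P.form_comb C hab x y
  have e3 : l (a • x + b • y) = a * l x + b * l y := by
    rw [l.map_add, l.map_smul, l.map_smul, smul_eq_mul, smul_eq_mul]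
  rw [h2] at e1
  rw [Geometry.smoothPart, h1, e1, e2, e3, Geometry.smoothPart, Geometry.smoothPart,
    Geometry.stepForm]
  ring

/-- The extended-real arithmetic of one time step: the factor `τ` cancels the factor `1 / τ` in front
of the frictional potential `r`, also where `r` or the contact energy `e` is infinite. -/
theorem ereal_step_eq {τ : ℝ} (hτ : 0 < τ) (r e : ℝ≥0∞) (a b l : ℝ) :
    (τ : EReal) * (((ENNReal.ofReal τ⁻¹ * r : ℝ≥0∞) : EReal) + (a : EReal))
      + ((b : EReal) + (e : EReal)) - (l : EReal)
      = ((τ * a + b - l : ℝ) : EReal) + ((r + e : ℝ≥0∞) : EReal) := by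
  by_cases hr : r = ⊤
  · have h0 : ENNReal.ofReal τ⁻¹ ≠ 0 := by simpa using hτ
    have h1 : (b : EReal) + (e : EReal) ≠ ⊥ := by
      simp [EReal.add_eq_bot_iff]
    rw [hr, ENNReal.mul_top h0, top_add, EReal.coe_ennreal_top, EReal.top_add_coe,
      EReal.coe_mul_top_of_pos hτ, EReal.top_add_of_ne_bot h1, EReal.top_sub_coe,
      EReal.coe_add_top]
  by_cases he : e = ⊤
  · have h1 : (τ : EReal) * (((ENNReal.ofReal τ⁻¹ * r : ℝ≥0∞) : EReal) + (a : EReal)) ≠ ⊥ := by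
      rw [← EReal.coe_ennreal_toReal (ENNReal.mul_ne_top ENNReal.ofReal_ne_top hr),
        ← EReal.coe_add, ← EReal.coe_mul]
      exact EReal.coe_ne_bot _
    rw [he, add_top, EReal.coe_ennreal_top, EReal.coe_add_top, EReal.add_top_of_ne_bot h1,
      EReal.top_sub_coe, EReal.coe_add_top]
  rw [← EReal.coe_ennreal_toReal (ENNReal.mul_ne_top ENNReal.ofReal_ne_top hr),
    ← EReal.coe_ennreal_toReal he, ← EReal.coe_ennreal_toReal (ENNReal.add_ne_top.2 ⟨hr, he⟩),
    ENNReal.toReal_mul, ENNReal.toReal_ofReal (inv_pos.2 hτ).le, ENNReal.toReal_add hr he]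
  norm_cast
  field_simp
  ring

theorem incremental_eq {P : Geometry d} (C D : Body → ModuliTensor d) (γ : ℝ → ℝ) (μ : ℝ) {τ : ℝ}
    (hτ : 0 < τ) {g : P.DirichletData} (f : P.NeumannData) (w : P.Disp) {u : P.Disp}
    (hu : HasDirichletData g u) :
    incremental C D γ μ τ g f w u
      = ((P.smoothPart C D τ (P.loadCLM f) (P.toState w) (P.toState u) : ℝ) : EReal)
        + ((nonsmooth γ μ w u : ℝ≥0∞) : EReal) := by
  have h1 : τ * R2 D (τ⁻¹ • (u - w)) + quad C u - load f u
      = P.smoothPart C D τ (P.loadCLM f) (P.toState w) (P.toState u) := by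
    have h2 : ∀ z, P.form D (τ⁻¹ • z) (τ⁻¹ • z) = τ⁻¹ * (τ⁻¹ * P.form D z z) := by simp
    rw [R2, quad_eq_form, quad_eq_form, load_eq_loadCLM, Geometry.smoothPart, map_smul, map_sub, h2]
    field_simp
  rw [← h1, incremental, R, energy, energyB, if_pos hu, R1_eq_friction, energyC_eq_contactEnergy,
    friction_smul γ μ (inv_pos.2 hτ).le, ereal_step_eq hτ, nonsmooth]

theorem incremental_eq_top {P : Geometry d} (C D : Body → ModuliTensor d) (γ : ℝ → ℝ) (μ : ℝ)
    {τ : ℝ} (hτ : 0 < τ) {g : P.DirichletData} (f : P.NeumannData) (w : P.Disp) {u : P.Disp}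
    (hu : ¬ HasDirichletData g u) : incremental C D γ μ τ g f w u = ⊤ := by
  have h0 : R D γ μ w (τ⁻¹ • (u - w)) ≠ ⊥ := by
    simp [R, R1, EReal.add_eq_bot_iff]
  have h1 : (τ : EReal) * R D γ μ w (τ⁻¹ • (u - w)) ≠ ⊥ := by
    rw [Ne, EReal.mul_eq_bot]
    push Not
    refine ⟨fun h => absurd h (EReal.coe_ne_bot _), fun _ => h0,
      fun h => absurd h (EReal.coe_ne_top _), fun h => ?_⟩
    exact absurd (EReal.coe_neg'.1 h) (not_lt.2 hτ.le)
  rw [incremental, energy, energyB, if_neg hu, EReal.top_add_of_ne_bot (by simp [energyC]),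
    EReal.add_top_of_ne_bot h1, EReal.top_sub_coe]

theorem incremental_lt_top_iff {P : Geometry d} (C D : Body → ModuliTensor d) (γ : ℝ → ℝ) (μ : ℝ)
    {τ : ℝ} (hτ : 0 < τ) (g : P.DirichletData) (f : P.NeumannData) (w u : P.Disp) :
    incremental C D γ μ τ g f w u < ⊤ ↔ HasDirichletData g u ∧ nonsmooth γ μ w u ≠ ⊤ := by
  by_cases hu : HasDirichletData g u
  · rw [incremental_eq C D γ μ hτ f w hu]
    by_cases hn : nonsmooth γ μ w u = ⊤
    · simp [hn]
    · rw [← EReal.coe_ennreal_toReal hn, ← EReal.coe_add]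
      exact iff_of_true (EReal.coe_lt_top _) ⟨hu, hn⟩
  · simp [incremental_eq_top C D γ μ hτ f w hu, hu]

theorem energy_lt_top_iff {P : Geometry d} (C : Body → ModuliTensor d) (γ : ℝ → ℝ)
    (g : P.DirichletData) (u : P.Disp) :
    energy C γ g u < ⊤ ↔ HasDirichletData g u ∧ contactEnergy γ u ≠ ⊤ := by
  rw [energy, energyB, energyC_eq_contactEnergy]
  by_cases hu : HasDirichletData g u
  · rw [if_pos hu]
    by_cases hn : contactEnergy γ u = ⊤
    · simp [hn]
    · rw [← EReal.coe_ennreal_toReal hn, ← EReal.coe_add]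
      exact iff_of_true (EReal.coe_lt_top _) ⟨hu, hn⟩
  · rw [if_neg hu, EReal.top_add_of_ne_bot (EReal.coe_ennreal_ne_bot _)]
    simp [hu]

end Incremental

/-! ### One time step -/

section TimeStep

variable {d : ℕ} {P : Geometry d}

/-- The real value of the incremental functional at a displacement with the right Dirichlet data.
The `toReal` makes it meaningful only where the nonsmooth part is finite. -/
noncomputable def stepValue (C D : Body → ModuliTensor d) (γ : ℝ → ℝ) (μ τ : ℝ)
    (f : P.NeumannData) (w u : P.Disp) : ℝ :=
  P.smoothPart C D τ (P.loadCLM f) (P.toState w) (P.toState u) + (nonsmooth γ μ w u).toReal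

theorem incremental_eq_stepValue (C D : Body → ModuliTensor d) (γ : ℝ → ℝ) (μ : ℝ) {τ : ℝ}
    (hτ : 0 < τ) {g : P.DirichletData} (f : P.NeumannData) (w : P.Disp) {u : P.Disp}
    (hu : HasDirichletData g u) (hn : nonsmooth γ μ w u ≠ ⊤) :
    incremental C D γ μ τ g f w u = ((stepValue C D γ μ τ f w u : ℝ) : EReal) := by
  rw [incremental_eq C D γ μ hτ f w hu, stepValue, EReal.coe_add, EReal.coe_ennreal_toReal hn]

section Convexity

variable {C D : Body → ModuliTensor d} {γ : ℝ → ℝ} {μ τ : ℝ}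
  (hγ0 : ∀ r, 0 ≤ γ r) (hγa : Antitone γ) (hγc : ConvexOn ℝ univ γ) (hγ : ContDiff ℝ 1 γ)
  (hμ : 0 ≤ μ)

include hγ0 hγa hγc hγ hμ

theorem nonsmooth_comb_ne_top {w u v : P.Disp} (hu : nonsmooth γ μ w u ≠ ⊤)
    (hv : nonsmooth γ μ w v ≠ ⊤) {a b : ℝ} (ha : 0 ≤ a) (hb : 0 ≤ b) (hab : a + b = 1) :
    nonsmooth γ μ w (a • u + b • v) ≠ ⊤ :=
  ne_top_of_le_ne_top (ENNReal.add_ne_top.2 ⟨ENNReal.mul_ne_top ENNReal.ofReal_ne_top hu,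
    ENNReal.mul_ne_top ENNReal.ofReal_ne_top hv⟩)
    (nonsmooth_comb_le hγ0 (fun _ => hγa.deriv_nonpos) hγc hγ hμ ha hb hab w u v)

theorem stepValue_comb_le (f : P.NeumannData) {w u v : P.Disp} (hu : nonsmooth γ μ w u ≠ ⊤)
    (hv : nonsmooth γ μ w v ≠ ⊤) {a b : ℝ} (ha : 0 ≤ a) (hb : 0 ≤ b) (hab : a + b = 1) :
    stepValue C D γ μ τ f w (a • u + b • v) ≤ a * stepValue C D γ μ τ f w u
      + b * stepValue C D γ μ τ f w v
      - a * b * P.stepForm C D τ (P.toState u - P.toState v) := by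
  have h1 := nonsmooth_comb_le hγ0 (fun _ => hγa.deriv_nonpos) hγc hγ hμ ha hb hab w u v
  have hfu := ENNReal.mul_ne_top (ENNReal.ofReal_ne_top (r := a)) hu
  have hfv := ENNReal.mul_ne_top (ENNReal.ofReal_ne_top (r := b)) hv
  have h2 := ENNReal.toReal_mono (ENNReal.add_ne_top.2 ⟨hfu, hfv⟩) h1
  rw [ENNReal.toReal_add hfu hfv, ENNReal.toReal_mul, ENNReal.toReal_mul,
    ENNReal.toReal_ofReal ha, ENNReal.toReal_ofReal hb] at h2
  have h3 := P.smoothPart_comb C D τ (P.loadCLM f) (P.toState w) (P.toState u) (P.toState v) hab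
  rw [← map_smul, ← map_smul, ← map_add] at h3
  simp only [stepValue, h3]
  linarith

/-- At a minimizer the functional grows at least quadratically: compare the minimizer with the
points of the segment to `v` and let them approach the minimizer. -/
theorem stepValue_add_stepForm_le {g : P.DirichletData} (f : P.NeumannData) {w u : P.Disp}
    (hug : HasDirichletData g u) (hu : nonsmooth γ μ w u ≠ ⊤)
    (hmin : ∀ v, HasDirichletData g v → nonsmooth γ μ w v ≠ ⊤ →
      stepValue C D γ μ τ f w u ≤ stepValue C D γ μ τ f w v)
    {v : P.Disp} (hvg : HasDirichletData g v) (hv : nonsmooth γ μ w v ≠ ⊤) :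
    stepValue C D γ μ τ f w u + P.stepForm C D τ (P.toState u - P.toState v)
      ≤ stepValue C D γ μ τ f w v := by
  set q := P.stepForm C D τ (P.toState u - P.toState v)
  have hs : ∀ s : ℝ, 0 < s → s < 1 →
      (1 - s) * q ≤ stepValue C D γ μ τ f w v - stepValue C D γ μ τ f w u := by
    intro s hs0 hs1
    have hab : (1 - s) + s = 1 := by ring
    have h1 := hmin _ (hug.convex hvg hab)
      (nonsmooth_comb_ne_top hγ0 hγa hγc hγ hμ hu hv (by linarith) hs0.le hab)
    have h2 := stepValue_comb_le (C := C) (D := D) (τ := τ) hγ0 hγa hγc hγ hμ f hu hv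
      (by linarith : 0 ≤ 1 - s) hs0.le hab
    have h3 : s * ((1 - s) * q)
        ≤ s * (stepValue C D γ μ τ f w v - stepValue C D γ μ τ f w u) := by
      linarith
    exact le_of_mul_le_mul_left h3 hs0
  have hlim : Tendsto (fun s : ℝ => (1 - s) * q) (𝓝[>] 0) (𝓝 q) := by
    have hc : Continuous fun s : ℝ => (1 - s) * q := by fun_prop
    have := hc.tendsto 0
    simp only [sub_zero, one_mul] at this
    exact this.mono_left nhdsWithin_le_nhds
  have := le_of_tendsto hlim (by
    filter_upwards [Ioo_mem_nhdsGT (zero_lt_one' ℝ)] with s hs'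
    exact hs s hs'.1 hs'.2)
  linarith

/-- Existence of a minimizer of one time step, as soon as there is a competitor. -/
theorem exists_stepValue_min (hd : 2 ≤ d) (hτ : 0 < τ) {g : P.DirichletData} (f : P.NeumannData)
    (w : P.Disp) {u₀ : P.Disp} (hg₀ : HasDirichletData g u₀) (hn₀ : nonsmooth γ μ w u₀ ≠ ⊤) :
    ∃ u, HasDirichletData g u ∧ nonsmooth γ μ w u ≠ ⊤ ∧
      ∀ v, HasDirichletData g v → nonsmooth γ μ w v ≠ ⊤ →
        stepValue C D γ μ τ f w u ≤ stepValue C D γ μ τ f w v := by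
  obtain ⟨c, hc, hcoer⟩ := P.exists_coercive hd C D hτ
  have hcomp : CompleteSpace P.zeroDirichlet := P.isClosed_zeroDirichlet.completeSpace_coe
  set l := P.loadCLM f with hl
  set x₀ := P.toState u₀ with hx₀
  set W := P.toState w with hW
  let F : P.zeroDirichlet → ℝ := fun x => P.smoothPart C D τ l W (x₀ + x)
  let G : P.zeroDirichlet → ℝ≥0∞ := fun x => nonsmooth γ μ w (u₀ + P.ofZeroDirichlet x)
  have hst : ∀ x : P.zeroDirichlet, P.toState (u₀ + P.ofZeroDirichlet x) = x₀ + x := fun x => rfl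
  have hF : Continuous F := by
    have h1 : Continuous fun x : P.zeroDirichlet => x₀ + (x : P.State) := by fun_prop
    have h2 : Continuous fun x : P.zeroDirichlet => x₀ + (x : P.State) - W := by fun_prop
    exact (((P.continuous_form D h2 h2).const_mul (1 / 2)).const_mul _).add
      ((P.continuous_form C h1 h1).const_mul _) |>.sub (l.continuous.comp h1)
  have hmid : ∀ x y : P.zeroDirichlet, x₀ + (((1 / 2 : ℝ) • x + (1 / 2 : ℝ) • y :
      P.zeroDirichlet) : P.State) = (1 / 2 : ℝ) • (x₀ + x) + (1 / 2 : ℝ) • (x₀ + y) := by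
    intro x y
    rw [Submodule.coe_add, Submodule.coe_smul, Submodule.coe_smul]
    module
  have hFc : ∀ x y : P.zeroDirichlet, F ((1 / 2 : ℝ) • x + (1 / 2 : ℝ) • y)
      ≤ (F x + F y) / 2 - c / 4 * ‖x - y‖ ^ 2 := by
    intro x y
    have h1 := P.smoothPart_comb C D τ l W (x₀ + x) (x₀ + y)
      (show (1 / 2 : ℝ) + 1 / 2 = 1 by norm_num)
    rw [← hmid, add_sub_add_left_eq_sub] at h1
    have h2 := hcoer _ (x - y).2
    have h3 : F ((1 / 2 : ℝ) • x + (1 / 2 : ℝ) • y) = 1 / 2 * F x + 1 / 2 * F y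
        - 1 / 2 * (1 / 2) * P.stepForm C D τ (x - y : P.State) := h1
    have h4 : c * ‖x - y‖ ^ 2 ≤ P.stepForm C D τ (x - y : P.State) := h2
    linarith
  -- `F x ≥ F 0 + L x + c ‖x‖²` with the bounded functional `L` given by the linear part of `F`
  have hM : ∃ M, ∀ x, M ≤ F x := by
    have hlin : ∃ B : ℝ, ∀ x : P.zeroDirichlet, |P.form C x₀ x + τ⁻¹ * P.form D (x₀ - W) x - l x|
        ≤ B * ‖x‖ := by
      let L : P.State →ₗ[ℝ] ℝ := P.form C x₀ + τ⁻¹ • P.form D (x₀ - W) - l.toLinearMap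
      have hLc : Continuous L :=
        ((P.continuous_form C continuous_const continuous_id).add
          ((P.continuous_form D continuous_const continuous_id).const_mul τ⁻¹)).sub l.continuous
      let L' : P.State →L[ℝ] ℝ := ⟨L, hLc⟩
      exact ⟨‖L'‖, fun x => L'.le_opNorm x⟩
    obtain ⟨B, hB⟩ := hlin
    refine ⟨F 0 - B ^ 2 / (4 * c), fun x => ?_⟩
    have h1 : F x = F 0 + (P.form C x₀ x + τ⁻¹ * P.form D (x₀ - W) x - l x)
        + P.stepForm C D τ x := by
      have e1 : x₀ + (x : P.State) - W = (x₀ - W) + x := by abel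
      have e2 : x₀ + ((0 : P.zeroDirichlet) : P.State) = x₀ := add_zero _
      change P.smoothPart C D τ l W (x₀ + x) = P.smoothPart C D τ l W (x₀ + (0 : P.zeroDirichlet))
        + _ + _
      rw [e2]
      simp only [Geometry.smoothPart, Geometry.stepForm, e1, map_add, LinearMap.add_apply]
      rw [P.form_comm D x (x₀ - W), P.form_comm C x x₀]
      ring
    have h2 := hcoer _ x.2
    have h2' : c * ‖x‖ ^ 2 ≤ P.stepForm C D τ (x : P.State) := h2
    have h3 := (abs_le.1 (hB x)).1
    have h4 : B * ‖x‖ ≤ c * ‖x‖ ^ 2 + B ^ 2 / (4 * c) := by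
      have : 0 ≤ c * (‖x‖ - B / (2 * c)) ^ 2 := by positivity
      have e : c * (‖x‖ - B / (2 * c)) ^ 2 = c * ‖x‖ ^ 2 - B * ‖x‖ + B ^ 2 / (4 * c) := by
        field_simp
        ring
      linarith
    rw [h1]
    linarith
  obtain ⟨M, hM⟩ := hM
  have hGc : ∀ x y : P.zeroDirichlet, G ((1 / 2 : ℝ) • x + (1 / 2 : ℝ) • y)
      ≤ ENNReal.ofReal (1 / 2) * G x + ENNReal.ofReal (1 / 2) * G y := by
    intro x y
    have h1 := nonsmooth_comb_le hγ0 (fun _ => hγa.deriv_nonpos) hγc hγ hμ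
      (by norm_num : (0 : ℝ) ≤ 1 / 2) (by norm_num : (0 : ℝ) ≤ 1 / 2) (by norm_num) w
      (u₀ + P.ofZeroDirichlet x) (u₀ + P.ofZeroDirichlet y)
    have h2 : u₀ + P.ofZeroDirichlet ((1 / 2 : ℝ) • x + (1 / 2 : ℝ) • y)
        = (1 / 2 : ℝ) • (u₀ + P.ofZeroDirichlet x) + (1 / 2 : ℝ) • (u₀ + P.ofZeroDirichlet y) := by
      refine P.toState_injective ?_
      rw [hst, hmid, map_add, map_smul, map_smul, hst, hst]
    rw [← h2] at h1
    exact h1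
  have hGl : ∀ (x : ℕ → P.zeroDirichlet) (y : P.zeroDirichlet) (L : ℝ≥0∞),
      Tendsto x atTop (𝓝 y) → Tendsto (fun n => G (x n)) atTop (𝓝 L) → G y ≤ L := by
    intro x y L hx hL
    refine nonsmooth_le_of_tendsto hγ w (v := fun n => u₀ + P.ofZeroDirichlet (x n))
      (fun η => ?_) hL
    have hc : Continuous fun x : P.zeroDirichlet => (P.proj η (x₀ + (x : P.State))).2.2 := by
      fun_prop
    exact (hc.tendsto y).comp hx
  obtain ⟨x, hx, hmin⟩ := exists_minimizer hF (by positivity : 0 < c / 4) hFc hM hGc hGl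
    ⟨0, by
      change nonsmooth γ μ w (u₀ + P.ofZeroDirichlet 0) ≠ ⊤
      have : u₀ + P.ofZeroDirichlet 0 = u₀ := P.toState_injective (add_zero _)
      rwa [this]⟩
  refine ⟨u₀ + P.ofZeroDirichlet x, hg₀.add_zero x, hx, fun v hvg hv => ?_⟩
  let y : P.zeroDirichlet := ⟨P.toState v - x₀, hvg.sub_mem hg₀⟩
  have hy : u₀ + P.ofZeroDirichlet y = v := P.toState_injective (add_sub_cancel _ _)
  have h1 := hmin y (by change nonsmooth γ μ w (u₀ + P.ofZeroDirichlet y) ≠ ⊤; rwa [hy])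
  have h2 : ∀ z, F z + (G z).toReal = stepValue C D γ μ τ f w (u₀ + P.ofZeroDirichlet z) :=
    fun z => rfl
  rwa [h2, h2, hy] at h1

theorem strictConvexOn_incremental (hd : 2 ≤ d) (hτ : 0 < τ) (g : P.DirichletData)
    (f : P.NeumannData) (w : P.Disp) :
    StrictConvexOn ℝ {u | incremental C D γ μ τ g f w u < ⊤}
      (fun u => (incremental C D γ μ τ g f w u).toReal) := by
  obtain ⟨c, hc, hcoer⟩ := P.exists_coercive hd C D hτ
  have hset : {u | incremental C D γ μ τ g f w u < ⊤}
      = {u | HasDirichletData g u ∧ nonsmooth γ μ w u ≠ ⊤} :=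
    Set.ext fun u => incremental_lt_top_iff C D γ μ hτ g f w u
  rw [hset]
  refine ⟨fun u hu v hv a b ha hb hab => ⟨hu.1.convex hv.1 hab,
    nonsmooth_comb_ne_top hγ0 hγa hγc hγ hμ hu.2 hv.2 ha hb hab⟩,
    fun u hu v hv huv a b ha hb hab => ?_⟩
  have h1 := stepValue_comb_le (C := C) (D := D) (τ := τ) hγ0 hγa hγc hγ hμ f hu.2 hv.2 ha.le
    hb.le hab
  have hne : 0 < ‖P.toState u - P.toState v‖ :=
    norm_pos_iff.2 (sub_ne_zero.2 fun h => huv (P.toState_injective h))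
  have h2 : 0 < P.stepForm C D τ (P.toState u - P.toState v) :=
    lt_of_lt_of_le (by positivity) (hcoer _ (hu.1.sub_mem hv.1))
  have h3 : 0 < a * b * P.stepForm C D τ (P.toState u - P.toState v) := by positivity
  simp only [smul_eq_mul]
  rw [incremental_eq_stepValue C D γ μ hτ f w hu.1 hu.2,
    incremental_eq_stepValue C D γ μ hτ f w hv.1 hv.2,
    incremental_eq_stepValue C D γ μ hτ f w (hu.1.convex hv.1 hab)
      (nonsmooth_comb_ne_top hγ0 hγa hγc hγ hμ hu.2 hv.2 ha.le hb.le hab), EReal.toReal_coe,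
    EReal.toReal_coe, EReal.toReal_coe]
  linarith

end Convexity

/-- Moving the previous state by a field without gap on the contact boundary changes neither the
contact energy nor the friction. -/
theorem nonsmooth_add_of_gap_eq_zero (γ : ℝ → ℝ) (μ : ℝ) (w δ : P.Disp)
    (hδ : ∀ᵐ x ∂P.σC, gap δ x = 0) : nonsmooth γ μ w (w + δ) = contactEnergy γ w := by
  have h1 : friction γ μ w (w + δ - w) = 0 := by
    rw [add_sub_cancel_left, friction]
    refine (lintegral_congr_ae (g := 0) ?_).trans (lintegral_zero)
    filter_upwards [hδ] with x hx
    simp [gapT, gapN, hx]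
  have h2 : contactEnergy γ (w + δ) = contactEnergy γ w := by
    refine lintegral_congr_ae ?_
    have h := ae_gap_comb 1 1 w δ
    rw [one_smul, one_smul] at h
    filter_upwards [h, hδ] with x hx hx'
    rw [gapN, hx, hx', one_smul, smul_zero, add_zero]
    rfl
  rw [nonsmooth, h1, h2, zero_add]

/-- The comparison of the minimizer with the previous state shifted by the change of the Dirichlet
prolongation, rewritten as an energy inequality. -/
theorem energy_balance_of_le {C D : Body → ModuliTensor d} {γ : ℝ → ℝ} {μ τ : ℝ}
    (f : P.NeumannData) (w u δ : P.Disp)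
    (h : stepValue C D γ μ τ f w u + P.stepForm C D τ (P.toState u - P.toState (w + δ))
      ≤ stepValue C D γ μ τ f w (w + δ)) :
    (nonsmooth γ μ w u).toReal + 2 / τ * R2 D (u - w) + quad C u
      ≤ quad C w + (nonsmooth γ μ w (w + δ)).toReal + dirichletWork C D τ w u δ
        + load f (u - w - δ) := by
  have hpos := P.form_self_nonneg C (P.toState u - P.toState (w + δ))
  rw [R2, quad_eq_form, quad_eq_form, quad_eq_form, dirichletWork_eq_form, load_eq_loadCLM]
  simp only [stepValue, Geometry.smoothPart, Geometry.stepForm] at h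
  simp only [map_add, map_sub, LinearMap.add_apply, LinearMap.sub_apply] at h hpos ⊢
  rw [P.form_comm C (P.toState δ) (P.toState w)] at h hpos
  rw [P.form_comm C (P.toState δ) (P.toState u), P.form_comm C (P.toState w) (P.toState u)]
    at h hpos
  rw [P.form_comm D (P.toState δ) (P.toState u), P.form_comm D (P.toState w) (P.toState u),
    P.form_comm D (P.toState δ) (P.toState w)] at h
  rw [P.form_comm D (P.toState w) (P.toState u), div_eq_mul_inv]
  linarith

end TimeStep

section Minimizer

variable {d : ℕ} {P : Geometry d}

/-- A displacement follows a change of the Dirichlet data when it is shifted by the change of a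
prolongation. -/
theorem HasDirichletData.add_sub {g h : P.DirichletData} {u v w : P.Disp}
    (hw : HasDirichletData h w) (hu : HasDirichletData g u) (hv : HasDirichletData h v) :
    HasDirichletData g (w + (u - v)) := by
  intro η
  have h1 := ae_mono (P.σD_le η) (ae_trace_comb 1 1 w (u - v) η)
  have h2 := hu.comb hv 1 (-1) η
  rw [one_smul, one_smul] at h1
  rw [one_smul, neg_smul, one_smul, ← sub_eq_add_neg] at h2
  filter_upwards [h1, h2, hw η] with x h1 h2 h3
  rw [h1, h2, h3]
  module

theorem ae_gap_sub_eq_zero {u v : P.Disp} (hu : ∀ᵐ x ∂P.σC, gap u x = 0)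
    (hv : ∀ᵐ x ∂P.σC, gap v x = 0) : ∀ᵐ x ∂P.σC, gap (u - v) x = 0 := by
  have h := ae_gap_comb 1 (-1) u v
  rw [one_smul, neg_smul, one_smul, ← sub_eq_add_neg] at h
  filter_upwards [h, hu, hv] with x h hu hv
  rw [h, hu, hv, smul_zero, smul_zero, add_zero]

theorem energy_eq (C : Body → ModuliTensor d) (γ : ℝ → ℝ) {g : P.DirichletData} {u : P.Disp}
    (hu : HasDirichletData g u) (hn : contactEnergy γ u ≠ ⊤) :
    energy C γ g u = ((quad C u + (contactEnergy γ u).toReal : ℝ) : EReal) := by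
  rw [energy, energyB, energyC_eq_contactEnergy, if_pos hu, EReal.coe_add,
    EReal.coe_ennreal_toReal hn]

end Minimizer

end ContactProblem

open ContactProblem in
theorem mainTheorem2 {d : ℕ} (hd : 2 ≤ d) (P : Geometry d) (C D : Body → ModuliTensor d)
    (γ : ℝ → ℝ) (hγ_nonneg : ∀ r, 0 ≤ γ r) (hγ_anti : Antitone γ)
    (hγ_conv : ConvexOn ℝ Set.univ γ) (hγ_smooth : ContDiff ℝ 1 γ)
    (μ : ℝ) (hμ : 0 < μ) (T τ : ℝ) (hτ : 0 < τ) (N : ℕ) (hN : (N : ℝ) * τ = T)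
    (gD : ℝ → P.DirichletData) (fN : ℝ → P.NeumannData)
    (uD : ℝ → P.Disp)
    (huD : ∀ t ∈ Set.Icc 0 T, HasDirichletData (gD t) (uD t))
    (huD_gap : ∀ t ∈ Set.Icc 0 T, ∀ᵐ x ∂P.σC, gap (uD t) x = 0)
    (k : ℕ) (hk : 1 ≤ k) (hkN : k ≤ N)
    (uprev : P.Disp) (huprev : energy C γ (gD (((k : ℝ) - 1) * τ)) uprev < ⊤) :
    let H : P.Disp → EReal := incremental C D γ μ τ (gD (k * τ)) (fN (k * τ)) uprev
    let δD : P.Disp := uD (k * τ) - uD (((k : ℝ) - 1) * τ)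
    StrictConvexOn ℝ {u | H u < ⊤} (fun u => (H u).toReal) ∧
    ∃ u : P.Disp, (∀ v, H u ≤ H v) ∧ (∀ v, (∀ v', H v ≤ H v') → v = u) ∧
      energy C γ (gD (k * τ)) u < ⊤ ∧
      R1 γ μ uprev (u - uprev) + ((2 / τ * R2 D (u - uprev) : ℝ) : EReal)
          + energy C γ (gD (k * τ)) u
        ≤ energy C γ (gD (((k : ℝ) - 1) * τ)) uprev
          + ((dirichletWork C D τ uprev u δD + load (fN (k * τ)) (u - uprev - δD) : ℝ) : EReal) := by
  intro H δD
  refine ⟨strictConvexOn_incremental hγ_nonneg hγ_anti hγ_conv hγ_smooth hμ.le hd hτ _ _ _, ?_⟩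
  have hk1 : (1 : ℝ) ≤ k := by exact_mod_cast hk
  have hkN' : (k : ℝ) ≤ N := by exact_mod_cast hkN
  have ht : (k : ℝ) * τ ∈ Set.Icc 0 T := ⟨by positivity, by rw [← hN]; gcongr⟩
  have ht' : ((k : ℝ) - 1) * τ ∈ Set.Icc 0 T :=
    ⟨mul_nonneg (by linarith) hτ.le, by rw [← hN]; gcongr; linarith⟩
  obtain ⟨hprev, hprev_fin⟩ := (energy_lt_top_iff C γ _ uprev).1 huprev
  -- the previous state, shifted by `δD`, is a competitor whose nonsmooth part is known
  have hcomp : HasDirichletData (gD (k * τ)) (uprev + δD) :=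
    hprev.add_sub (huD _ ht) (huD _ ht')
  have hns : nonsmooth γ μ uprev (uprev + δD) = contactEnergy γ uprev :=
    nonsmooth_add_of_gap_eq_zero γ μ uprev δD
      (ae_gap_sub_eq_zero (huD_gap _ ht) (huD_gap _ ht'))
  have hcomp_fin : nonsmooth γ μ uprev (uprev + δD) ≠ ⊤ := by rwa [hns]
  obtain ⟨u, hug, hu, hmin⟩ := exists_stepValue_min (C := C) (D := D) hγ_nonneg hγ_anti hγ_conv
    hγ_smooth hμ.le hd hτ (fN (k * τ)) uprev hcomp hcomp_fin
  have hgrow : ∀ v, HasDirichletData (gD (k * τ)) v → nonsmooth γ μ uprev v ≠ ⊤ →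
      stepValue C D γ μ τ (fN (k * τ)) uprev u + P.stepForm C D τ (P.toState u - P.toState v)
        ≤ stepValue C D γ μ τ (fN (k * τ)) uprev v := fun v hvg hv =>
    stepValue_add_stepForm_le hγ_nonneg hγ_anti hγ_conv hγ_smooth hμ.le _ hug hu hmin hvg hv
  have hH : ∀ v, HasDirichletData (gD (k * τ)) v → nonsmooth γ μ uprev v ≠ ⊤ →
      H v = ((stepValue C D γ μ τ (fN (k * τ)) uprev v : ℝ) : EReal) := fun v hvg hv =>
    incremental_eq_stepValue C D γ μ hτ _ uprev hvg hv
  obtain ⟨hfr, hce⟩ := ENNReal.add_ne_top.1 hu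
  refine ⟨u, fun v => ?_, fun v hv => ?_, (energy_lt_top_iff C γ _ u).2 ⟨hug, hce⟩, ?_⟩
  · by_cases hv : H v < ⊤
    · obtain ⟨hvg, hvn⟩ := (incremental_lt_top_iff C D γ μ hτ _ _ uprev v).1 hv
      rw [hH u hug hu, hH v hvg hvn]
      exact EReal.coe_le_coe_iff.2 (hmin v hvg hvn)
    · rw [not_lt_top_iff.1 hv]
      exact le_top
  · have hle := hv u
    have hlt : H v < ⊤ := hle.trans_lt (hH u hug hu ▸ EReal.coe_lt_top _)
    obtain ⟨hvg, hvn⟩ := (incremental_lt_top_iff C D γ μ hτ _ _ uprev v).1 hlt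
    rw [hH u hug hu, hH v hvg hvn, EReal.coe_le_coe_iff] at hle
    have hq := hgrow v hvg hvn
    obtain ⟨c, hc, hcoer⟩ := P.exists_coercive hd C D hτ
    have h1 := hcoer _ (hug.sub_mem hvg)
    have h2 : ‖P.toState u - P.toState v‖ ^ 2 = 0 :=
      le_antisymm (by nlinarith) (sq_nonneg _)
    rw [sq_eq_zero_iff, norm_eq_zero, sub_eq_zero] at h2
    exact (P.toState_injective h2).symm
  · have hb := energy_balance_of_le _ uprev u δD (hgrow _ hcomp hcomp_fin)
    rw [hns, nonsmooth, ENNReal.toReal_add hfr hce] at hb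
    rw [energy_eq C γ hug hce, energy_eq C γ hprev hprev_fin, R1_eq_friction,
      ← EReal.coe_ennreal_toReal hfr, ← EReal.coe_add, ← EReal.coe_add, ← EReal.coe_add,
      EReal.coe_le_coe_iff]
    linarith
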